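/- Let $F$ be a sub-Gaussian distribution on $\mathbb{R}^d$ (for every $x$ there is a $K_x>0$ with $F\{z : |\langle z,x\rangle|>t\}\le 2e^{-t^2/K_x^2}$ for all $t\ge 0$) whose covariance matrix $\Xi$ is nonsingular, and let $Z_1,Z_2,\dots$ be i.i.d. with distribution $F$. For each $n$ let $D$ be the $n\times n$ matrix with entries $D_{ij}=\|Z_i-Z_j\|$, let $D^2$ denote its entrywise square, and suppose that $\max_{1\le i\le n}\sum_{j=1}^n D_{ij}^2\gg\log^4 n$ in probability, that is, for every $C$, $\mathbb{P}\{\max_{i}\sum_{j} D_{ij}^2\ge C\log^4 n\}\to 1$ as $n\to\infty$. For each $n$ let $\Delta^2=D^2+E$ (entrywise squares), where $E=E^{(n)}$ is a random $n\times n$ matrix, independent of $Z_1,\dots,Z_n$, such that (i) $\mathbb{E}[E]=0$; (ii) $E$ is symmetric with zero diagonal; (iii) the entries $E_{ij}$, $i<j$, are independent and $\mathrm{Var}(E_{ij})=\sigma^2$ for all $i\ne j$, with $\sigma^2$ not depending on $n$; (iv) the entries are uniformly sub-Gaussian: $\mathbb{P}(|E_{ij}|>t)\le 2e^{-t^2/K^2}$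 for all $t\ge0$, with one constant $K>0$ for all $i,j,n$. The entries need not be identically distributed. Let $\hat X_n=U S^{1/2}\in\mathbb{R}^{n\times d}$ be a classical multidimensional scaling (CMDS) embedding of $\Delta$, where $S$ is the diagonal matrix of the $d$ largest eigenvalues of $\hat B=-\tfrac12 P\Delta^2P$, $P=I-\tfrac1n\mathbf{1}\mathbf{1}^\top$, and the columns of $U$ are corresponding orthonormal eigenvectors. (Here any measurable choice of the eigenvectors is allowed, and $\hat X_n$ may be an arbitrary random matrix on the event that $\hat B$ has fewer than $d$ positive eigenvalues.) Then there exist random orthogonal $d\times d$ matrices $W_1,W_2,\dots$ such that, for every $\alpha\in\mathbb{R}^d$ and every fixed row index $i$, $$\lim_{n\to\infty}\mathbb{P}\bigl\{\sqrt n\,\bigl[(\hat X_nW_n)_i-(Z_i-\bar Z)\bigr]\le\alpha\bigr\}=\Phi\Bigl(\alpha,\tfrac{\sigma^2}{4}\Xi^{-1}\Bigr),$$ where $\bar Z=\frac1n\sum_{k=1}^nZ_k$, the inequality is coordinatewise, $(A)_i$ is the $i$-th row of $A$, and $\Phi(\cdot,\Sigma)$ is the cumulative distribution function of the Gaussian distribution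 $N(0,\Sigma)$ on $\mathbb{R}^d$. -/

import Mathlib

open MeasureTheory ProbabilityTheory Filter Topology
open scoped Matrix

noncomputable section

namespace CMDS

/-- The real random variable `X` is sub-Gaussian with constant `K > 0`:
`P(|X| > t) ≤ 2 exp(-t² / K²)` for all `t ≥ 0`. -/
def IsSubGaussianWith {Ω : Type*} [MeasurableSpace Ω] (X : Ω → ℝ) (K : ℝ) (P : Measure Ω) : Prop :=
  0 < K ∧ ∀ t : ℝ, 0 ≤ t → P.real {ω | t < |X ω|} ≤ 2 * Real.exp (-(t ^ 2 / K ^ 2))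

/-- A distribution on `ℝᵈ` is sub-Gaussian if all its one-dimensional marginals `⟨·, x⟩` are. -/
def IsSubGaussianDistribution {d : ℕ} (F : Measure (EuclideanSpace ℝ (Fin d))) : Prop :=
  ∀ x : EuclideanSpace ℝ (Fin d), ∃ K : ℝ, IsSubGaussianWith (fun z ↦ inner ℝ z x) K F

/-- The covariance matrix of a distribution on `ℝᵈ`. -/
def covMatrix {d : ℕ} (F : Measure (EuclideanSpace ℝ (Fin d))) : Matrix (Fin d) (Fin d) ℝ :=
  Matrix.of fun k l ↦ cov[fun z ↦ z k, fun z ↦ z l; F]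

/-- The matrix `D²` of squared Euclidean distances `‖zᵢ - zⱼ‖²` of the points `z₀, …, zₙ₋₁`. -/
def sqDist {d : ℕ} (n : ℕ) (z : ℕ → EuclideanSpace ℝ (Fin d)) : Matrix (Fin n) (Fin n) ℝ :=
  Matrix.of fun i j ↦ ‖z i - z j‖ ^ 2

/-- The sample mean of the points `z₀, …, zₙ₋₁`. -/
def sampleMean {d : ℕ} (n : ℕ) (z : ℕ → EuclideanSpace ℝ (Fin d)) : EuclideanSpace ℝ (Fin d) :=
  (n : ℝ)⁻¹ • ∑ i : Fin n, z i

/-- The centering matrix `P = I - 𝟏𝟏ᵀ / n`. -/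
def centering (n : ℕ) : Matrix (Fin n) (Fin n) ℝ :=
  1 - (n : ℝ)⁻¹ • Matrix.of fun _ _ ↦ 1

/-- The doubly centered matrix `B = -½ P Δ² P`, as a function of the matrix `Δsq = Δ²` of squared
dissimilarities. -/
def doubleCenter {n : ℕ} (Δsq : Matrix (Fin n) (Fin n) ℝ) : Matrix (Fin n) (Fin n) ℝ :=
  (-(1 / 2 : ℝ)) • (centering n * Δsq * centering n)

/-- `X` is a classical multidimensional scaling embedding into `ℝᵈ` of the dissimilarities whose
entrywise squares are `Δsq`: `X = U S^{1/2}`, where `S = diag s` holds the `d` largest eigenvalues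
of `B = -½ P Δ² P` (counted with multiplicity), all of them positive, and the columns of `U` are
corresponding orthonormal eigenvectors. That these eigenvalues are the largest ones is expressed
by the last clause: every eigenvalue of `B` on the orthogonal complement of the columns of `U` is at
most every `s k`. All choices of eigenvectors are allowed. -/
def IsCMDSEmbedding {n d : ℕ} (Δsq : Matrix (Fin n) (Fin n) ℝ) (X : Matrix (Fin n) (Fin d) ℝ) :
    Prop :=
  ∃ (U : Matrix (Fin n) (Fin d) ℝ) (s : Fin d → ℝ),
    Uᵀ * U = 1 ∧
    doubleCenter Δsq * U = U * Matrix.diagonal s ∧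
    (∀ k, 0 < s k) ∧
    (∀ (r : ℝ) (v : Fin n → ℝ), v ≠ 0 → Uᵀ *ᵥ v = 0 → doubleCenter Δsq *ᵥ v = r • v →
      ∀ k, r ≤ s k) ∧
    X = U * Matrix.diagonal fun k ↦ √(s k)

end CMDS

end

open scoped Matrix.Norms.Frobenius

namespace CMDS

/-! ### Frobenius norm inequalities -/

section Frobenius

variable {ι κ m : Type*} [Fintype ι] [Fintype κ] [Fintype m]

/-! Let Y be the centred data and N = −½PEP. The doubly centred matrix is YYᵀ + N, and an embedding
X = US^{1/2} satisfies (YYᵀ + N)X = X(XᵀX). This equation survives any rotation X ↦ XW. Take for W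
the orthogonal polar factor that makes YᵀXW positive semidefinite. Since then XW ≈ Y, the equation
suggests XW ≈ Y + NY(YᵀY)⁻¹. Up to a negligible row average, √n times row i of the correction is
−½√n ∑_j E_ij (Y(YᵀY)⁻¹)_j. Given the data, this is a sum of independent centred vectors whose
covariance is close to (σ²/4) n(YᵀY)⁻¹, which tends to (σ²/4)Ξ⁻¹.

The remainder is controlled deterministically in `norm_expansion_le`. The part V of X orthogonal to
the columns of Y is of first order in NY, whereas YᵀX and XᵀX differ from YᵀY only by terms of the
order of YᵀNY and of the square of NY (`norm_gram_sub_le`). Stability of the positive semidefinite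
square root turns closeness of (YᵀX)² and (YᵀY)² into closeness of YᵀX and YᵀY.
`norm_embedding_expansion_le` restores the scaling and leaves a remainder of order n^{-1/4} after
multiplication by √n.

No sharp operator norm bound is needed. The Frobenius norm of E² is of order n^{3/2}, so E has
operator norm of order n^{3/4}, and this weak bound enters the remainder only next to two further
small factors. For the product of a row of N with NY submultiplicativity would be too weak, so it is
bounded by its own second moment. All noise bounds are second moments given the data
(`IsNoise.lintegral_noiseSize_le`); they rest on the orthogonality of products of independent
centred entries and on fourth moments.

For the limit, `ae_isRegular` supplies the laws of large numbers, `tendsto_measure_rowError_sub`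
shows that the remainder vanishes in probability, `tendsto_integral_exp_row` is the central limit
theorem conditional on the data, and Slutsky's theorem combines them. If σ = 0, the limit is a point
mass and orthants need not be continuity sets; there the error vanishes exactly with high
probability. -/

lemma frobenius_norm_sq (A : Matrix ι κ ℝ) : ‖A‖ ^ 2 = ∑ i, ∑ j, A i j ^ 2 := by
  have h : 0 ≤ ∑ i, ∑ j, A i j ^ 2 := by positivity
  rw [Matrix.frobenius_norm_def]
  simp only [Real.rpow_two, Real.norm_eq_abs, sq_abs]
  rw [← Real.sqrt_eq_rpow, Real.sq_sqrt h]

lemma trace_transpose_mul_self (A : Matrix ι κ ℝ) : (Aᵀ * A).trace = ‖A‖ ^ 2 := by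
  rw [frobenius_norm_sq, Finset.sum_comm]
  simp [Matrix.trace, Matrix.mul_apply, sq]

lemma abs_trace_transpose_mul_le (A B : Matrix ι κ ℝ) : |(Aᵀ * B).trace| ≤ ‖A‖ * ‖B‖ := by
  have h : (Aᵀ * B).trace = ∑ p : κ × ι, A p.2 p.1 * B p.2 p.1 := by
    simp [Matrix.trace, Matrix.mul_apply, Fintype.sum_prod_type]
  have hs (A : Matrix ι κ ℝ) : ‖A‖ ^ 2 = ∑ p : κ × ι, A p.2 p.1 ^ 2 := by
    rw [frobenius_norm_sq, Finset.sum_comm, Fintype.sum_prod_type]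
  rw [h]
  apply abs_le_of_sq_le_sq _ (by positivity)
  rw [mul_pow, hs, hs]
  exact Finset.sum_mul_sq_le_sq_mul_sq _ _ _

lemma frobenius_norm_mul_le_of_le {A : Matrix ι κ ℝ} {B : Matrix κ m ℝ} {a b : ℝ}
    (hA : ‖A‖ ≤ a) (hB : ‖B‖ ≤ b) : ‖A * B‖ ≤ a * b :=
  (Matrix.frobenius_norm_mul A B).trans
    (mul_le_mul hA hB (norm_nonneg _) ((norm_nonneg _).trans hA))

/-- A symmetric matrix acts with operator norm at most `‖N²‖ ^ (1/2)`. -/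
lemma norm_mul_sq_le {N : Matrix ι ι ℝ} (hN : Nᵀ = N) (M : Matrix ι κ ℝ) :
    ‖N * M‖ ^ 2 ≤ ‖N * N‖ * ‖M‖ ^ 2 := by
  have h : ((N * M)ᵀ * (N * M)) = Mᵀ * ((N * N) * M) := by
    rw [Matrix.transpose_mul, hN]; simp only [Matrix.mul_assoc]
  rw [← trace_transpose_mul_self, h]
  calc (Mᵀ * (N * N * M)).trace ≤ ‖M‖ * ‖N * N * M‖ :=
        (le_abs_self _).trans (abs_trace_transpose_mul_le _ _)
    _ ≤ ‖M‖ * (‖N * N‖ * ‖M‖) := by gcongr; exact Matrix.frobenius_norm_mul _ _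
    _ = _ := by ring

/-- Both squared norms are the trace of (AAᵀ)², by cyclicity. This serves to remove the projection
in the middle of EPE. -/
lemma norm_transpose_mul_self (A : Matrix ι κ ℝ) : ‖Aᵀ * A‖ = ‖A * Aᵀ‖ := by
  rw [← sq_eq_sq₀ (norm_nonneg _) (norm_nonneg _), ← trace_transpose_mul_self,
    ← trace_transpose_mul_self]
  simp only [Matrix.transpose_mul, Matrix.transpose_transpose]
  rw [Matrix.mul_assoc, Matrix.trace_mul_comm]
  simp only [Matrix.mul_assoc]

lemma norm_projection_mul_le {Q : Matrix ι ι ℝ} (hQ : Qᵀ = Q) (hQQ : Q * Q = Q)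
    (M : Matrix ι κ ℝ) : ‖Q * M‖ ≤ ‖M‖ := by
  have h : ((Q * M)ᵀ * (Q * M)) = Mᵀ * (Q * M) := by
    rw [Matrix.transpose_mul, hQ, Matrix.mul_assoc, ← Matrix.mul_assoc Q, hQQ]
  have h1 : ‖Q * M‖ ^ 2 ≤ ‖M‖ * ‖Q * M‖ := by
    rw [← trace_transpose_mul_self, h]
    exact (le_abs_self _).trans (abs_trace_transpose_mul_le _ _)
  by_contra! h2
  nlinarith [norm_nonneg M]

lemma norm_mul_projection_le {Q : Matrix ι ι ℝ} (hQ : Qᵀ = Q) (hQQ : Q * Q = Q)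
    (M : Matrix κ ι ℝ) : ‖M * Q‖ ≤ ‖M‖ := by
  rw [← Matrix.frobenius_norm_transpose, Matrix.transpose_mul, hQ,
    ← Matrix.frobenius_norm_transpose M]
  exact norm_projection_mul_le hQ hQQ _

/-- A lower bound for the singular values of Y in terms of the inverse Γ of its Gram matrix: DᵀD =
(YD)ᵀ(YΓD), and Cauchy–Schwarz is combined with ‖YΓD‖² ≤ ‖Γ‖‖D‖². -/
lemma norm_sq_le_mul_norm_mul_sq [DecidableEq κ] {Y : Matrix ι κ ℝ} {Γ : Matrix κ κ ℝ}
    (hΓ : (Yᵀ * Y) * Γ = 1) (D : Matrix κ m ℝ) : ‖D‖ ^ 2 ≤ ‖Γ‖ * ‖Y * D‖ ^ 2 := by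
  have h1 : Dᵀ * D = (Y * D)ᵀ * (Y * (Γ * D)) := by
    rw [Matrix.transpose_mul, Matrix.mul_assoc, ← Matrix.mul_assoc Yᵀ, ← Matrix.mul_assoc (Yᵀ * Y),
      hΓ, Matrix.one_mul]
  have h2 : (Y * (Γ * D))ᵀ * (Y * (Γ * D)) = (Γ * D)ᵀ * D := by
    rw [Matrix.transpose_mul Y, Matrix.mul_assoc, ← Matrix.mul_assoc Yᵀ,
      ← Matrix.mul_assoc (Yᵀ * Y), hΓ, Matrix.one_mul]
  have h3 : ‖Y * (Γ * D)‖ ^ 2 ≤ ‖Γ‖ * ‖D‖ ^ 2 := by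
    rw [← trace_transpose_mul_self, h2]
    calc _ ≤ ‖Γ * D‖ * ‖D‖ := (le_abs_self _).trans (abs_trace_transpose_mul_le _ _)
      _ ≤ ‖Γ‖ * ‖D‖ * ‖D‖ := by gcongr; exact Matrix.frobenius_norm_mul _ _
      _ = _ := by ring
  have h4 : ‖D‖ ^ 2 ≤ ‖Y * D‖ * ‖Y * (Γ * D)‖ := by
    rw [← trace_transpose_mul_self, h1]
    exact (le_abs_self _).trans (abs_trace_transpose_mul_le _ _)
  rcases eq_or_lt_of_le (norm_nonneg D) with h0 | h0
  · have : ‖D‖ ^ 2 = 0 := by rw [← h0]; norm_num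
    rw [this]; positivity
  · have h5 : (‖D‖ ^ 2) ^ 2 ≤ ‖Y * D‖ ^ 2 * (‖Γ‖ * ‖D‖ ^ 2) :=
      calc _ ≤ (‖Y * D‖ * ‖Y * (Γ * D)‖) ^ 2 := by gcongr
        _ = ‖Y * D‖ ^ 2 * ‖Y * (Γ * D)‖ ^ 2 := by ring
        _ ≤ _ := by gcongr
    have h6 : 0 < ‖D‖ ^ 2 := by positivity
    nlinarith

/-- Stability of the positive semidefinite square root. -/
lemma norm_sub_le_of_posSemidef [DecidableEq κ] {Y : Matrix ι κ ℝ} {A Γ : Matrix κ κ ℝ}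
    (hΓ : (Yᵀ * Y) * Γ = 1) (hA : A.PosSemidef) :
    ‖A - Yᵀ * Y‖ ≤ ‖Γ‖ * ‖A * A - (Yᵀ * Y) * (Yᵀ * Y)‖ := by
  set G := Yᵀ * Y with hG
  set D := A - G with hD
  have hAT : Aᵀ = A := by simpa using hA.isHermitian.eq
  have hGT : Gᵀ = G := by rw [hG, Matrix.transpose_mul, Matrix.transpose_transpose]
  have hDT : Dᵀ = D := by rw [hD, Matrix.transpose_sub, hAT, hGT]
  -- This identity is tested against D in the trace inner product: AD contributes a nonnegative
  -- amount because A is positive semidefinite, and DG contributes ‖YD‖², which controls ‖D‖².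
  have h1 : A * A - G * G = A * D + D * G := by rw [hD]; noncomm_ring
  have h2 : (Dᵀ * (A * D)).trace ≥ 0 := by
    have := (hA.conjTranspose_mul_mul_same D).trace_nonneg
    simpa [Matrix.mul_assoc] using this
  have h3 : (Dᵀ * (D * G)).trace = ‖Y * D‖ ^ 2 := by
    rw [← trace_transpose_mul_self, Matrix.transpose_mul, hDT, ← Matrix.mul_assoc,
      Matrix.trace_mul_comm, ← Matrix.mul_assoc, Matrix.trace_mul_comm, hG]
    simp only [Matrix.mul_assoc]
  have h4 := norm_sq_le_mul_norm_mul_sq hΓ D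
  have h5 : ‖Y * D‖ ^ 2 ≤ ‖D‖ * ‖A * A - G * G‖ := by
    have := (le_abs_self _).trans (abs_trace_transpose_mul_le D (A * A - G * G))
    rw [h1, Matrix.mul_add, Matrix.trace_add, h3] at this
    rw [h1]; linarith
  by_contra! h6
  have h7 : ‖D‖ ^ 2 ≤ ‖Γ‖ * (‖D‖ * ‖A * A - G * G‖) := h4.trans (by gcongr)
  have h8 : 0 < ‖D‖ := lt_of_le_of_lt (by positivity) h6
  nlinarith

end Frobenius

/-! ### Component of the embedding orthogonal to the data -/

section Expansion

variable {ι κ m : Type*} [Fintype ι] [Fintype κ] [Fintype m] [DecidableEq κ]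

/-- With Q = I − YΓYᵀ, the projection off the columns of Y, the equation for X becomes QNX =
QX(XᵀX), because Q kills YYᵀX. Then Θ cancels the Gram factor. -/
lemma perp_eq {Y X : Matrix ι κ ℝ} {N : Matrix ι ι ℝ} {Γ Θ : Matrix κ κ ℝ}
    (hΓ' : Γ * (Yᵀ * Y) = 1) (hΘ : (Xᵀ * X) * Θ = 1)
    (hX : (Y * Yᵀ + N) * X = X * (Xᵀ * X)) :
    X - Y * (Γ * (Yᵀ * X)) = (N * X - Y * (Γ * (Yᵀ * (N * X)))) * Θ := by
  have h1 : Y * (Γ * (Yᵀ * ((Y * Yᵀ) * X))) = (Y * Yᵀ) * X := by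
    calc _ = Y * ((Γ * (Yᵀ * Y)) * (Yᵀ * X)) := by simp only [Matrix.mul_assoc]
      _ = _ := by rw [hΓ', Matrix.one_mul, Matrix.mul_assoc]
  have h2 : N * X - Y * (Γ * (Yᵀ * (N * X)))
      = (X - Y * (Γ * (Yᵀ * X))) * (Xᵀ * X) := by
    calc _ = ((Y * Yᵀ) * X + N * X) - Y * (Γ * (Yᵀ * ((Y * Yᵀ) * X + N * X))) := by
          rw [Matrix.mul_add, Matrix.mul_add, Matrix.mul_add, h1]; abel
      _ = X * (Xᵀ * X) - Y * (Γ * (Yᵀ * (X * (Xᵀ * X)))) := by rw [← Matrix.add_mul, hX]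
      _ = _ := by rw [Matrix.sub_mul]; simp only [Matrix.mul_assoc]
  rw [h2, Matrix.mul_assoc, hΘ, Matrix.mul_one]

/-- The two bounds feed each other. With V the orthogonal component, `perp_eq` gives ‖V‖ ≤ 2L⁴‖NX‖,
and splitting X gives ‖NX‖ ≤ bL³ + ρ‖V‖. Smallness of 4L⁴ρ lets ‖V‖ be absorbed, so ρ affects
neither final bound. -/
lemma norm_perp_le {Y X : Matrix ι κ ℝ} {N : Matrix ι ι ℝ} {Γ Θ : Matrix κ κ ℝ} {L ρ b : ℝ}
    (hL : 1 ≤ L) (hΓ' : Γ * (Yᵀ * Y) = 1) (hΘ : (Xᵀ * X) * Θ = 1)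
    (hX : (Y * Yᵀ + N) * X = X * (Xᵀ * X))
    (hΓL : ‖Γ‖ ≤ L) (hΘL : ‖Θ‖ ≤ L) (hYL : ‖Y‖ ≤ L) (hXL : ‖X‖ ≤ L)
    (hρ : ∀ M : Matrix ι κ ℝ, ‖N * M‖ ≤ ρ * ‖M‖) (hb : ‖N * Y‖ ≤ b) (hρL : 4 * L ^ 4 * ρ ≤ 1) :
    ‖X - Y * (Γ * (Yᵀ * X))‖ ≤ 4 * L ^ 7 * b ∧ ‖N * X‖ ≤ 2 * L ^ 3 * b := by
  set V := X - Y * (Γ * (Yᵀ * X)) with hV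
  have hb0 : 0 ≤ b := (norm_nonneg _).trans hb
  have hYT : ‖Yᵀ‖ ≤ L := by rwa [Matrix.frobenius_norm_transpose]
  have h1 : ‖N * X‖ ≤ b * L ^ 3 + ρ * ‖V‖ := by
    have : N * X = (N * Y) * (Γ * (Yᵀ * X)) + N * V := by
      rw [hV, Matrix.mul_sub, Matrix.mul_assoc]; abel
    rw [this]
    refine (norm_add_le _ _).trans (add_le_add ?_ (hρ V))
    refine (frobenius_norm_mul_le_of_le hb (frobenius_norm_mul_le_of_le hΓL
      (frobenius_norm_mul_le_of_le hYT hXL))).trans (le_of_eq (by ring))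
  have h2 : ‖V‖ ≤ (2 * L ^ 4) * ‖N * X‖ := by
    rw [hV, perp_eq hΓ' hΘ hX]
    calc _ ≤ (‖N * X‖ + L * (L * (L * ‖N * X‖))) * L := by
          refine frobenius_norm_mul_le_of_le ((norm_sub_le _ _).trans (add_le_add le_rfl ?_)) hΘL
          exact frobenius_norm_mul_le_of_le hYL (frobenius_norm_mul_le_of_le hΓL
            (frobenius_norm_mul_le_of_le hYT le_rfl))
      _ = L * ‖N * X‖ + L ^ 4 * ‖N * X‖ := by ring
      _ ≤ L ^ 4 * ‖N * X‖ + L ^ 4 * ‖N * X‖ := by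
          gcongr; exact le_self_pow₀ hL (by norm_num)
      _ = _ := by ring
  have h3 : ‖V‖ ≤ 4 * L ^ 7 * b := by
    have : (2 * L ^ 4) * ‖N * X‖ ≤ (2 * L ^ 4) * (b * L ^ 3 + ρ * ‖V‖) := by gcongr
    have h5 : 4 * L ^ 4 * ρ * ‖V‖ ≤ 1 * ‖V‖ := by gcongr
    nlinarith
  refine ⟨h3, ?_⟩
  have h5 : 4 * L ^ 4 * ρ * ‖V‖ ≤ 1 * ‖V‖ := by gcongr
  have hL4 : 0 < 4 * L ^ 4 := by positivity
  have h6 : ρ * ‖V‖ ≤ L ^ 3 * b := by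
    have h7 : 4 * L ^ 4 * (ρ * ‖V‖) ≤ 4 * L ^ 4 * (L ^ 3 * b) := by nlinarith
    exact le_of_mul_le_mul_left h7 hL4
  linarith

end Expansion

/-! ### Gram matrices and the first-order row expansion -/

section Expansion

variable {ι κ m : Type*} [Fintype ι] [Fintype κ] [Fintype m] [DecidableEq κ]

/-- Pythagoras: X is the sum of its projection YΓ(YᵀX) and an orthogonal component. Symmetry of YᵀX
removes the transpose from the Gram matrix of the projection. -/
lemma gram_eq {Y X : Matrix ι κ ℝ} {Γ : Matrix κ κ ℝ} (hΓ : (Yᵀ * Y) * Γ = 1)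
    (hA : (Yᵀ * X)ᵀ = Yᵀ * X) :
    Xᵀ * X = (Yᵀ * X) * (Γ * (Yᵀ * X)) +
      (X - Y * (Γ * (Yᵀ * X)))ᵀ * (X - Y * (Γ * (Yᵀ * X))) := by
  set A := Yᵀ * X with hAd
  set V := X - Y * (Γ * A) with hV
  have hYV : Yᵀ * V = 0 := by
    rw [hV, Matrix.mul_sub, ← Matrix.mul_assoc, ← Matrix.mul_assoc, hΓ, Matrix.one_mul, sub_self]
  have hVY : Vᵀ * Y = 0 := by
    rw [← Matrix.transpose_transpose Y, ← Matrix.transpose_mul, hYV, Matrix.transpose_zero]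
  have hΓT : Γᵀ = Γ := by
    have h1 : Γᵀ * (Yᵀ * Y) = 1 := by
      have := congrArg Matrix.transpose hΓ
      simpa [Matrix.transpose_mul] using this
    calc Γᵀ = Γᵀ * ((Yᵀ * Y) * Γ) := by rw [hΓ, Matrix.mul_one]
      _ = Γ := by rw [← Matrix.mul_assoc, h1, Matrix.one_mul]
  have hX : X = Y * (Γ * A) + V := by rw [hV]; abel
  have h2 : (Y * (Γ * A))ᵀ * (Y * (Γ * A)) = A * (Γ * A) := by
    rw [Matrix.transpose_mul, Matrix.transpose_mul, hΓT, hA]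
    calc _ = A * (Γ * (((Yᵀ * Y) * Γ) * A)) := by simp only [Matrix.mul_assoc]
      _ = _ := by rw [hΓ, Matrix.one_mul]
  have h3 : (Y * (Γ * A))ᵀ * V = 0 := by
    rw [Matrix.transpose_mul, Matrix.mul_assoc, hYV, Matrix.mul_zero]
  have h4 : Vᵀ * (Y * (Γ * A)) = 0 := by
    rw [← Matrix.mul_assoc, hVY, Matrix.zero_mul]
  calc Xᵀ * X = (Y * (Γ * A) + V)ᵀ * (Y * (Γ * A) + V) := by rw [← hX]
    _ = _ := by
      rw [Matrix.transpose_add, Matrix.add_mul, Matrix.mul_add, Matrix.mul_add, h2, h3, h4]; abel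

/-- YᵀNX is of second order: the projection of X contributes YᵀNY, and the orthogonal component V
contributes the product of the two small factors YᵀN and V. -/
lemma norm_cross_gram_le {Y X : Matrix ι κ ℝ} {N : Matrix ι ι ℝ} {Γ : Matrix κ κ ℝ}
    {L b q : ℝ} (hL : 1 ≤ L) (hN : Nᵀ = N)
    (hΓL : ‖Γ‖ ≤ L) (hYL : ‖Y‖ ≤ L) (hXL : ‖X‖ ≤ L)
    (hb : ‖N * Y‖ ≤ b) (hq : ‖Yᵀ * (N * Y)‖ ≤ q)
    (hV : ‖X - Y * (Γ * (Yᵀ * X))‖ ≤ 4 * L ^ 7 * b) :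
    ‖Yᵀ * (N * X)‖ ≤ 4 * L ^ 7 * (q + b ^ 2) := by
  have hYT : ‖Yᵀ‖ ≤ L := by rwa [Matrix.frobenius_norm_transpose]
  have hb0 : 0 ≤ b := (norm_nonneg _).trans hb
  have hq0 : 0 ≤ q := (norm_nonneg _).trans hq
  have hYN : ‖Yᵀ * N‖ ≤ b := by
    rwa [← Matrix.frobenius_norm_transpose, Matrix.transpose_mul, hN, Matrix.transpose_transpose]
  set V := X - Y * (Γ * (Yᵀ * X)) with hVd
  have h : Yᵀ * (N * X) = (Yᵀ * (N * Y)) * (Γ * (Yᵀ * X)) + (Yᵀ * N) * V := by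
    rw [hVd, Matrix.mul_sub]; simp only [Matrix.mul_assoc]; abel
  rw [h]
  calc _ ≤ q * (L * (L * L)) + b * (4 * L ^ 7 * b) :=
        (norm_add_le _ _).trans (add_le_add (frobenius_norm_mul_le_of_le hq
          (frobenius_norm_mul_le_of_le hΓL (frobenius_norm_mul_le_of_le hYT hXL)))
          (frobenius_norm_mul_le_of_le hYN hV))
    _ = q * L ^ 3 + 4 * L ^ 7 * b ^ 2 := by ring
    _ ≤ q * (4 * L ^ 7) + 4 * L ^ 7 * b ^ 2 := by
        gcongr
        calc L ^ 3 ≤ L ^ 7 := pow_le_pow_right₀ hL (by norm_num)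
          _ ≤ 4 * L ^ 7 := by nlinarith [show 0 < L ^ 7 by positivity]
    _ = _ := by ring

/-- Write A = YᵀX, T = XᵀX, G = YᵀY, R = YᵀNX, K = VᵀV. Multiplying the equation for X by Yᵀ gives
AT = GA + R. Inserting T = AΓA + K yields (A²Γ − G)A = R − AK, so A² is close to G². Positive
semidefiniteness of A, the reason for choosing the polar rotation, then makes A close to G. -/
lemma norm_gram_sub_le {Y X : Matrix ι κ ℝ} {N : Matrix ι ι ℝ} {Γ Θ : Matrix κ κ ℝ} {L b q : ℝ}
    (hL : 1 ≤ L) (hN : Nᵀ = N) (hΓ : (Yᵀ * Y) * Γ = 1) (hΓ' : Γ * (Yᵀ * Y) = 1)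
    (hΘ : (Xᵀ * X) * Θ = 1) (hX : (Y * Yᵀ + N) * X = X * (Xᵀ * X)) (hA : (Yᵀ * X).PosSemidef)
    (hΓL : ‖Γ‖ ≤ L) (hΘL : ‖Θ‖ ≤ L) (hYL : ‖Y‖ ≤ L) (hXL : ‖X‖ ≤ L)
    (hb : ‖N * Y‖ ≤ b) (hq : ‖Yᵀ * (N * Y)‖ ≤ q)
    (hV : ‖X - Y * (Γ * (Yᵀ * X))‖ ≤ 4 * L ^ 7 * b) (hbL : 32 * L ^ 15 * b ^ 2 ≤ 1)
    (hqL : 40 * L ^ 24 * (q + b ^ 2) ≤ 1) :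
    ‖Yᵀ * X - Yᵀ * Y‖ ≤ 40 * L ^ 23 * (q + b ^ 2) ∧
    ‖Yᵀ * X - Xᵀ * X‖ ≤ 100 * L ^ 23 * (q + b ^ 2) := by
  have hAT : (Yᵀ * X)ᵀ = Yᵀ * X := by simpa using hA.isHermitian.eq
  have hL0 : 0 ≤ L := by linarith
  have hT := gram_eq hΓ hAT
  have hR := norm_cross_gram_le hL hN hΓL hYL hXL hb hq hV
  have hYT : ‖Yᵀ‖ ≤ L := by rwa [Matrix.frobenius_norm_transpose]
  have hb0 : 0 ≤ b := (norm_nonneg _).trans hb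
  have hq0 : 0 ≤ q := (norm_nonneg _).trans hq
  have hAL : ‖Yᵀ * X‖ ≤ L * L := frobenius_norm_mul_le_of_le hYT hXL
  have hAX : (Yᵀ * X) * (Xᵀ * X) = (Yᵀ * Y) * (Yᵀ * X) + Yᵀ * (N * X) := by
    rw [Matrix.mul_assoc, ← hX, Matrix.add_mul, Matrix.mul_add]; simp only [Matrix.mul_assoc]
  set R := Yᵀ * (N * X) with hRd
  set V := X - Y * (Γ * (Yᵀ * X)) with hVd
  set K := Vᵀ * V with hKd
  have hVT : ‖Vᵀ‖ ≤ 4 * L ^ 7 * b := by rwa [Matrix.frobenius_norm_transpose]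
  have hK : ‖K‖ ≤ 16 * L ^ 14 * b ^ 2 :=
    (frobenius_norm_mul_le_of_le hVT hV).trans (le_of_eq (by ring))
  set A := Yᵀ * X with hAd
  set T := Xᵀ * X with hTd
  set G := Yᵀ * Y with hGd
  set Υ := A * A * Γ - G with hΥd
  have hGL : ‖G‖ ≤ L * L := frobenius_norm_mul_le_of_le hYT hYL
  have hΥA : Υ * A = R - A * K := by
    have : A * (A * (Γ * A) + K) = G * A + R := by rw [← hT, hAX]
    have h2 : Υ * A = A * (A * (Γ * A) + K) - A * K - G * A := by rw [hΥd]; noncomm_ring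
    rw [h2, this]; abel
  -- This takes the place of a bound on A⁻¹: the identity is TΘ = AΓAΘ + KΘ, the first summand
  -- starts with A, and the second has norm at most 1/2 and is absorbed.
  have hΥ1 : Υ = (R - A * K) * (Γ * (A * Θ)) + Υ * (K * Θ) := by
    rw [← hΥA]
    calc Υ = Υ * ((A * (Γ * A) + K) * Θ) := by rw [← hT, hΘ, Matrix.mul_one]
      _ = _ := by noncomm_ring
  have hQ : ‖R - A * K‖ ≤ 20 * L ^ 16 * (q + b ^ 2) := by
    calc _ ≤ 4 * L ^ 7 * (q + b ^ 2) + (L * L) * (16 * L ^ 14 * b ^ 2) :=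
          (norm_sub_le _ _).trans (add_le_add hR (frobenius_norm_mul_le_of_le hAL hK))
      _ = 4 * L ^ 7 * (q + b ^ 2) + 16 * L ^ 16 * b ^ 2 := by ring
      _ ≤ 4 * L ^ 16 * (q + b ^ 2) + 16 * L ^ 16 * (q + b ^ 2) := by
          gcongr
          · norm_num
          · linarith
      _ = _ := by ring
  have hKΘ : ‖K * Θ‖ ≤ 1 / 2 := by
    calc _ ≤ 16 * L ^ 14 * b ^ 2 * L := frobenius_norm_mul_le_of_le hK hΘL
      _ = (32 * L ^ 15 * b ^ 2) / 2 := by ring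
      _ ≤ _ := by linarith
  have hΥ : ‖Υ‖ ≤ 40 * L ^ 20 * (q + b ^ 2) := by
    have h1 : ‖Υ‖ ≤ (20 * L ^ 16 * (q + b ^ 2)) * (L * (L * L * L)) + ‖Υ‖ * (1 / 2) := by
      calc ‖Υ‖ = ‖(R - A * K) * (Γ * (A * Θ)) + Υ * (K * Θ)‖ := by rw [← hΥ1]
        _ ≤ _ := (norm_add_le _ _).trans (add_le_add (frobenius_norm_mul_le_of_le hQ
          (frobenius_norm_mul_le_of_le hΓL (frobenius_norm_mul_le_of_le hAL hΘL)))
          (frobenius_norm_mul_le_of_le le_rfl hKΘ))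
    linarith
  have hM : A * A - G * G = Υ * G := by
    rw [hΥd, Matrix.sub_mul, Matrix.mul_assoc (A * A), hΓ', Matrix.mul_one]
  have hD : ‖A - G‖ ≤ 40 * L ^ 23 * (q + b ^ 2) := by
    calc ‖A - G‖ ≤ ‖Γ‖ * ‖A * A - G * G‖ := norm_sub_le_of_posSemidef hΓ hA
      _ ≤ L * ((40 * L ^ 20 * (q + b ^ 2)) * (L * L)) := by
          rw [hM]; gcongr; exact frobenius_norm_mul_le_of_le hΥ hGL
      _ = _ := by ring
  refine ⟨hD, ?_⟩
  set D := A - G with hDd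
  -- Substituting A = G + D into T = AΓA + K gives T = G + 2D + DΓD + K.
  have hATd : A - T = -(D + D * (Γ * D) + K) := by
    have hA1 : A = G + D := by rw [hDd]; abel
    have h2 : A * (Γ * A) = G + D + D + D * (Γ * D) := by
      rw [hA1]
      calc _ = G * Γ * G + G * Γ * D + D * (Γ * G) + D * (Γ * D) := by noncomm_ring
        _ = _ := by rw [hΓ, hΓ', Matrix.one_mul, Matrix.one_mul, Matrix.mul_one]
    rw [hT, h2, hDd]; abel
  rw [hATd, norm_neg]
  calc _ ≤ ‖D‖ + ‖D‖ * (L * (40 * L ^ 23 * (q + b ^ 2))) + 16 * L ^ 14 * b ^ 2 := by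
        refine (norm_add_le _ _).trans (add_le_add ((norm_add_le _ _).trans (add_le_add le_rfl ?_)) hK)
        exact frobenius_norm_mul_le_of_le le_rfl (frobenius_norm_mul_le_of_le hΓL hD)
    _ = ‖D‖ + ‖D‖ * (40 * L ^ 24 * (q + b ^ 2)) + 16 * L ^ 14 * b ^ 2 := by ring
    _ ≤ ‖D‖ + ‖D‖ * 1 + 20 * L ^ 23 * (q + b ^ 2) := by
        gcongr
        · norm_num
        · norm_num
        · linarith
    _ ≤ _ := by linarith

/-- First order expansion of the solution `X` of `(Y Yᵀ + N) X = X (Xᵀ X)`, applied to a row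
vector (or several of them) `e`. -/
theorem norm_expansion_le {Y X : Matrix ι κ ℝ} {N : Matrix ι ι ℝ} {Γ Θ : Matrix κ κ ℝ}
    {e : Matrix m ι ℝ} {L ρ b q r p y : ℝ}
    (hL : 1 ≤ L) (hN : Nᵀ = N) (hΓ : (Yᵀ * Y) * Γ = 1)
    (hΘ : (Xᵀ * X) * Θ = 1) (hX : (Y * Yᵀ + N) * X = X * (Xᵀ * X)) (hA : (Yᵀ * X).PosSemidef)
    (hΓL : ‖Γ‖ ≤ L) (hΘL : ‖Θ‖ ≤ L) (hYL : ‖Y‖ ≤ L) (hXL : ‖X‖ ≤ L)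
    (hρ : ∀ M : Matrix ι κ ℝ, ‖N * M‖ ≤ ρ * ‖M‖) (hρ0 : 0 ≤ ρ)
    (hb : ‖N * Y‖ ≤ b) (hq : ‖Yᵀ * (N * Y)‖ ≤ q)
    (hy : ‖e * Y‖ ≤ y) (hr : ‖e * N‖ ≤ r) (hp : ‖e * N * (N * Y)‖ ≤ p)
    (hρL : 4 * L ^ 4 * ρ ≤ 1) (hbL : 32 * L ^ 15 * b ^ 2 ≤ 1)
    (hqL : 40 * L ^ 24 * (q + b ^ 2) ≤ 1) :
    ‖e * X - e * Y - e * N * Y * Γ‖ ≤ 200 * L ^ 27 * ((y + r) * (q + b ^ 2) + p + r * ρ * b) := by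
  have hΓ' : Γ * (Yᵀ * Y) = 1 := mul_eq_one_comm.1 hΓ
  have hL0 : 0 ≤ L := by linarith
  obtain ⟨hV, hNX⟩ := norm_perp_le hL hΓ' hΘ hX hΓL hΘL hYL hXL hρ hb hρL
  obtain ⟨hD, hAT⟩ :=
    norm_gram_sub_le hL hN hΓ hΓ' hΘ hX hA hΓL hΘL hYL hXL hb hq hV hbL hqL
  have hR := norm_cross_gram_le hL hN hΓL hYL hXL hb hq hV
  have hVe := perp_eq hΓ' hΘ hX
  have hb0 : 0 ≤ b := (norm_nonneg _).trans hb
  have hq0 : 0 ≤ q := (norm_nonneg _).trans hq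
  have hr0 : 0 ≤ r := (norm_nonneg _).trans hr
  have hy0 : 0 ≤ y := (norm_nonneg _).trans hy
  have hp0 : 0 ≤ p := (norm_nonneg _).trans hp
  have hYT : ‖Yᵀ‖ ≤ L := by rwa [Matrix.frobenius_norm_transpose]
  have hAL : ‖Yᵀ * X‖ ≤ L * L := frobenius_norm_mul_le_of_le hYT hXL
  set V := X - Y * (Γ * (Yᵀ * X)) with hVd
  have hXe : X = (Y * (Yᵀ * X) + N * X) * Θ := by
    calc X = X * ((Xᵀ * X) * Θ) := by rw [hΘ, Matrix.mul_one]
      _ = (X * (Xᵀ * X)) * Θ := by simp only [Matrix.mul_assoc]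
      _ = _ := by rw [← hX, Matrix.add_mul]; simp only [Matrix.mul_assoc]
  have hXY : X - Y = Y * (Γ * (Yᵀ * X - Yᵀ * Y)) + V := by
    rw [hVd, Matrix.mul_sub, hΓ', Matrix.mul_sub, Matrix.mul_one]; abel
  have hΘΓ : Θ - Γ = Θ * ((Yᵀ * Y - Xᵀ * X) * Γ) := by
    rw [Matrix.sub_mul, Matrix.mul_sub, hΓ, Matrix.mul_one, ← Matrix.mul_assoc Θ,
      mul_eq_one_comm.1 hΘ, Matrix.one_mul]
  have hYΘ : Y = Y * (Xᵀ * X) * Θ := by rw [Matrix.mul_assoc, hΘ, Matrix.mul_one]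
  -- From X = (Y(YᵀX) + NX)Θ, the remainder splits into eY(YᵀX − XᵀX)Θ, eNY(Θ − Γ) and eN(X − Y)Θ.
  -- In the last, the part eNVΘ is rewritten by `perp_eq`. This produces eN·NX, for which p and rρb
  -- give more than the product of ‖eN‖ and ‖V‖ would.
  have key : e * X - e * Y - e * N * Y * Γ =
      (e * Y) * ((Yᵀ * X - Xᵀ * X) * Θ) + (e * N) * (Y * (Θ * ((Yᵀ * Y - Xᵀ * X) * Γ)))
      + ((e * N) * (Y * (Γ * ((Yᵀ * X - Yᵀ * Y) * Θ)))
        + (e * N * (N * X) - (e * N) * (Y * (Γ * (Yᵀ * (N * X))))) * (Θ * Θ)) := by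
    have e1 : e * X - e * Y - e * N * Y * Γ = (e * Y) * ((Yᵀ * X - Xᵀ * X) * Θ)
        + (e * N) * (Y * (Θ - Γ)) + (e * N) * ((X - Y) * Θ) := by
      have : e * X = e * Y * ((Yᵀ * X) * Θ) + e * N * (X * Θ) := by
        conv_lhs => rw [hXe]
        simp only [Matrix.add_mul, Matrix.mul_add, Matrix.mul_assoc]
      rw [this, Matrix.sub_mul, hΘ]
      simp only [Matrix.mul_sub, Matrix.sub_mul, Matrix.mul_one, Matrix.mul_assoc]
      abel
    have e2 : (e * N * (N * X) - (e * N) * (Y * (Γ * (Yᵀ * (N * X))))) * (Θ * Θ)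
        = (e * N) * (V * Θ) := by
      rw [hVe]; simp only [Matrix.mul_sub, Matrix.sub_mul, Matrix.mul_assoc]
    rw [e1, e2, hΘΓ, hXY, Matrix.add_mul, Matrix.mul_add (e * N)]
    simp only [Matrix.mul_assoc]
  set s := q + b ^ 2 with hs
  have hs0 : 0 ≤ s := by positivity
  have hGT : ‖Yᵀ * Y - Xᵀ * X‖ ≤ 140 * L ^ 23 * s := by
    have : Yᵀ * Y - Xᵀ * X = (Yᵀ * X - Xᵀ * X) - (Yᵀ * X - Yᵀ * Y) := by abel
    rw [this]
    exact (norm_sub_le _ _).trans ((add_le_add hAT hD).trans (le_of_eq (by ring)))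
  have hNNX : ‖e * N * (N * X)‖ ≤ p * L ^ 3 + 4 * L ^ 7 * (r * ρ * b) := by
    have : e * N * (N * X) = e * N * (N * Y) * (Γ * (Yᵀ * X)) + e * N * (N * V) := by
      rw [hVd, Matrix.mul_sub, Matrix.mul_sub]; simp only [Matrix.mul_assoc]; abel
    rw [this]
    refine (norm_add_le _ _).trans (add_le_add ?_ ?_)
    · exact (frobenius_norm_mul_le_of_le hp (frobenius_norm_mul_le_of_le hΓL hAL)).trans
        (le_of_eq (by ring))
    · refine (frobenius_norm_mul_le_of_le hr ((hρ V).trans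
        (mul_le_mul_of_nonneg_left hV hρ0))).trans (le_of_eq (by ring))
  rw [key]
  have t1 : ‖(e * Y) * ((Yᵀ * X - Xᵀ * X) * Θ)‖ ≤ 100 * L ^ 27 * (y * s) := by
    calc _ ≤ y * (100 * L ^ 23 * s * L) :=
          frobenius_norm_mul_le_of_le hy (frobenius_norm_mul_le_of_le hAT hΘL)
      _ = 100 * L ^ 24 * (y * s) := by ring
      _ ≤ _ := by gcongr; norm_num
  have t2 : ‖(e * N) * (Y * (Θ * ((Yᵀ * Y - Xᵀ * X) * Γ)))‖ ≤ 140 * L ^ 27 * (r * s) := by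
    calc _ ≤ r * (L * (L * (140 * L ^ 23 * s * L))) :=
          frobenius_norm_mul_le_of_le hr (frobenius_norm_mul_le_of_le hYL
            (frobenius_norm_mul_le_of_le hΘL (frobenius_norm_mul_le_of_le hGT hΓL)))
      _ = 140 * L ^ 26 * (r * s) := by ring
      _ ≤ _ := by gcongr; norm_num
  have t3 : ‖(e * N) * (Y * (Γ * ((Yᵀ * X - Yᵀ * Y) * Θ)))‖ ≤ 40 * L ^ 27 * (r * s) := by
    calc _ ≤ r * (L * (L * (40 * L ^ 23 * s * L))) :=
          frobenius_norm_mul_le_of_le hr (frobenius_norm_mul_le_of_le hYL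
            (frobenius_norm_mul_le_of_le hΓL (frobenius_norm_mul_le_of_le hD hΘL)))
      _ = 40 * L ^ 26 * (r * s) := by ring
      _ ≤ _ := by gcongr; norm_num
  have t4 : ‖(e * N * (N * X) - (e * N) * (Y * (Γ * (Yᵀ * (N * X))))) * (Θ * Θ)‖ ≤
      L ^ 27 * p + 4 * L ^ 27 * (r * ρ * b) + 4 * L ^ 27 * (r * s) := by
    calc _ ≤ ((p * L ^ 3 + 4 * L ^ 7 * (r * ρ * b)) + r * (L * (L * (4 * L ^ 7 * s)))) * (L * L) :=
          frobenius_norm_mul_le_of_le ((norm_sub_le _ _).trans (add_le_add hNNX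
            (frobenius_norm_mul_le_of_le hr (frobenius_norm_mul_le_of_le hYL
              (frobenius_norm_mul_le_of_le hΓL hR))))) (frobenius_norm_mul_le_of_le hΘL hΘL)
      _ = L ^ 5 * p + 4 * L ^ 9 * (r * ρ * b) + 4 * L ^ 11 * (r * s) := by ring
      _ ≤ _ := by gcongr <;> norm_num
  have hpL : 0 ≤ L ^ 27 * p := by positivity
  have hysL : 0 ≤ L ^ 27 * (y * s) := by positivity
  have hrsL : 0 ≤ L ^ 27 * (r * s) := by positivity
  have hrbL : 0 ≤ L ^ 27 * (r * ρ * b) := by positivity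
  calc _ ≤ 100 * L ^ 27 * (y * s) + 140 * L ^ 27 * (r * s) + (40 * L ^ 27 * (r * s) +
        (L ^ 27 * p + 4 * L ^ 27 * (r * ρ * b) + 4 * L ^ 27 * (r * s))) :=
        (norm_add_le _ _).trans (add_le_add ((norm_add_le _ _).trans (add_le_add t1 t2))
          ((norm_add_le _ _).trans (add_le_add t3 t4)))
    _ ≤ _ := by nlinarith

end Expansion

/-! ### Leading eigenvalues of the perturbed Gram matrix -/

section Spectral

variable {ι κ m : Type*} [Fintype ι] [Fintype κ] [Fintype m] [DecidableEq ι] [DecidableEq κ]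

/-- The matrix s_k·1 − C is B with all eigenvalues belonging to U replaced by s_k. An eigenvector of
C with negative eigenvalue would be orthogonal to U, since UᵀC = 0, and would be an eigenvector of B
with eigenvalue above s_k. Hence C is positive semidefinite. On the given V it acts as s_k − B,
because UᵀV lives in row k only. No ordering of s is needed. -/
lemma trace_quadForm_le {B : Matrix ι ι ℝ} (hB : Bᵀ = B) {U : Matrix ι κ ℝ} {s : κ → ℝ}
    (hU : Uᵀ * U = 1) (hBU : B * U = U * Matrix.diagonal s) (k : κ)
    (hmax : ∀ (r : ℝ) (v : ι → ℝ), v ≠ 0 → Uᵀ *ᵥ v = 0 → B *ᵥ v = r • v → r ≤ s k)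
    {V : Matrix ι m ℝ} (hV : ∀ l, l ≠ k → ∀ j, (Uᵀ * V) l j = 0) :
    (Vᵀ * (B * V)).trace ≤ s k * ‖V‖ ^ 2 := by
  set C : Matrix ι ι ℝ := s k • (1 : Matrix ι ι ℝ) -
    (B - U * Matrix.diagonal s * Uᵀ + s k • (U * Uᵀ)) with hC
  have hCT : C.IsHermitian := by
    rw [Matrix.IsHermitian, Matrix.conjTranspose_eq_transpose_of_trivial, hC]
    simp [Matrix.transpose_mul, hB, Matrix.mul_assoc]
  have hUB : Uᵀ * B = Matrix.diagonal s * Uᵀ := by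
    have := congrArg Matrix.transpose hBU
    simpa [Matrix.transpose_mul, hB] using this
  have hUC : Uᵀ * C = 0 := by
    rw [hC, Matrix.mul_sub, Matrix.mul_add, Matrix.mul_sub, hUB]
    simp only [Matrix.mul_smul, ← Matrix.mul_assoc, hU, Matrix.one_mul, Matrix.mul_one]
    abel
  have hpos : C.PosSemidef := by
    rw [hCT.posSemidef_iff_eigenvalues_nonneg]
    intro j
    by_contra! hlt
    rw [Pi.zero_apply] at hlt
    set w : ι → ℝ := WithLp.ofLp (hCT.eigenvectorBasis j) with hw
    have hCw : C *ᵥ w = hCT.eigenvalues j • w := hCT.mulVec_eigenvectorBasis j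
    have hw0 : w ≠ 0 := by
      intro h0
      have := hCT.eigenvectorBasis.orthonormal.ne_zero j
      exact this (by ext i; exact congrFun h0 i)
    have hUw : Uᵀ *ᵥ w = 0 := by
      have : Uᵀ *ᵥ (C *ᵥ w) = 0 := by rw [Matrix.mulVec_mulVec, hUC, Matrix.zero_mulVec]
      rw [hCw, Matrix.mulVec_smul] at this
      exact (smul_eq_zero.1 this).resolve_left hlt.ne
    have hBw : B *ᵥ w = (s k - hCT.eigenvalues j) • w := by
      have h1 : C *ᵥ w = s k • w - B *ᵥ w := by
        rw [hC, Matrix.sub_mulVec, Matrix.add_mulVec, Matrix.sub_mulVec, Matrix.smul_mulVec,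
          Matrix.smul_mulVec, ← Matrix.mulVec_mulVec, ← Matrix.mulVec_mulVec, hUw]
        simp [← Matrix.mulVec_mulVec, hUw]
      rw [sub_smul, ← hCw, h1]; abel
    have := hmax _ w hw0 hUw hBw
    linarith
  have h0 : (Matrix.diagonal s - s k • (1 : Matrix κ κ ℝ)) * (Uᵀ * V) = 0 := by
    have : Matrix.diagonal s - s k • (1 : Matrix κ κ ℝ) = Matrix.diagonal fun l ↦ s l - s k := by
      rw [← Matrix.diagonal_one, ← Matrix.diagonal_smul, Matrix.diagonal_sub]; simp
    rw [this]
    ext l j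
    rw [Matrix.diagonal_mul]
    by_cases hl : l = k
    · simp [hl]
    · simp [hV l hl j]
  have h1 : Vᵀ * (C * V) = s k • (Vᵀ * V) - Vᵀ * (B * V) := by
    have : C * V = s k • V - B * V +
        U * ((Matrix.diagonal s - s k • (1 : Matrix κ κ ℝ)) * (Uᵀ * V)) := by
      rw [hC]
      simp only [Matrix.sub_mul, Matrix.add_mul, Matrix.smul_mul, Matrix.one_mul, Matrix.mul_sub,
        Matrix.mul_smul, Matrix.mul_assoc]
      abel
    rw [this, h0, Matrix.mul_zero, add_zero, Matrix.mul_sub, Matrix.mul_smul]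
  have h2 : 0 ≤ (Vᵀ * (C * V)).trace := by
    have := (hpos.conjTranspose_mul_mul_same V).trace_nonneg
    simpa [Matrix.mul_assoc] using this
  rw [h1, Matrix.trace_sub, Matrix.trace_smul, trace_transpose_mul_self, smul_eq_mul] at h2
  linarith

/-- The leading eigenvalues of a small perturbation of `Y Yᵀ` are bounded below. -/
lemma one_le_mul_eigenvalue {Y : Matrix ι κ ℝ} {N : Matrix ι ι ℝ} {Γ : Matrix κ κ ℝ}
    (hN : Nᵀ = N) (hΓ : (Yᵀ * Y) * Γ = 1) {ρ : ℝ}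
    (hρ : ∀ M : Matrix ι Unit ℝ, ‖N * M‖ ≤ ρ * ‖M‖)
    {U : Matrix ι κ ℝ} {s : κ → ℝ} (hU : Uᵀ * U = 1)
    (hBU : (Y * Yᵀ + N) * U = U * Matrix.diagonal s) (k : κ)
    (hmax : ∀ (r : ℝ) (v : ι → ℝ), v ≠ 0 → Uᵀ *ᵥ v = 0 → (Y * Yᵀ + N) *ᵥ v = r • v → r ≤ s k) :
    1 ≤ ‖Γ‖ * (s k + ρ) := by
  have hΓ' : Γ * (Yᵀ * Y) = 1 := mul_eq_one_comm.1 hΓ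
  -- The Courant–Fischer dimension count: orthogonality of Yy to the columns of U other than the
  -- k-th imposes one condition fewer than there are coordinates of y. Zeroing row k of UᵀY makes
  -- this a singular square system.
  obtain ⟨y, hy0, hy⟩ : ∃ y : κ → ℝ, y ≠ 0 ∧ ((Uᵀ * Y).updateRow k 0) *ᵥ y = 0 := by
    rw [Matrix.exists_mulVec_eq_zero_iff]
    exact Matrix.det_eq_zero_of_row_eq_zero k (by simp)
  set D : Matrix κ Unit ℝ := Matrix.replicateCol Unit y with hD
  set V := Y * D with hV
  have hUV : ∀ l, l ≠ k → ∀ j, (Uᵀ * V) l j = 0 := by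
    intro l hl j
    have := congrFun hy l
    simp only [Matrix.mulVec, Matrix.updateRow_ne hl, Pi.zero_apply] at this
    rw [hV, ← Matrix.mul_assoc, Matrix.mul_apply]
    simpa [dotProduct, hD] using this
  have h1 := trace_quadForm_le (by simp [Matrix.transpose_mul, hN]) hU hBU k hmax hUV
  have h2 : Vᵀ * ((Y * Yᵀ + N) * V) = (Yᵀ * V)ᵀ * (Yᵀ * V) + Vᵀ * (N * V) := by
    rw [Matrix.transpose_mul Yᵀ, Matrix.transpose_transpose, Matrix.add_mul, Matrix.mul_add]
    simp only [Matrix.mul_assoc]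
  have h3 : -(ρ * ‖V‖ ^ 2) ≤ (Vᵀ * (N * V)).trace := by
    have := (abs_le.1 (abs_trace_transpose_mul_le V (N * V))).1
    nlinarith [hρ V, norm_nonneg V]
  rw [h2, Matrix.trace_add, trace_transpose_mul_self] at h1
  have hVD : Yᵀ * V = (Yᵀ * Y) * D := by rw [hV, Matrix.mul_assoc]
  have hDV : D = Γ * (Yᵀ * V) := by rw [hVD, ← Matrix.mul_assoc, hΓ', Matrix.one_mul]
  have h4 : ‖V‖ ^ 2 ≤ ‖Γ‖ * ‖Yᵀ * V‖ ^ 2 := by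
    have : Vᵀ * V = (Γ * (Yᵀ * V))ᵀ * (Yᵀ * V) := by
      rw [← hDV]; conv_lhs => rw [hV, Matrix.transpose_mul, Matrix.mul_assoc]
    rw [← trace_transpose_mul_self, this]
    calc _ ≤ ‖Γ * (Yᵀ * V)‖ * ‖Yᵀ * V‖ :=
          (le_abs_self _).trans (abs_trace_transpose_mul_le _ _)
      _ ≤ ‖Γ‖ * ‖Yᵀ * V‖ * ‖Yᵀ * V‖ := by gcongr; exact Matrix.frobenius_norm_mul _ _
      _ = _ := by ring
  have hV0 : 0 < ‖V‖ ^ 2 := by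
    have : V ≠ 0 := by
      intro h0
      rw [h0, Matrix.mul_zero, Matrix.mul_zero] at hDV
      apply hy0
      ext i
      simpa [hD] using congrFun (congrFun hDV i) ()
    positivity
  have h5 : ‖Γ‖ * ‖Yᵀ * V‖ ^ 2 ≤ ‖Γ‖ * ((s k + ρ) * ‖V‖ ^ 2) := by
    gcongr; linarith
  by_contra! h6
  nlinarith

lemma exists_leading_eigenvectors {n d : ℕ} (hdn : d ≤ n) {B : Matrix (Fin n) (Fin n) ℝ}
    (hB : Bᵀ = B) : ∃ (U : Matrix (Fin n) (Fin d) ℝ) (s : Fin d → ℝ), Uᵀ * U = 1 ∧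
      B * U = U * Matrix.diagonal s ∧
      ∀ (r : ℝ) (v : Fin n → ℝ), v ≠ 0 → Uᵀ *ᵥ v = 0 → B *ᵥ v = r • v → ∀ k, r ≤ s k := by
  have hH : B.IsHermitian := by
    rwa [Matrix.IsHermitian, Matrix.conjTranspose_eq_transpose_of_trivial]
  set b := hH.eigenvectorBasis with hb
  set lam := hH.eigenvalues with hlam
  set σ := Tuple.sort fun j ↦ -lam j with hσ
  have hmono : Monotone ((fun j ↦ -lam j) ∘ σ) := Tuple.monotone_sort _
  have hBb (j : Fin n) : B *ᵥ (b j : Fin n → ℝ) = lam j • (b j : Fin n → ℝ) :=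
    hH.mulVec_eigenvectorBasis j
  have horth (i j : Fin n) : (b i : Fin n → ℝ) ⬝ᵥ (b j : Fin n → ℝ) = if i = j then 1 else 0 := by
    have := orthonormal_iff_ite.1 b.orthonormal i j
    rw [← this, PiLp.inner_apply]
    simp [dotProduct, mul_comm]
  set f : Fin d → Fin n := fun k ↦ σ (Fin.castLE hdn k) with hf
  have hfinj : Function.Injective f := σ.injective.comp (Fin.castLE_injective hdn)
  refine ⟨Matrix.of fun i k ↦ b (f k) i, fun k ↦ lam (f k), ?_, ?_, ?_⟩
  · ext k l
    have := horth (f k) (f l)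
    rw [Matrix.one_apply, Matrix.mul_apply]
    simp only [hfinj.eq_iff] at this
    rw [← this]; rfl
  · ext i k
    have := congrFun (hBb (f k)) i
    rw [Matrix.mul_diagonal, Matrix.mul_apply]
    simpa [Matrix.mulVec, dotProduct, mul_comm] using this
  · intro r v hv hUv hBv k
    obtain ⟨j, hj⟩ : ∃ j, (b j : Fin n → ℝ) ⬝ᵥ v ≠ 0 := by
      by_contra! h
      apply hv
      have : WithLp.toLp 2 v = 0 := by
        refine b.repr.map_eq_zero_iff.1 (by
          ext j
          rw [b.repr_apply_apply, PiLp.inner_apply]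
          simpa [dotProduct, mul_comm] using h j)
      simpa using this
    have hr : r = lam j := by
      have h1 : (b j : Fin n → ℝ) ⬝ᵥ (B *ᵥ v) = (B *ᵥ (b j : Fin n → ℝ)) ⬝ᵥ v := by
        rw [Matrix.dotProduct_mulVec, ← Matrix.mulVec_transpose, hB]
      rw [hBv, hBb, dotProduct_smul, smul_dotProduct, smul_eq_mul, smul_eq_mul] at h1
      exact mul_right_cancel₀ hj h1
    -- The vector v is orthogonal to the eigenvectors in the first d sorted positions, so an
    -- eigenvector that it meets comes later and has no larger eigenvalue.
    have hjd : d ≤ (σ.symm j : ℕ) := by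
      by_contra! hlt
      have := congrFun hUv ⟨σ.symm j, hlt⟩
      apply hj
      have hfj : f ⟨σ.symm j, hlt⟩ = j := by simp [hf]
      simpa [Matrix.mulVec, dotProduct, hfj] using this
    have := @hmono (Fin.castLE hdn k) (σ.symm j) (by
      rw [Fin.le_def]; exact (k.2.le.trans hjd : (k : ℕ) ≤ _))
    simp only [Function.comp, Equiv.apply_symm_apply] at this
    rw [hr]; simp only [hf]; linarith

end Spectral

/-! ### Measurable polar decomposition -/

section Polar

variable {κ : Type*} [Fintype κ] [DecidableEq κ]

open scoped MatrixOrder in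
-- Squaring is continuous and injective on the closed, hence Polish, set of positive semidefinite
-- matrices. By the Lusin–Souslin theorem it is a measurable embedding, and its inverse extends
-- measurably to all matrices.
lemma exists_measurable_sqrt : ∃ g : (κ → κ → ℝ) → (κ → κ → ℝ), Measurable g ∧
    ∀ S : Matrix κ κ ℝ, S.PosSemidef → g (fun i j ↦ (S * S) i j) = fun i j ↦ S i j := by
  let C : Set (κ → κ → ℝ) := {S | (Matrix.of S).PosSemidef}
  have hC : IsClosed C := by
    have : C = {S : κ → κ → ℝ | ∀ i j, S i j = S j i} ∩
        {S | ∀ x : κ → ℝ, 0 ≤ x ⬝ᵥ (Matrix.of S *ᵥ x)} := by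
      ext S
      simp only [C, Set.mem_ofPred_eq, Set.mem_inter_iff,
        Matrix.posSemidef_iff_dotProduct_mulVec]
      refine and_congr ?_ (by simp)
      rw [Matrix.IsHermitian, Matrix.conjTranspose_eq_transpose_of_trivial, ← Matrix.ext_iff]
      exact ⟨fun h i j ↦ (h j i), fun h i j ↦ (h j i)⟩
    rw [this]
    refine IsClosed.inter ?_ ?_
    · simp only [Set.ofPred_forall]
      exact isClosed_iInter fun i ↦ isClosed_iInter fun j ↦
        isClosed_eq (by fun_prop) (by fun_prop)
    · simp only [Set.ofPred_forall]
      refine isClosed_iInter fun x ↦ isClosed_le continuous_const ?_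
      simp only [dotProduct, Matrix.mulVec, Matrix.of_apply]
      fun_prop
  let f : C → (κ → κ → ℝ) := fun S i j ↦ ∑ k, (S : κ → κ → ℝ) i k * (S : κ → κ → ℝ) k j
  have hf : Continuous f := by
    refine continuous_pi fun i ↦ continuous_pi fun j ↦ ?_
    have h (i j : κ) : Continuous fun S : C ↦ (S : κ → κ → ℝ) i j :=
      (continuous_apply_apply i j).comp continuous_subtype_val
    exact continuous_finsetSum _ fun k _ ↦ (h i k).mul (h k j)
  have hmul (S : C) : Matrix.of (f S) = Matrix.of (S : κ → κ → ℝ) * Matrix.of (S : κ → κ → ℝ) := by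
    ext i j; simp [f, Matrix.mul_apply]
  have hinj : Function.Injective f := by
    intro S T h
    have h2 : Matrix.of (S : κ → κ → ℝ) * Matrix.of (S : κ → κ → ℝ)
        = Matrix.of (T : κ → κ → ℝ) * Matrix.of (T : κ → κ → ℝ) := by rw [← hmul, ← hmul, h]
    have hS : (0 : Matrix κ κ ℝ) ≤ Matrix.of S := Matrix.nonneg_iff_posSemidef.2 S.2
    have hT : (0 : Matrix κ κ ℝ) ≤ Matrix.of T := Matrix.nonneg_iff_posSemidef.2 T.2
    have h3 : Matrix.of (S : κ → κ → ℝ) = Matrix.of (T : κ → κ → ℝ) := by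
      rw [← CFC.sqrt_mul_self (Matrix.of (S : κ → κ → ℝ)) hS, h2, CFC.sqrt_mul_self _ hT]
    exact Subtype.ext (Matrix.of.injective h3)
  have : PolishSpace C := hC.polishSpace
  have hemb : MeasurableEmbedding f := hf.measurableEmbedding hinj
  obtain ⟨g, hg, hgf⟩ := hemb.exists_measurable_extend (g := fun S : C ↦ (S : κ → κ → ℝ))
    measurable_subtype_coe (fun _ ↦ ⟨0⟩)
  refine ⟨g, hg, fun S hS ↦ ?_⟩
  have h1 := congrFun hgf ⟨fun i j ↦ S i j, hS⟩
  have h2 : (fun i j ↦ (S * S) i j) = f ⟨fun i j ↦ S i j, hS⟩ := by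
    funext i j; simp [f, Matrix.mul_apply]
  rw [h2]
  exact h1

lemma measurable_det {α : Type*} [MeasurableSpace α] {M : α → Matrix κ κ ℝ}
    (hM : ∀ i j, Measurable fun a ↦ M a i j) : Measurable fun a ↦ (M a).det := by
  simp only [Matrix.det_apply]
  fun_prop

lemma measurable_inv_apply {α : Type*} [MeasurableSpace α] {M : α → Matrix κ κ ℝ}
    (hM : ∀ i j, Measurable fun a ↦ M a i j) (i j : κ) : Measurable fun a ↦ (M a)⁻¹ i j := by
  have h : (fun a ↦ (M a)⁻¹ i j) = fun a ↦ (M a).det⁻¹ * ((M a).updateRow j (Pi.single i 1)).det := by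
    ext a
    rw [Matrix.inv_def, Matrix.smul_apply, Ring.inverse_eq_inv', Matrix.adjugate_apply, smul_eq_mul]
  rw [h]
  refine (measurable_det hM).inv.mul (measurable_det fun k l ↦ ?_)
  by_cases hk : k = j
  · subst hk; simp
  · simpa [Matrix.updateRow_ne hk] using hM k l

lemma measurable_mul_apply {ι κ' m α : Type*} [Fintype κ'] [MeasurableSpace α]
    {M : α → Matrix ι κ' ℝ} {M' : α → Matrix κ' m ℝ} (hM : ∀ i j, Measurable fun a ↦ M a i j)
    (hM' : ∀ i j, Measurable fun a ↦ M' a i j) (i : ι) (j : m) :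
    Measurable fun a ↦ (M a * M' a) i j := by
  simp only [Matrix.mul_apply]
  fun_prop

/-- A measurable choice of an orthogonal polar factor. -/
lemma exists_measurable_polar : ∃ w : (κ → κ → ℝ) → Matrix κ κ ℝ,
    (∀ i j, Measurable fun M ↦ w M i j) ∧ (∀ M, w M ∈ Matrix.orthogonalGroup κ ℝ) ∧
    ∀ M : Matrix κ κ ℝ, M.det ≠ 0 → (M * w M).PosSemidef := by
  classical
  obtain ⟨g, hg, hgS⟩ := exists_measurable_sqrt (κ := κ)
  set H : Matrix κ κ ℝ → Matrix κ κ ℝ := fun M ↦ Matrix.of (g fun i j ↦ (M * Mᵀ) i j) with hH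
  have hsq (M : Matrix κ κ ℝ) : (H M).PosSemidef ∧ H M * H M = M * Mᵀ := by
    open scoped MatrixOrder in
    have h0 : (0 : Matrix κ κ ℝ) ≤ M * Mᵀ := by
      rw [Matrix.nonneg_iff_posSemidef]
      simpa using Matrix.posSemidef_self_mul_conjTranspose M
    have h1 := Matrix.nonneg_iff_posSemidef.1 (CFC.sqrt_nonneg (M * Mᵀ))
    have h2 := CFC.sqrt_mul_sqrt_self (M * Mᵀ) h0
    have h3 := hgS _ h1
    rw [h2] at h3
    have h4 : H M = CFC.sqrt (M * Mᵀ) := by rw [hH]; simp only [h3]; rfl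
    rw [h4]
    exact ⟨h1, h2⟩
  -- For invertible M, the product of M with this factor is the square root H of MMᵀ. The value 1 at
  -- singular M only keeps w orthogonal everywhere.
  set w : Matrix κ κ ℝ → Matrix κ κ ℝ := fun M ↦ if M.det ≠ 0 then M⁻¹ * H M else 1 with hw
  have hdet : MeasurableSet {M : κ → κ → ℝ | (Matrix.of M).det ≠ 0} :=
    (measurable_det (M := fun M : κ → κ → ℝ ↦ Matrix.of M) (by simp only [Matrix.of_apply]; fun_prop))
      (measurableSet_singleton 0).compl
  have horth (M : Matrix κ κ ℝ) : w M ∈ Matrix.orthogonalGroup κ ℝ := by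
    rw [Matrix.mem_orthogonalGroup_iff]
    by_cases h : M.det ≠ 0
    · obtain ⟨h1, h2⟩ := hsq M
      have hu : IsUnit M.det := isUnit_iff_ne_zero.2 h
      have h1T : (H M)ᵀ = H M := by simpa using h1.isHermitian.eq
      simp only [hw, if_pos h]
      rw [Matrix.transpose_mul, h1T, Matrix.mul_assoc, ← Matrix.mul_assoc (H M), h2,
        Matrix.transpose_nonsing_inv, Matrix.mul_assoc,
        Matrix.mul_nonsing_inv _ (by rwa [Matrix.det_transpose]), Matrix.mul_one,
        Matrix.nonsing_inv_mul _ hu]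
    · rw [not_not] at h
      simp [hw, h]
  refine ⟨fun M ↦ w (Matrix.of M), ?_, ?_, ?_⟩
  · intro i j
    have : (fun M : κ → κ → ℝ ↦ w (Matrix.of M) i j)
        = fun M : κ → κ → ℝ ↦ if (Matrix.of M).det ≠ 0 then
        ((Matrix.of M)⁻¹ * H (Matrix.of M)) i j else (1 : Matrix κ κ ℝ) i j := by
      ext M; simp only [hw]; split_ifs <;> rfl
    rw [this]
    refine Measurable.ite hdet ?_ measurable_const
    refine measurable_mul_apply
      (fun i j ↦ measurable_inv_apply (by simp only [Matrix.of_apply]; fun_prop) i j)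
      (fun i j ↦ ?_) i j
    have h1 : Measurable fun (M : κ → κ → ℝ) i j ↦ (Matrix.of M * (Matrix.of M)ᵀ) i j := by
      refine measurable_pi_lambda _ fun i ↦ measurable_pi_lambda _ fun j ↦ ?_
      exact measurable_mul_apply (by simp only [Matrix.of_apply]; fun_prop)
        (by simp only [Matrix.transpose_apply, Matrix.of_apply]; fun_prop) i j
    exact (measurable_pi_apply j).comp ((measurable_pi_apply i).comp (hg.comp h1))
  · exact fun M ↦ horth (Matrix.of M)
  · intro M hM
    have hu : IsUnit M.det := isUnit_iff_ne_zero.2 hM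
    change (M * w M).PosSemidef
    simp only [hw, if_pos hM]
    rw [← Matrix.mul_assoc, Matrix.mul_nonsing_inv _ hu, Matrix.one_mul]
    exact (hsq M).1

end Polar

/-! ### Rotated embeddings and a priori bounds -/

section Rotation

variable {ι κ m : Type*} [Fintype ι] [Fintype κ] [Fintype m] [DecidableEq κ]

lemma norm_mul_orthogonal {W : Matrix κ κ ℝ} (hW : W ∈ Matrix.orthogonalGroup κ ℝ)
    (M : Matrix ι κ ℝ) : ‖M * W‖ = ‖M‖ := by
  have h : W * Wᵀ = 1 := (Matrix.mem_orthogonalGroup_iff _ _).1 hW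
  rw [← sq_eq_sq₀ (norm_nonneg _) (norm_nonneg _), ← trace_transpose_mul_self,
    ← trace_transpose_mul_self, Matrix.trace_mul_comm, Matrix.transpose_mul, Matrix.mul_assoc,
    ← Matrix.mul_assoc W, h, Matrix.one_mul, Matrix.trace_mul_comm]

lemma norm_orthogonal_transpose_mul {W : Matrix κ κ ℝ} (hW : W ∈ Matrix.orthogonalGroup κ ℝ)
    (M : Matrix κ m ℝ) : ‖Wᵀ * M‖ = ‖M‖ := by
  rw [← Matrix.frobenius_norm_transpose, Matrix.transpose_mul, Matrix.transpose_transpose,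
    norm_mul_orthogonal hW, Matrix.frobenius_norm_transpose]

/-- Writing the eigenvalues as the Gram matrix of X makes the eigenvalue equation invariant under
rotation; in terms of the diagonal matrix it is not. -/
lemma mul_rotation_eq {B : Matrix ι ι ℝ} {X : Matrix ι κ ℝ} {s : κ → ℝ}
    (hXX : Xᵀ * X = Matrix.diagonal s) (hBX : B * X = X * Matrix.diagonal s)
    {W : Matrix κ κ ℝ} (hW : W ∈ Matrix.orthogonalGroup κ ℝ) :
    B * (X * W) = (X * W) * ((X * W)ᵀ * (X * W)) := by
  have h : W * Wᵀ = 1 := (Matrix.mem_orthogonalGroup_iff _ _).1 hW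
  rw [← Matrix.mul_assoc, hBX, Matrix.transpose_mul]
  calc _ = X * ((Xᵀ * X) * W) := by rw [hXX, Matrix.mul_assoc]
    _ = X * ((W * Wᵀ) * ((Xᵀ * X) * W)) := by rw [h, Matrix.one_mul]
    _ = _ := by simp only [Matrix.mul_assoc]

lemma gram_rotation_mul_inv {X : Matrix ι κ ℝ} {s : κ → ℝ} (hs : ∀ k, 0 < s k)
    (hXX : Xᵀ * X = Matrix.diagonal s)
    {W : Matrix κ κ ℝ} (hW : W ∈ Matrix.orthogonalGroup κ ℝ) :
    ((X * W)ᵀ * (X * W)) * (Wᵀ * (Matrix.diagonal (fun k ↦ (s k)⁻¹) * W)) = 1 := by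
  have h : W * Wᵀ = 1 := (Matrix.mem_orthogonalGroup_iff _ _).1 hW
  have h' : Wᵀ * W = 1 := mul_eq_one_comm.1 h
  have hd : Matrix.diagonal s * Matrix.diagonal (fun k ↦ (s k)⁻¹) = 1 := by
    rw [Matrix.diagonal_mul_diagonal, ← Matrix.diagonal_one]
    congr 1; ext k; exact mul_inv_cancel₀ (hs k).ne'
  calc _ = Wᵀ * ((Xᵀ * X) * ((W * Wᵀ) * (Matrix.diagonal (fun k ↦ (s k)⁻¹) * W))) := by
        rw [Matrix.transpose_mul]; simp only [Matrix.mul_assoc]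
    _ = Wᵀ * ((Matrix.diagonal s * Matrix.diagonal (fun k ↦ (s k)⁻¹)) * W) := by
        rw [h, hXX, Matrix.one_mul, Matrix.mul_assoc]
    _ = 1 := by rw [hd, Matrix.one_mul, h']

lemma norm_diagonal_inv_le {s : κ → ℝ} {c : ℝ} (hc : 0 ≤ c) (hs : ∀ k, 0 < s k)
    (h : ∀ k, 1 ≤ c * s k) :
    ‖Matrix.diagonal (fun k ↦ (s k)⁻¹)‖ ≤ Fintype.card κ * c := by
  apply abs_le_of_sq_le_sq' _ (by positivity) |>.2
  have hle (k : κ) : (s k)⁻¹ ^ 2 ≤ c ^ 2 := by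
    have := hs k
    gcongr
    rw [inv_le_iff_one_le_mul₀ this]; exact h k
  have : ‖Matrix.diagonal (fun k ↦ (s k)⁻¹)‖ ^ 2 = ∑ k, (s k)⁻¹ ^ 2 := by
    rw [← trace_transpose_mul_self, Matrix.diagonal_transpose, Matrix.diagonal_mul_diagonal,
      Matrix.trace_diagonal]
    simp only [sq]
  rw [this]
  calc _ ≤ ∑ _k : κ, c ^ 2 := Finset.sum_le_sum fun k _ ↦ hle k
    _ = Fintype.card κ * c ^ 2 := by simp
    _ ≤ (Fintype.card κ : ℝ) ^ 2 * c ^ 2 := by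
        gcongr
        rcases Nat.eq_zero_or_pos (Fintype.card κ) with h0 | h0
        · simp [h0]
        · exact le_self_pow₀ (by exact_mod_cast h0) (by norm_num)
    _ = _ := by ring

/-- Here ‖X‖² = ∑ s_k, while ∑ s_k² is the trace of XᵀBX, with B = YYᵀ + N, and is at most (‖Y‖² +
ρ)‖X‖². Cauchy–Schwarz over the eigenvalues concludes. -/
lemma norm_sq_embedding_le {Y X : Matrix ι κ ℝ} {N : Matrix ι ι ℝ} {s : κ → ℝ} {ρ : ℝ}
    (hXX : Xᵀ * X = Matrix.diagonal s) (hBX : (Y * Yᵀ + N) * X = X * Matrix.diagonal s)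
    (hρ0 : 0 ≤ ρ) (hρ : ∀ M : Matrix ι κ ℝ, ‖N * M‖ ≤ ρ * ‖M‖) :
    ‖X‖ ^ 2 ≤ Fintype.card κ * (‖Y‖ ^ 2 + ρ) := by
  have h1 : ‖X‖ ^ 2 = ∑ k, s k := by
    rw [← trace_transpose_mul_self, hXX, Matrix.trace_diagonal]
  have h2 : ∑ k, s k ^ 2 ≤ (‖Y‖ ^ 2 + ρ) * ‖X‖ ^ 2 := by
    have e1 : ∑ k, s k ^ 2 = (Xᵀ * ((Y * Yᵀ + N) * X)).trace := by
      rw [hBX, ← Matrix.mul_assoc, hXX, Matrix.diagonal_mul_diagonal, Matrix.trace_diagonal]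
      simp only [sq]
    have e2 : Xᵀ * ((Y * Yᵀ + N) * X) = (Yᵀ * X)ᵀ * (Yᵀ * X) + Xᵀ * (N * X) := by
      rw [Matrix.transpose_mul Yᵀ, Matrix.transpose_transpose, Matrix.add_mul, Matrix.mul_add]
      simp only [Matrix.mul_assoc]
    rw [e1, e2, Matrix.trace_add, trace_transpose_mul_self]
    have e3 : ‖Yᵀ * X‖ ≤ ‖Y‖ * ‖X‖ := by
      rw [← Matrix.frobenius_norm_transpose Y]; exact Matrix.frobenius_norm_mul _ _
    have e4 : (Xᵀ * (N * X)).trace ≤ ‖X‖ * (ρ * ‖X‖) :=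
      ((le_abs_self _).trans (abs_trace_transpose_mul_le X (N * X))).trans
        (mul_le_mul_of_nonneg_left (hρ X) (norm_nonneg _))
    have e5 : ‖Yᵀ * X‖ ^ 2 ≤ (‖Y‖ * ‖X‖) ^ 2 := by gcongr
    nlinarith
  have h3 : (∑ k, s k) ^ 2 ≤ Fintype.card κ * ∑ k, s k ^ 2 := by
    have := sq_sum_le_card_mul_sum_sq (s := Finset.univ) (f := s)
    simpa using this
  rw [← h1] at h3
  have h4 : (‖X‖ ^ 2) ^ 2 ≤ Fintype.card κ * (‖Y‖ ^ 2 + ρ) * ‖X‖ ^ 2 := by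
    calc _ ≤ _ := h3
      _ ≤ Fintype.card κ * ((‖Y‖ ^ 2 + ρ) * ‖X‖ ^ 2) := by gcongr
      _ = _ := by ring
  rcases eq_or_lt_of_le (sq_nonneg ‖X‖) with h0 | h0
  · rw [← h0]; positivity
  · nlinarith

/-- If YᵀX killed v, then Xv would be the orthogonal component applied to v. That component is
small, whereas Θ bounds X from below. -/
lemma det_cross_ne_zero {Y X : Matrix ι κ ℝ} {Γ Θ : Matrix κ κ ℝ} {L b : ℝ}
    (hΘ : (Xᵀ * X) * Θ = 1) (hΘL : ‖Θ‖ ≤ L) (hL : 0 ≤ L)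
    (hV : ‖X - Y * (Γ * (Yᵀ * X))‖ ≤ 4 * L ^ 7 * b) (hbL : 32 * L ^ 15 * b ^ 2 ≤ 1) :
    (Yᵀ * X).det ≠ 0 := by
  intro h0
  obtain ⟨v, hv0, hv⟩ := Matrix.exists_mulVec_eq_zero_iff.2 h0
  set D : Matrix κ Unit ℝ := Matrix.replicateCol Unit v with hD
  have hAD : (Yᵀ * X) * D = 0 := by
    ext i j
    have := congrFun hv i
    rw [Matrix.mul_apply]
    simpa [Matrix.mulVec, dotProduct, hD] using this
  set V := X - Y * (Γ * (Yᵀ * X)) with hVd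
  have hXD : X * D = V * D := by
    rw [hVd, Matrix.sub_mul, Matrix.mul_assoc Y, Matrix.mul_assoc Γ, hAD]; simp
  have h1 := norm_sq_le_mul_norm_mul_sq hΘ D
  have hD0 : 0 < ‖D‖ ^ 2 := by
    have : D ≠ 0 := by
      intro h; apply hv0; ext i; simpa [hD] using congrFun (congrFun h i) ()
    positivity
  have h2 : ‖V * D‖ ^ 2 ≤ (4 * L ^ 7 * b * ‖D‖) ^ 2 := by
    gcongr; exact frobenius_norm_mul_le_of_le hV le_rfl
  rw [hXD] at h1
  have h3 : ‖D‖ ^ 2 ≤ L * (4 * L ^ 7 * b * ‖D‖) ^ 2 := h1.trans (by gcongr)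
  have h4 : L * (4 * L ^ 7 * b * ‖D‖) ^ 2 = (32 * L ^ 15 * b ^ 2) * ‖D‖ ^ 2 / 2 := by ring
  nlinarith

end Rotation

/-! ### Row expansion for the aligned embedding -/

section Row

variable {ι κ : Type*} [Fintype ι] [Fintype κ] [DecidableEq κ]

/-- The expansion of a rotated embedding, in a scaling in which the signal has size one. -/
lemma norm_rotated_expansion_le {m : Type*} [Fintype m] {Y X : Matrix ι κ ℝ} {N : Matrix ι ι ℝ}
    {Γ W : Matrix κ κ ℝ} {e : Matrix m ι ℝ} {s : κ → ℝ} {L ρ b q r p y : ℝ}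
    (hL : 1 ≤ L) (hN : Nᵀ = N) (hΓ : (Yᵀ * Y) * Γ = 1) (hs : ∀ k, 0 < s k)
    (hXX : Xᵀ * X = Matrix.diagonal s) (hBX : (Y * Yᵀ + N) * X = X * Matrix.diagonal s)
    (hW : W ∈ Matrix.orthogonalGroup κ ℝ)
    (hA : (Yᵀ * X).det ≠ 0 → (Yᵀ * X * W).PosSemidef)
    (hΓL : ‖Γ‖ ≤ L) (hΘL : ‖Matrix.diagonal (fun k ↦ (s k)⁻¹)‖ ≤ L) (hYL : ‖Y‖ ≤ L) (hXL : ‖X‖ ≤ L)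
    (hρ : ∀ M : Matrix ι κ ℝ, ‖N * M‖ ≤ ρ * ‖M‖) (hρ0 : 0 ≤ ρ)
    (hb : ‖N * Y‖ ≤ b) (hq : ‖Yᵀ * (N * Y)‖ ≤ q)
    (hy : ‖e * Y‖ ≤ y) (hr : ‖e * N‖ ≤ r) (hp : ‖e * N * (N * Y)‖ ≤ p)
    (hρL : 4 * L ^ 4 * ρ ≤ 1) (hbL : 32 * L ^ 15 * b ^ 2 ≤ 1)
    (hqL : 40 * L ^ 24 * (q + b ^ 2) ≤ 1) :
    ‖e * (X * W) - e * Y - e * N * Y * Γ‖ ≤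
      200 * L ^ 27 * ((y + r) * (q + b ^ 2) + p + r * ρ * b) := by
  have h1 := mul_rotation_eq hXX hBX hW
  have h2 := gram_rotation_mul_inv hs hXX hW
  have hΘ : ‖Wᵀ * (Matrix.diagonal (fun k ↦ (s k)⁻¹) * W)‖ ≤ L := by
    rwa [norm_orthogonal_transpose_mul hW, norm_mul_orthogonal hW]
  -- The trivial rotation comes first: the orthogonal component of the unrotated X is small, so YᵀX
  -- is invertible, and only then is the aligned cross matrix known to be positive semidefinite.
  have hone : (1 : Matrix κ κ ℝ) ∈ Matrix.orthogonalGroup κ ℝ := one_mem _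
  have h1' := mul_rotation_eq hXX hBX hone
  have h2' := gram_rotation_mul_inv hs hXX hone
  rw [Matrix.mul_one] at h1'
  simp only [Matrix.mul_one, Matrix.transpose_one, Matrix.one_mul] at h2'
  have hV := (norm_perp_le hL (mul_eq_one_comm.1 hΓ) h2' h1' hΓL hΘL hYL hXL hρ hb hρL).1
  have hdet := det_cross_ne_zero h2' hΘL (by linarith) hV hbL
  exact norm_expansion_le hL hN hΓ h2 h1 (by rw [← Matrix.mul_assoc]; exact hA hdet) hΓL hΘ hYL
    (by rwa [norm_mul_orthogonal hW]) hρ hρ0 hb hq hy hr hp hρL hbL hqL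

lemma norm_mul_le_of_norm_sq_le {N : Matrix ι ι ℝ} (hN : Nᵀ = N) {ρ : ℝ} (hρ0 : 0 ≤ ρ)
    (hNN : ‖N * N‖ ≤ ρ ^ 2) {m : Type*} [Fintype m] (M : Matrix ι m ℝ) : ‖N * M‖ ≤ ρ * ‖M‖ := by
  apply abs_le_of_sq_le_sq' _ (by positivity) |>.2
  calc _ ≤ ‖N * N‖ * ‖M‖ ^ 2 := norm_mul_sq_le hN M
    _ ≤ ρ ^ 2 * ‖M‖ ^ 2 := by gcongr
    _ = _ := by ring

end Row

/-! ### Double centering of squared distances -/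

section Centering

variable {n d : ℕ}

/-- The data matrix of the centred points. -/
noncomputable def centered (n : ℕ) (z : ℕ → EuclideanSpace ℝ (Fin d)) : Matrix (Fin n) (Fin d) ℝ :=
  Matrix.of fun i k ↦ z i k - sampleMean n z k

/-- The perturbation of the Gram matrix of the centred points caused by the noise `E`. -/
noncomputable def gramNoise (E : Matrix (Fin n) (Fin n) ℝ) : Matrix (Fin n) (Fin n) ℝ :=
  (-(1 / 2 : ℝ)) • (centering n * E * centering n)

lemma centering_transpose : (centering n)ᵀ = centering n := by
  ext i j; simp [centering, Matrix.one_apply, eq_comm]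

lemma centering_mul_apply {m : Type*} (M : Matrix (Fin n) m ℝ) (i : Fin n) (j : m) :
    (centering n * M) i j = M i j - (n : ℝ)⁻¹ * ∑ l, M l j := by
  rw [centering, Matrix.sub_mul, Matrix.one_mul, Matrix.sub_apply, Matrix.smul_mul,
    Matrix.smul_apply, Matrix.mul_apply]
  simp

lemma centering_mul_const (hn : 0 < n) {m : Type*} (a : m → ℝ) :
    centering n * (Matrix.of fun (_ : Fin n) j ↦ a j) = 0 := by
  ext i j
  have : (n : ℝ) ≠ 0 := by positivity
  rw [centering_mul_apply]
  simp [this]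

lemma const_mul_centering (hn : 0 < n) {m : Type*} (a : m → ℝ) :
    (Matrix.of fun i (_ : Fin n) ↦ a i) * centering n = 0 := by
  rw [← Matrix.transpose_inj, Matrix.transpose_mul, centering_transpose, Matrix.transpose_zero]
  exact centering_mul_const hn a

lemma centering_mul_centering (hn : 0 < n) : centering n * centering n = centering n := by
  have h : (Matrix.of fun _ _ ↦ 1 : Matrix (Fin n) (Fin n) ℝ) =
    Matrix.of fun (_ : Fin n) (j : Fin n) ↦ (fun _ ↦ (1 : ℝ)) j := rfl
  nth_rw 2 [centering]
  rw [Matrix.mul_sub, Matrix.mul_smul, h, centering_mul_const hn]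
  simp

lemma centered_eq (z : ℕ → EuclideanSpace ℝ (Fin d)) :
    centered n z = centering n * Matrix.of fun (i : Fin n) k ↦ z i k := by
  ext i k
  rw [centering_mul_apply]
  simp [centered, sampleMean]

lemma centering_mul_centered (hn : 0 < n) (z : ℕ → EuclideanSpace ℝ (Fin d)) :
    centering n * centered n z = centered n z := by
  rw [centered_eq, ← Matrix.mul_assoc, centering_mul_centering hn]

lemma gramNoise_transpose {E : Matrix (Fin n) (Fin n) ℝ} (hE : Eᵀ = E) :
    (gramNoise E)ᵀ = gramNoise E := by
  rw [gramNoise, Matrix.transpose_smul, Matrix.transpose_mul, Matrix.transpose_mul,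
    centering_transpose, hE, Matrix.mul_assoc]

/-- By polarization ‖z_i − z_j‖² is ‖z_i‖² + ‖z_j‖² − 2⟨z_i, z_j⟩. The first two terms are constant
along rows or columns and are annihilated by the centering matrix on one side. -/
lemma doubleCenter_eq (hn : 0 < n) (z : ℕ → EuclideanSpace ℝ (Fin d))
    (E : Matrix (Fin n) (Fin n) ℝ) :
    doubleCenter (sqDist n z + E) = centered n z * (centered n z)ᵀ + gramNoise E := by
  set Z : Matrix (Fin n) (Fin d) ℝ := Matrix.of fun i k ↦ z i k with hZ
  have h1 : sqDist n z = (Matrix.of fun (i : Fin n) (_ : Fin n) ↦ ‖z i‖ ^ 2) +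
      (Matrix.of fun (_ : Fin n) (j : Fin n) ↦ ‖z j‖ ^ 2) - (2 : ℝ) • (Z * Zᵀ) := by
    ext i j
    simp only [sqDist, Matrix.of_apply, Matrix.add_apply, Matrix.sub_apply, Matrix.smul_apply,
      Matrix.mul_apply, hZ, Matrix.transpose_apply, smul_eq_mul]
    rw [norm_sub_sq_real, PiLp.inner_apply]
    simp only [RCLike.inner_apply, conj_trivial, mul_comm]
    ring
  have h2 : centering n * sqDist n z * centering n
      = -((2 : ℝ) • (centered n z * (centered n z)ᵀ)) := by
    rw [h1, Matrix.mul_sub, Matrix.mul_add, Matrix.sub_mul, Matrix.add_mul,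
      Matrix.mul_assoc _ (Matrix.of fun (i : Fin n) (_ : Fin n) ↦ ‖z i‖ ^ 2),
      const_mul_centering hn fun i : Fin n ↦ ‖z i‖ ^ 2,
      centering_mul_const hn fun j : Fin n ↦ ‖z j‖ ^ 2, centered_eq, Matrix.transpose_mul,
      centering_transpose]
    simp [Matrix.mul_assoc, hZ]
  rw [doubleCenter, gramNoise, Matrix.mul_add, Matrix.add_mul, h2, smul_add]
  congr 1
  rw [smul_neg, smul_smul, ← neg_smul]; norm_num

end Centering

/-! ### The expansion at sample size n -/

section Embedding

variable {n d : ℕ} {z : ℕ → EuclideanSpace ℝ (Fin d)} {E : Matrix (Fin n) (Fin n) ℝ}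

lemma one_le_eigenvalue_of_noise (hn : 0 < n) (hE : Eᵀ = E)
    (hdet : IsUnit ((centered n z)ᵀ * centered n z).det) {ρ : ℝ} (hρ0 : 0 ≤ ρ)
    (hNN : ‖gramNoise E * gramNoise E‖ ≤ ρ ^ 2)
    (hρ : 2 * (‖((centered n z)ᵀ * centered n z)⁻¹‖ * ρ) ≤ 1)
    {U : Matrix (Fin n) (Fin d) ℝ} {s : Fin d → ℝ} (hU : Uᵀ * U = 1)
    (hBU : doubleCenter (sqDist n z + E) * U = U * Matrix.diagonal s)
    (hmax : ∀ (r : ℝ) (v : Fin n → ℝ), v ≠ 0 → Uᵀ *ᵥ v = 0 →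
      doubleCenter (sqDist n z + E) *ᵥ v = r • v → ∀ k, r ≤ s k) (k : Fin d) :
    0 < s k ∧ 1 ≤ 2 * ‖((centered n z)ᵀ * centered n z)⁻¹‖ * s k := by
  rw [doubleCenter_eq hn] at hBU hmax
  have h := one_le_mul_eigenvalue (gramNoise_transpose hE) (Matrix.mul_nonsing_inv _ hdet)
    (fun M ↦ norm_mul_le_of_norm_sq_le (gramNoise_transpose hE) hρ0 hNN M) hU hBU k
    (fun r v hv h1 h2 ↦ hmax r v hv h1 h2 k)
  have h2 : 1 ≤ 2 * ‖((centered n z)ᵀ * centered n z)⁻¹‖ * s k := by nlinarith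
  refine ⟨?_, h2⟩
  by_contra! h3
  nlinarith [norm_nonneg ((centered n z)ᵀ * centered n z)⁻¹]

/-- Small noise keeps the d leading eigenvalues positive. This is what makes the assumption that the
given matrix is an embedding whenever one exists applicable on the good event. -/
lemma exists_isCMDSEmbedding (hn : 0 < n) (hdn : d ≤ n) (hE : Eᵀ = E)
    (hdet : IsUnit ((centered n z)ᵀ * centered n z).det) {ρ : ℝ} (hρ0 : 0 ≤ ρ)
    (hNN : ‖gramNoise E * gramNoise E‖ ≤ ρ ^ 2)
    (hρ : 2 * (‖((centered n z)ᵀ * centered n z)⁻¹‖ * ρ) ≤ 1) :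
    ∃ X : Matrix (Fin n) (Fin d) ℝ, IsCMDSEmbedding (sqDist n z + E) X := by
  have hB : (doubleCenter (sqDist n z + E))ᵀ = doubleCenter (sqDist n z + E) := by
    rw [doubleCenter_eq hn, Matrix.transpose_add, gramNoise_transpose hE, Matrix.transpose_mul,
      Matrix.transpose_transpose]
  obtain ⟨U, s, hU, hBU, hmax⟩ := exists_leading_eigenvectors hdn hB
  exact ⟨_, U, s, hU, hBU,
    fun k ↦ (one_le_eigenvalue_of_noise hn hE hdet hρ0 hNN hρ hU hBU hmax k).1, hmax, rfl⟩

lemma norm_scaled_le {ι κ : Type*} [Fintype ι] [Fintype κ] {a b c : ℝ} {M : Matrix ι κ ℝ}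
    (ha : 0 ≤ a) (hM : ‖M‖ ≤ b) (h : a * b ≤ c) : ‖a • M‖ ≤ c := by
  rw [norm_smul, Real.norm_of_nonneg ha]
  exact (mul_le_mul_of_nonneg_left hM ha).trans h

set_option maxHeartbeats 1000000 in
/-- A row of a suitably rotated CMDS embedding agrees up to `o(n ^ (-1/2))` with its first order
expansion. Here `u = n ^ (1/4)`, `L₀` bounds the data and `Λ` the noise. -/
theorem norm_embedding_expansion_le (hE : Eᵀ = E)
    (hdet : IsUnit ((centered n z)ᵀ * centered n z).det)
    {X : Matrix (Fin n) (Fin d) ℝ} (hX : IsCMDSEmbedding (sqDist n z + E) X)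
    {W : Matrix (Fin d) (Fin d) ℝ} (hW : W ∈ Matrix.orthogonalGroup (Fin d) ℝ)
    (hA : ((centered n z)ᵀ * X).det ≠ 0 → ((centered n z)ᵀ * X * W).PosSemidef)
    {e : Matrix Unit (Fin n) ℝ} {u L₀ L Λ : ℝ} (hu : u ^ 4 = n) (hu0 : 0 < u) (hL₀ : 0 ≤ L₀)
    (hL : L = 2 * (d + 1) * (L₀ + 1)) (hΛ : 0 ≤ Λ)
    (huL : 40 * L ^ 24 * (1 + Λ) ^ 2 ≤ u)
    (hΓ : ‖((centered n z)ᵀ * centered n z)⁻¹‖ ≤ L₀ / n)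
    (hY : ‖centered n z‖ ^ 2 ≤ L₀ * n) (hy : ‖e * centered n z‖ ≤ L₀)
    (hNN : ‖gramNoise E * gramNoise E‖ ≤ Λ ^ 2 * u ^ 6)
    (hb : ‖gramNoise E * centered n z‖ ≤ Λ * u ^ 4)
    (hq : ‖(centered n z)ᵀ * (gramNoise E * centered n z)‖ ≤ Λ * u ^ 4)
    (hr : ‖e * gramNoise E‖ ≤ Λ * u ^ 2)
    (hp : ‖e * gramNoise E * (gramNoise E * centered n z)‖ ≤ Λ * u ^ 4) :
    u ^ 2 * ‖e * (X * W) - e * centered n z -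
      e * gramNoise E * centered n z * ((centered n z)ᵀ * centered n z)⁻¹‖ ≤
      200 * L ^ 27 * ((L + Λ) * (Λ + Λ ^ 2) + Λ + Λ ^ 3) / u := by
  have hn : 0 < n := by
    have : (0 : ℝ) < n := by rw [← hu]; positivity
    exact_mod_cast this
  have hd0 : (0 : ℝ) ≤ d := by positivity
  have hL1 : 1 ≤ L := by rw [hL]; nlinarith
  have hL0L : L₀ ≤ L := by rw [hL]; nlinarith
  have hL24 : 1 ≤ L ^ 24 := one_le_pow₀ hL1
  have hu1 : 1 ≤ u := by
    refine le_trans ?_ huL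
    nlinarith [mul_nonneg (by positivity : 0 ≤ L ^ 24) hΛ]
  obtain ⟨U, s, hU, hBU, hs, hmax, rfl⟩ := hX
  set Y := centered n z with hYd
  set N := gramNoise E with hNd
  set Γ := (Yᵀ * Y)⁻¹ with hΓd
  have hNT : Nᵀ = N := gramNoise_transpose hE
  have hnu : (n : ℝ) = u ^ 4 := hu.symm
  rw [hnu] at hΓ hY
  have hΛu : 4 * L ^ 4 * Λ ≤ u := by
    refine le_trans ?_ huL
    have : L ^ 4 ≤ L ^ 24 := pow_le_pow_right₀ hL1 (by norm_num)
    have h2 : Λ ≤ (1 + Λ) ^ 2 := by nlinarith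
    have h3 : 4 * L ^ 4 * Λ ≤ 40 * L ^ 24 * (1 + Λ) ^ 2 := by gcongr; norm_num
    exact h3
  have hρ2 : ‖N * N‖ ≤ (Λ * u ^ 3) ^ 2 := hNN.trans (le_of_eq (by ring))
  have hρΓ : 2 * (‖Γ‖ * (Λ * u ^ 3)) ≤ 1 := by
    calc 2 * (‖Γ‖ * (Λ * u ^ 3)) ≤ 2 * (L₀ / u ^ 4 * (Λ * u ^ 3)) := by gcongr
      _ = 2 * L₀ * Λ / u := by field_simp
      _ ≤ 1 := by
        rw [div_le_one hu0]
        refine le_trans ?_ hΛu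
        have : L₀ ≤ L ^ 4 := hL0L.trans (le_self_pow₀ hL1 (by norm_num))
        have h3 : 2 * L₀ * Λ ≤ 4 * L ^ 4 * Λ := by gcongr; norm_num
        exact h3
  have hsk := one_le_eigenvalue_of_noise hn hE hdet (by positivity) hρ2 hρΓ hU hBU hmax
  rw [doubleCenter_eq hn] at hBU
  set Xh := U * Matrix.diagonal (fun k ↦ √(s k)) with hXh
  have hXX : Xhᵀ * Xh = Matrix.diagonal s := by
    rw [hXh, Matrix.transpose_mul, Matrix.diagonal_transpose, Matrix.mul_assoc,
      ← Matrix.mul_assoc Uᵀ, hU, Matrix.one_mul, Matrix.diagonal_mul_diagonal]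
    congr 1; ext k; exact Real.mul_self_sqrt (hs k).le
  have hBX : (Y * Yᵀ + N) * Xh = Xh * Matrix.diagonal s := by
    rw [hXh, ← Matrix.mul_assoc, hBU, Matrix.mul_assoc, Matrix.mul_assoc,
      Matrix.diagonal_mul_diagonal, Matrix.diagonal_mul_diagonal]
    congr 2; ext k; ring
  have hρ (M : Matrix (Fin n) (Fin d) ℝ) : ‖N * M‖ ≤ Λ * u ^ 3 * ‖M‖ :=
    norm_mul_le_of_norm_sq_le hNT (by positivity) hρ2 M
  have hXL := norm_sq_embedding_le hXX hBX (by positivity) hρ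
  have hSinv := norm_diagonal_inv_le (c := 2 * ‖Γ‖) (by positivity) hs (fun k ↦ (hsk k).2)
  rw [Fintype.card_fin] at hXL hSinv
  have hu4 : 0 < u ^ 4 := by positivity
  have hΛu3 : Λ * u ^ 3 ≤ u ^ 4 := by
    have h4 : 1 ≤ L ^ 4 := one_le_pow₀ hL1
    have h5 : Λ ≤ u := by nlinarith
    calc Λ * u ^ 3 ≤ u * u ^ 3 := by gcongr
      _ = u ^ 4 := by ring
  -- Dividing Y and X by u² = √n and N by u⁴ = n gives the signal size one. The remainder is then of
  -- order u⁻⁵, the order of rρb, while the other terms are of order u⁻⁶. Undoing the scaling costs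
  -- u² and the factor √n another u², which leaves 1/u.
  have key := norm_rotated_expansion_le (Y := (u ^ 2)⁻¹ • Y) (X := (u ^ 2)⁻¹ • Xh)
    (N := (u ^ 4)⁻¹ • N) (Γ := u ^ 4 • Γ) (W := W) (e := e) (s := fun k ↦ (u ^ 4)⁻¹ * s k)
    (L := L) (ρ := Λ / u) (b := Λ / u ^ 2) (q := Λ / u ^ 4) (r := Λ / u ^ 2) (p := Λ / u ^ 6)
    (y := L / u ^ 2) hL1 (by rw [Matrix.transpose_smul, hNT]) ?_ (fun k ↦ mul_pos (by positivity)
      (hs k)) ?_ ?_ hW ?_ ?_ ?_ ?_ ?_ ?_ (by positivity) ?_ ?_ ?_ ?_ ?_ ?_ ?_ ?_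
  · have h1 : e * ((u ^ 2)⁻¹ • Xh * W) - e * ((u ^ 2)⁻¹ • Y)
        - e * ((u ^ 4)⁻¹ • N) * ((u ^ 2)⁻¹ • Y) * (u ^ 4 • Γ) =
        (u ^ 2)⁻¹ • (e * (Xh * W) - e * Y - e * N * Y * Γ) := by
      simp only [Matrix.smul_mul, Matrix.mul_smul, smul_sub, smul_smul]
      congr 2
      field_simp
    rw [h1, norm_smul, Real.norm_of_nonneg (by positivity)] at key
    set v := ‖e * (Xh * W) - e * Y - e * N * Y * Γ‖
    have h2 : 200 * L ^ 27 * ((L / u ^ 2 + Λ / u ^ 2) * (Λ / u ^ 4 + (Λ / u ^ 2) ^ 2) + Λ / u ^ 6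
        + Λ / u ^ 2 * (Λ / u) * (Λ / u ^ 2)) =
        200 * L ^ 27 * (((L + Λ) * (Λ + Λ ^ 2) + Λ) / u ^ 6 + Λ ^ 3 / u ^ 5) := by
      field_simp
    rw [h2] at key
    have h3 : u ^ 2 * v = u ^ 4 * ((u ^ 2)⁻¹ * v) := by field_simp
    rw [h3]
    calc _ ≤ u ^ 4 * (200 * L ^ 27 * (((L + Λ) * (Λ + Λ ^ 2) + Λ) / u ^ 6 + Λ ^ 3 / u ^ 5)) := by
          gcongr
      _ = 200 * L ^ 27 * (((L + Λ) * (Λ + Λ ^ 2) + Λ) / u ^ 2 + Λ ^ 3 / u) := by field_simp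
      _ ≤ 200 * L ^ 27 * (((L + Λ) * (Λ + Λ ^ 2) + Λ) / u + Λ ^ 3 / u) := by
          gcongr; exact le_self_pow₀ hu1 (by norm_num)
      _ = _ := by ring
  · simp only [Matrix.transpose_smul, Matrix.smul_mul, Matrix.mul_smul, smul_smul]
    rw [hΓd, Matrix.mul_nonsing_inv _ hdet]
    have : u ^ 4 * ((u ^ 2)⁻¹ * (u ^ 2)⁻¹) = 1 := by field_simp
    rw [this, one_smul]
  · simp only [Matrix.transpose_smul, Matrix.smul_mul, Matrix.mul_smul, smul_smul, hXX]
    rw [← Matrix.diagonal_smul]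
    congr 1; ext k; simp only [Pi.smul_apply, smul_eq_mul]; field_simp
  · have h1 : Matrix.diagonal (fun k ↦ (u ^ 4)⁻¹ * s k) = (u ^ 4)⁻¹ • Matrix.diagonal s := by
      rw [← Matrix.diagonal_smul]; rfl
    have h2 : ((u ^ 2)⁻¹ • Y * ((u ^ 2)⁻¹ • Y)ᵀ + (u ^ 4)⁻¹ • N) = (u ^ 4)⁻¹ • (Y * Yᵀ + N) := by
      simp only [Matrix.transpose_smul, Matrix.smul_mul, Matrix.mul_smul, smul_smul, smul_add]
      congr 2; field_simp
    rw [h1, h2, Matrix.smul_mul, Matrix.mul_smul, hBX, Matrix.mul_smul, Matrix.smul_mul, smul_comm]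
  · intro h
    have h1 : ((u ^ 2)⁻¹ • Y)ᵀ * (u ^ 2)⁻¹ • Xh = (u ^ 4)⁻¹ • (Yᵀ * Xh) := by
      simp only [Matrix.transpose_smul, Matrix.smul_mul, Matrix.mul_smul, smul_smul]
      congr 1; field_simp
    rw [h1] at h ⊢
    rw [Matrix.smul_mul]
    refine (hA ?_).smul (by positivity)
    rw [Matrix.det_smul] at h
    exact right_ne_zero_of_mul h
  · exact norm_scaled_le (by positivity) hΓ (le_trans (le_of_eq (by field_simp)) hL0L)
  · have h1 : Matrix.diagonal (fun k ↦ ((u ^ 4)⁻¹ * s k)⁻¹) =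
        u ^ 4 • Matrix.diagonal fun k ↦ (s k)⁻¹ := by
      rw [← Matrix.diagonal_smul]
      congr 1; ext k; simp only [Pi.smul_apply, smul_eq_mul, mul_inv, inv_inv]
    rw [h1]
    refine norm_scaled_le (by positivity) hSinv ?_
    calc u ^ 4 * (d * (2 * ‖Γ‖)) ≤ u ^ 4 * (d * (2 * (L₀ / u ^ 4))) := by gcongr
      _ = 2 * d * L₀ := by field_simp
      _ ≤ L := by rw [hL]; nlinarith
  · refine norm_scaled_le (b := √(L₀ * u ^ 4)) (by positivity) (Real.le_sqrt_of_sq_le hY) ?_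
    rw [Real.sqrt_mul hL₀, show u ^ 4 = (u ^ 2) ^ 2 by ring, Real.sqrt_sq (by positivity)]
    have : √L₀ ≤ L := Real.sqrt_le_iff.2 ⟨by linarith, hL0L.trans (le_self_pow₀ hL1 (by norm_num))⟩
    refine le_trans (le_of_eq ?_) this
    field_simp
  · have h1 : ‖Xh‖ ^ 2 ≤ L * u ^ 4 := by
      calc _ ≤ _ := hXL
        _ ≤ d * (L₀ * u ^ 4 + u ^ 4) := mul_le_mul_of_nonneg_left (add_le_add hY hΛu3) hd0
        _ = d * (L₀ + 1) * u ^ 4 := by ring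
        _ ≤ L * u ^ 4 := by gcongr; rw [hL]; nlinarith
    refine norm_scaled_le (b := √(L * u ^ 4)) (by positivity) (Real.le_sqrt_of_sq_le h1) ?_
    rw [Real.sqrt_mul (by linarith), show u ^ 4 = (u ^ 2) ^ 2 by ring, Real.sqrt_sq (by positivity)]
    have : √L ≤ L := Real.sqrt_le_iff.2 ⟨by linarith, le_self_pow₀ hL1 (by norm_num)⟩
    refine le_trans (le_of_eq ?_) this
    field_simp
  · intro M
    rw [Matrix.smul_mul, norm_smul, Real.norm_of_nonneg (by positivity)]
    calc (u ^ 4)⁻¹ * ‖N * M‖ ≤ (u ^ 4)⁻¹ * (Λ * u ^ 3 * ‖M‖) := by gcongr; exact hρ M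
      _ = _ := by field_simp
  · rw [Matrix.smul_mul, Matrix.mul_smul, smul_smul]
    exact norm_scaled_le (by positivity) hb (le_of_eq (by field_simp))
  · simp only [Matrix.transpose_smul, Matrix.smul_mul, Matrix.mul_smul, smul_smul]
    exact norm_scaled_le (by positivity) hq (le_of_eq (by field_simp))
  · rw [Matrix.mul_smul]
    refine norm_scaled_le (by positivity) (hy.trans hL0L) (le_of_eq (by field_simp))
  · rw [Matrix.mul_smul]
    refine norm_scaled_le (by positivity) hr (le_of_eq (by field_simp))
  · simp only [Matrix.smul_mul, Matrix.mul_smul, smul_smul]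
    exact norm_scaled_le (by positivity) hp (le_of_eq (by field_simp))
  · rw [mul_div_assoc', div_le_one hu0]; exact hΛu
  · rw [div_pow, mul_div_assoc', div_le_one (by positivity)]
    calc 32 * L ^ 15 * Λ ^ 2 ≤ 40 * L ^ 24 * (1 + Λ) ^ 2 := by
          have h1 : L ^ 15 ≤ L ^ 24 := pow_le_pow_right₀ hL1 (by norm_num)
          have h2 : Λ ^ 2 ≤ (1 + Λ) ^ 2 := by gcongr; linarith
          gcongr; norm_num
      _ ≤ u := huL
      _ ≤ (u ^ 2) ^ 2 := by rw [← pow_mul]; exact le_self_pow₀ hu1 (by norm_num)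
  · have h1 : 40 * L ^ 24 * (Λ / u ^ 4 + (Λ / u ^ 2) ^ 2) = 40 * L ^ 24 * (Λ + Λ ^ 2) / u ^ 4 := by
      field_simp
    rw [h1, div_le_one (by positivity)]
    calc 40 * L ^ 24 * (Λ + Λ ^ 2) ≤ 40 * L ^ 24 * (1 + Λ) ^ 2 := by gcongr; nlinarith
      _ ≤ u := huL
      _ ≤ u ^ 4 := le_self_pow₀ hu1 (by norm_num)

end Embedding

/-! ### From the centred noise back to the noise matrix -/

section RawNoise

variable {n d : ℕ}

/-- The row vector that selects the row `i`. -/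
def rowSelector (i : Fin n) : Matrix Unit (Fin n) ℝ := Matrix.of fun _ j ↦ if j = i then 1 else 0

/-- The all-ones row vector. -/
def onesRow (n : ℕ) : Matrix Unit (Fin n) ℝ := Matrix.of fun _ _ ↦ 1

lemma rowSelector_mul_apply {m : Type*} (i : Fin n) (M : Matrix (Fin n) m ℝ) (x : Unit) (j : m) :
    (rowSelector i * M) x j = M i j := by
  simp [rowSelector, Matrix.mul_apply]

lemma onesRow_mul_apply {m : Type*} (M : Matrix (Fin n) m ℝ) (x : Unit) (j : m) :
    (onesRow n * M) x j = ∑ i, M i j := by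
  simp [onesRow, Matrix.mul_apply]

lemma rowSelector_mul_centering (i : Fin n) :
    rowSelector i * centering n = rowSelector i - (n : ℝ)⁻¹ • onesRow n := by
  ext x j
  rw [rowSelector_mul_apply]
  simp [centering, rowSelector, onesRow, Matrix.one_apply, eq_comm]

lemma centering_eq : centering n = 1 - (n : ℝ)⁻¹ • ((onesRow n)ᵀ * onesRow n) := by
  ext i j
  simp [centering, onesRow, Matrix.mul_apply]

lemma norm_onesRow_transpose : ‖(onesRow n)ᵀ‖ ^ 2 = n := by
  rw [frobenius_norm_sq]; simp [onesRow]

variable {E : Matrix (Fin n) (Fin n) ℝ} {z : ℕ → EuclideanSpace ℝ (Fin d)}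

lemma gramNoise_mul_centered (hn : 0 < n) :
    gramNoise E * centered n z = (-(1 / 2 : ℝ)) • (centering n * (E * centered n z)) := by
  rw [gramNoise, Matrix.smul_mul, Matrix.mul_assoc, centering_mul_centered hn, Matrix.mul_assoc]

lemma norm_half_smul_le {ι κ : Type*} [Fintype ι] [Fintype κ] (M : Matrix ι κ ℝ) :
    ‖(-(1 / 2 : ℝ)) • M‖ ≤ ‖M‖ := by
  rw [norm_smul]
  have : ‖(-(1 / 2 : ℝ))‖ = 1 / 2 := by norm_num
  rw [this]
  linarith [norm_nonneg M]

/-- The core of PEPEP is EPE = (PE)ᵀ(PE), which has the same norm as (PE)(PE)ᵀ = PE²P. The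
projections are then dropped. -/
lemma norm_gramNoise_mul_self_le (hn : 0 < n) (hE : Eᵀ = E) :
    ‖gramNoise E * gramNoise E‖ ≤ ‖E * E‖ := by
  set P := centering n with hP
  have hPT : Pᵀ = P := centering_transpose
  have hPP : P * P = P := centering_mul_centering hn
  have h1 : gramNoise E * gramNoise E =
      (-(1 / 2 : ℝ)) • ((-(1 / 2 : ℝ)) • (P * ((P * E)ᵀ * (P * E)) * P)) := by
    rw [gramNoise, Matrix.smul_mul, Matrix.mul_smul, Matrix.transpose_mul, hE, ← hP, hPT]
    congr 2
    simp only [Matrix.mul_assoc]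
  have h2 : (P * E) * (P * E)ᵀ = P * (E * E) * P := by
    rw [Matrix.transpose_mul, hE, hPT]; simp only [Matrix.mul_assoc]
  rw [h1]
  calc _ ≤ ‖P * ((P * E)ᵀ * (P * E)) * P‖ := (norm_half_smul_le _).trans (norm_half_smul_le _)
    _ ≤ ‖(P * E)ᵀ * (P * E)‖ :=
        (norm_mul_projection_le hPT hPP _).trans (norm_projection_mul_le hPT hPP _)
    _ = ‖P * (E * E) * P‖ := by rw [norm_transpose_mul_self, h2]
    _ ≤ _ := (norm_mul_projection_le hPT hPP _).trans (norm_projection_mul_le hPT hPP _)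

lemma norm_gramNoise_mul_centered_le (hn : 0 < n) :
    ‖gramNoise E * centered n z‖ ≤ ‖E * centered n z‖ := by
  rw [gramNoise_mul_centered hn]
  exact (norm_half_smul_le _).trans
    (norm_projection_mul_le centering_transpose (centering_mul_centering hn) _)

lemma norm_cross_gramNoise_le (hn : 0 < n) :
    ‖(centered n z)ᵀ * (gramNoise E * centered n z)‖ ≤
      ‖(centered n z)ᵀ * (E * centered n z)‖ := by
  have h : (centered n z)ᵀ * centering n = (centered n z)ᵀ := by
    rw [← Matrix.transpose_inj, Matrix.transpose_mul, Matrix.transpose_transpose,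
      centering_transpose, centering_mul_centered hn]
  rw [gramNoise_mul_centered hn, Matrix.mul_smul, ← Matrix.mul_assoc, h]
  exact norm_half_smul_le _

lemma rowSelector_mul_gramNoise (i : Fin n) :
    rowSelector i * gramNoise E = (-(1 / 2 : ℝ)) •
      ((rowSelector i * E - (n : ℝ)⁻¹ • (onesRow n * E)) * centering n) := by
  rw [gramNoise, Matrix.mul_smul, ← Matrix.mul_assoc, ← Matrix.mul_assoc,
    rowSelector_mul_centering, Matrix.sub_mul, Matrix.smul_mul]

lemma norm_rowSelector_mul_gramNoise_le (hn : 0 < n) (i : Fin n) :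
    ‖rowSelector i * gramNoise E‖ ≤ ‖rowSelector i * E‖ + (n : ℝ)⁻¹ * ‖onesRow n * E‖ := by
  rw [rowSelector_mul_gramNoise]
  refine (norm_half_smul_le _).trans
    ((norm_mul_projection_le centering_transpose (centering_mul_centering hn) _).trans
      ((norm_sub_le _ _).trans ?_))
  rw [norm_smul, Real.norm_of_nonneg (by positivity)]

/-- Row i of P is the unit row minus the averaging row. For the unit row the inner P is expanded
too, so that the exact product of row i of E with EY survives for its own moment bound. In the
averaged terms the factor 1/n makes submultiplicativity sufficient. -/
lemma norm_rowSelector_mul_gramNoise_sq_le (hn : 0 < n) (i : Fin n) :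
    ‖rowSelector i * gramNoise E * (gramNoise E * centered n z)‖ ≤
      ‖rowSelector i * E * (E * centered n z)‖ +
      (n : ℝ)⁻¹ * (‖rowSelector i * E‖ * √n * ‖onesRow n * (E * centered n z)‖) +
      (n : ℝ)⁻¹ * (‖onesRow n * E‖ * ‖E * centered n z‖) := by
  set Y := centered n z
  set a := rowSelector i * E
  set o := onesRow n * E
  have h1 : rowSelector i * gramNoise E * (gramNoise E * Y) = (-(1 / 2 : ℝ)) • ((-(1 / 2 : ℝ)) •
      (a * (E * Y) - (n : ℝ)⁻¹ • ((a * (onesRow n)ᵀ) * (onesRow n * (E * Y)))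
        - (n : ℝ)⁻¹ • (o * (centering n * (E * Y))))) := by
    rw [gramNoise_mul_centered hn, rowSelector_mul_gramNoise, Matrix.smul_mul, Matrix.mul_smul,
      Matrix.mul_assoc, ← Matrix.mul_assoc (centering n), centering_mul_centering hn,
      Matrix.sub_mul, Matrix.smul_mul]
    congr 3
    rw [centering_eq, Matrix.sub_mul, Matrix.mul_sub, Matrix.one_mul, Matrix.smul_mul,
      Matrix.mul_smul]
    simp only [a, Y, Matrix.mul_assoc]
  have hs : ‖(onesRow n)ᵀ‖ = √n := by
    rw [← norm_onesRow_transpose, Real.sqrt_sq (norm_nonneg _)]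
  rw [h1]
  refine (norm_half_smul_le _).trans ((norm_half_smul_le _).trans
    ((norm_sub_le _ _).trans (add_le_add ((norm_sub_le _ _).trans (add_le_add le_rfl ?_)) ?_)))
  · rw [norm_smul, Real.norm_of_nonneg (by positivity)]
    gcongr
    exact frobenius_norm_mul_le_of_le (frobenius_norm_mul_le_of_le le_rfl hs.le) le_rfl
  · rw [norm_smul, Real.norm_of_nonneg (by positivity)]
    gcongr
    exact frobenius_norm_mul_le_of_le le_rfl
      (norm_projection_mul_le centering_transpose (centering_mul_centering hn) _)

lemma rowSelector_mul_gramNoise_mul_centered (hn : 0 < n) (i : Fin n) :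
    rowSelector i * gramNoise E * centered n z = (-(1 / 2 : ℝ)) •
      (rowSelector i * (E * centered n z) - (n : ℝ)⁻¹ • (onesRow n * (E * centered n z))) := by
  rw [Matrix.mul_assoc, gramNoise_mul_centered hn, Matrix.mul_smul, ← Matrix.mul_assoc,
    rowSelector_mul_centering, Matrix.sub_mul, Matrix.smul_mul]

/-- The constant in the expansion of a row of the embedding, in terms of bounds `L` on the data
and `Λ` on the noise. -/
noncomputable def expansionBound (L Λ : ℝ) : ℝ :=
  200 * L ^ 27 * ((L + Λ) * (Λ + Λ ^ 2) + Λ + Λ ^ 3)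

/-- The constant in the expansion of a row of the embedding. -/
noncomputable def expansionConst (d : ℕ) (L₀ a : ℝ) : ℝ :=
  expansionBound (2 * (d + 1) * (L₀ + 1)) (a + 2 * a ^ 2 + 2 * a ^ 4) + a ^ 2 * L₀

/-- How large the fourth root of the sample size has to be for the expansion. -/
noncomputable def expansionThreshold (d : ℕ) (L₀ a : ℝ) : ℝ :=
  40 * (2 * (d + 1) * (L₀ + 1)) ^ 24 * (1 + (a + 2 * a ^ 2 + 2 * a ^ 4)) ^ 2

/-- The bounds on the noise `E` (relative to the data) under which the row `i` of the embedding
can be expanded. -/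
structure NoiseBound (E : Matrix (Fin n) (Fin n) ℝ) (Y : Matrix (Fin n) (Fin d) ℝ) (i : Fin n)
    (a u : ℝ) : Prop where
  sq : ‖E * E‖ ≤ a ^ 2 * u ^ 6
  data : ‖E * Y‖ ≤ a ^ 2 * u ^ 4
  cross : ‖Yᵀ * (E * Y)‖ ≤ a ^ 2 * u ^ 4
  row : ‖rowSelector i * E‖ ≤ a ^ 2 * u ^ 2
  ones : ‖onesRow n * E‖ ≤ a ^ 2 * u ^ 4
  ones_data : ‖onesRow n * (E * Y)‖ ≤ a ^ 2 * u ^ 4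
  row_sq : ‖rowSelector i * E * (E * Y)‖ ≤ a ^ 2 * u ^ 4

/-- The bounds on the data under which a row of the embedding can be expanded. -/
structure DataBound (Y : Matrix (Fin n) (Fin d) ℝ) (i : Fin n) (L₀ : ℝ) : Prop where
  det : IsUnit (Yᵀ * Y).det
  inv : ‖(Yᵀ * Y)⁻¹‖ ≤ L₀ / n
  norm : ‖Y‖ ^ 2 ≤ L₀ * n
  row : ‖rowSelector i * Y‖ ≤ L₀

variable {i : Fin n} {a u L₀ : ℝ}

lemma NoiseBound.gramNoise_sq (h : NoiseBound E (centered n z) i a u) (hE : Eᵀ = E) (ha : 0 ≤ a) :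
    ‖gramNoise E * gramNoise E‖ ≤ (a + 2 * a ^ 2 + 2 * a ^ 4) ^ 2 * u ^ 6 := by
  refine (norm_gramNoise_mul_self_le i.pos hE).trans (h.sq.trans ?_)
  have : a ≤ a + 2 * a ^ 2 + 2 * a ^ 4 := by nlinarith [pow_nonneg ha 4, pow_nonneg ha 2]
  have h6 : 0 ≤ u ^ 6 := by positivity
  gcongr

theorem exists_embedding_of_bounds (hE : Eᵀ = E) (hD : DataBound (centered n z) i L₀)
    (hN : NoiseBound E (centered n z) i a u) (hu : u ^ 4 = n) (hu0 : 0 < u) (hL₀ : 0 ≤ L₀)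
    (ha : 0 ≤ a) (hua : expansionThreshold d L₀ a ≤ u) (hdn : d ≤ n) :
    ∃ X : Matrix (Fin n) (Fin d) ℝ, IsCMDSEmbedding (sqDist n z + E) X := by
  set Λ := a + 2 * a ^ 2 + 2 * a ^ 4 with hΛ
  have hΛ0 : 0 ≤ Λ := by positivity
  refine exists_isCMDSEmbedding i.pos hdn hE hD.det (ρ := Λ * u ^ 3) (by positivity)
    ((hN.gramNoise_sq hE ha).trans (le_of_eq (by ring))) ?_
  have h1 : ‖((centered n z)ᵀ * centered n z)⁻¹‖ ≤ L₀ / u ^ 4 := by rw [hu]; exact hD.inv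
  calc _ ≤ 2 * (L₀ / u ^ 4 * (Λ * u ^ 3)) := by gcongr
    _ = 2 * L₀ * Λ / u := by field_simp
    _ ≤ 1 := by
      rw [div_le_one hu0]
      refine le_trans ?_ hua
      rw [expansionThreshold, ← hΛ]
      have hd : (0 : ℝ) ≤ d := by positivity
      have h5 : L₀ ≤ 2 * (d + 1) * (L₀ + 1) := by nlinarith
      have h6 : 1 ≤ 2 * (d + 1) * (L₀ + 1) := by nlinarith
      generalize 2 * ((d : ℝ) + 1) * (L₀ + 1) = B at h5 h6 ⊢
      have h2 : L₀ ≤ B ^ 24 := h5.trans (le_self_pow₀ h6 (by simp))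
      have h3 : Λ ≤ (1 + Λ) ^ 2 := by nlinarith
      have h4 : 0 ≤ B ^ 24 := hL₀.trans h2
      generalize B ^ 24 = C at h2 h4 ⊢
      calc 2 * L₀ * Λ ≤ 40 * L₀ * Λ := by gcongr; norm_num
        _ ≤ 40 * C * (1 + Λ) ^ 2 := by gcongr

theorem norm_embedding_row_le (hE : Eᵀ = E) (hD : DataBound (centered n z) i L₀)
    (hN : NoiseBound E (centered n z) i a u) (hu : u ^ 4 = n) (hu0 : 0 < u) (hL₀ : 0 ≤ L₀)
    (ha : 0 ≤ a) (hua : expansionThreshold d L₀ a ≤ u)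
    {X : Matrix (Fin n) (Fin d) ℝ} (hX : IsCMDSEmbedding (sqDist n z + E) X)
    {W : Matrix (Fin d) (Fin d) ℝ} (hW : W ∈ Matrix.orthogonalGroup (Fin d) ℝ)
    (hA : ((centered n z)ᵀ * X).det ≠ 0 → ((centered n z)ᵀ * X * W).PosSemidef) :
    u ^ 2 * ‖rowSelector i * (X * W) - rowSelector i * centered n z + (1 / 2 : ℝ) •
      (rowSelector i * (E * centered n z) * ((centered n z)ᵀ * centered n z)⁻¹)‖ ≤
      expansionConst d L₀ a / u := by
  have hn : 0 < n := i.pos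
  have hn0 : (0 : ℝ) < n := by exact_mod_cast hn
  have hu1 : 1 ≤ u := by
    have : (1 : ℝ) ≤ u ^ 4 := by rw [hu]; exact_mod_cast hn
    by_contra! hlt
    have := pow_lt_one₀ hu0.le hlt (n := 4) (by norm_num)
    linarith
  -- The bound on E² needs a, the row bound needs 2a², and the product of the row with NY needs a² +
  -- 2a⁴; the sum dominates all three.
  set Λ := a + 2 * a ^ 2 + 2 * a ^ 4 with hΛ
  set L := 2 * ((d : ℝ) + 1) * (L₀ + 1) with hL
  have ha2 : a ^ 2 ≤ Λ := by rw [hΛ]; nlinarith [pow_nonneg ha 4, pow_nonneg ha 2]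
  have ha22 : 2 * a ^ 2 ≤ Λ := by rw [hΛ]; nlinarith [pow_nonneg ha 4, pow_nonneg ha 2]
  have hninv : (n : ℝ)⁻¹ = (u ^ 4)⁻¹ := by rw [hu]
  have hsqrt : √(n : ℝ) = u ^ 2 := by
    rw [← hu, show u ^ 4 = (u ^ 2) ^ 2 by ring, Real.sqrt_sq (by positivity)]
  have hr : ‖rowSelector i * gramNoise E‖ ≤ Λ * u ^ 2 := by
    refine (norm_rowSelector_mul_gramNoise_le hn i).trans ?_
    calc _ ≤ a ^ 2 * u ^ 2 + (u ^ 4)⁻¹ * (a ^ 2 * u ^ 4) := by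
          rw [hninv]; gcongr
          · exact hN.row
          · exact hN.ones
      _ = a ^ 2 * u ^ 2 + a ^ 2 * 1 := by field_simp
      _ ≤ a ^ 2 * u ^ 2 + a ^ 2 * u ^ 2 := by gcongr; exact one_le_pow₀ hu1
      _ = 2 * a ^ 2 * u ^ 2 := by ring
      _ ≤ _ := by gcongr
  have hp : ‖rowSelector i * gramNoise E * (gramNoise E * centered n z)‖ ≤ Λ * u ^ 4 := by
    refine (norm_rowSelector_mul_gramNoise_sq_le hn i).trans ?_
    rw [hninv, hsqrt]
    calc _ ≤ a ^ 2 * u ^ 4 + (u ^ 4)⁻¹ * (a ^ 2 * u ^ 2 * u ^ 2 * (a ^ 2 * u ^ 4)) +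
          (u ^ 4)⁻¹ * (a ^ 2 * u ^ 4 * (a ^ 2 * u ^ 4)) := by
          gcongr
          · exact hN.row_sq
          · exact hN.row
          · exact hN.ones_data
          · exact hN.ones
          · exact hN.data
      _ = (a ^ 2 + 2 * a ^ 4) * u ^ 4 := by field_simp; ring
      _ ≤ _ := by gcongr; rw [hΛ]; nlinarith [pow_nonneg ha 2]
  have key := norm_embedding_expansion_le hE hD.det hX hW hA (e := rowSelector i) (u := u)
    (L₀ := L₀) (L := L) (Λ := Λ) hu hu0 hL₀ hL (by positivity) hua hD.inv hD.norm hD.row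
    (hN.gramNoise_sq hE ha)
    ((norm_gramNoise_mul_centered_le hn).trans (hN.data.trans (by gcongr)))
    ((norm_cross_gramNoise_le hn).trans (hN.cross.trans (by gcongr))) hr hp
  set Γ := ((centered n z)ᵀ * centered n z)⁻¹ with hΓ
  -- Row i of PEY is row i of EY minus the average of the rows of EY. The average is of lower order
  -- and is estimated separately.
  have hsplit : rowSelector i * (X * W) - rowSelector i * centered n z + (1 / 2 : ℝ) •
      (rowSelector i * (E * centered n z) * Γ) =
      (rowSelector i * (X * W) - rowSelector i * centered n z -
        rowSelector i * gramNoise E * centered n z * Γ) +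
      (1 / 2 : ℝ) • ((n : ℝ)⁻¹ • (onesRow n * (E * centered n z) * Γ)) := by
    rw [rowSelector_mul_gramNoise_mul_centered hn, Matrix.smul_mul, Matrix.sub_mul, Matrix.smul_mul,
      smul_sub, neg_smul, neg_smul]
    abel
  have hlast : ‖(1 / 2 : ℝ) • ((n : ℝ)⁻¹ • (onesRow n * (E * centered n z) * Γ))‖ ≤
      (u ^ 4)⁻¹ * (a ^ 2 * u ^ 4 * (L₀ / u ^ 4)) := by
    have hb : ‖onesRow n * (E * centered n z) * Γ‖ ≤ a ^ 2 * u ^ 4 * (L₀ / u ^ 4) :=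
      frobenius_norm_mul_le_of_le hN.ones_data (by rw [hu]; exact hD.inv)
    have hb0 := (norm_nonneg _).trans hb
    rw [norm_smul, norm_smul, hninv, Real.norm_of_nonneg (by positivity),
      Real.norm_of_nonneg (by positivity)]
    have : (u ^ 4)⁻¹ * ‖onesRow n * (E * centered n z) * Γ‖ ≤
        (u ^ 4)⁻¹ * (a ^ 2 * u ^ 4 * (L₀ / u ^ 4)) := by gcongr
    have h0 : 0 ≤ (u ^ 4)⁻¹ * ‖onesRow n * (E * centered n z) * Γ‖ := by positivity
    linarith
  rw [hsplit]
  calc _ ≤ u ^ 2 * (‖rowSelector i * (X * W) - rowSelector i * centered n z -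
        rowSelector i * gramNoise E * centered n z * Γ‖ +
        (u ^ 4)⁻¹ * (a ^ 2 * u ^ 4 * (L₀ / u ^ 4))) := by
        gcongr; exact (norm_add_le _ _).trans (add_le_add le_rfl hlast)
    _ ≤ 200 * L ^ 27 * ((L + Λ) * (Λ + Λ ^ 2) + Λ + Λ ^ 3) / u + a ^ 2 * L₀ / u ^ 2 := by
        rw [mul_add]
        refine add_le_add key (le_of_eq ?_)
        field_simp
    _ ≤ 200 * L ^ 27 * ((L + Λ) * (Λ + Λ ^ 2) + Λ + Λ ^ 3) / u + a ^ 2 * L₀ / u := by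
        gcongr; exact le_self_pow₀ hu1 (by norm_num)
    _ = (200 * L ^ 27 * ((L + Λ) * (Λ + Λ ^ 2) + Λ + Λ ^ 3) + a ^ 2 * L₀) / u := (add_div _ _ _).symm

/-- Without noise the remainder bound vanishes, so the expansion is exact; the degenerate case σ = 0
depends on this. -/
lemma expansionConst_zero (L₀ : ℝ) : expansionConst d L₀ 0 = 0 := by
  simp [expansionConst, expansionBound]

end RawNoise

/-! ### Second moments of linear and quadratic forms in the noise -/

section SecondMoments

variable {Ω : Type*} [MeasurableSpace Ω] {P : Measure Ω}

/-- The m_a are pairwise orthogonal in L², so only the diagonal terms of the expanded square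
survive. The lower integral form suits the later Markov and Fubini arguments. -/
lemma lintegral_sum_sq_le {ι : Type*} [Fintype ι] {m : ι → Ω → ℝ} {M : ℝ}
    (hm : ∀ a, MemLp (m a) 2 P) (h0 : ∀ a b, a ≠ b → ∫ ω, m a ω * m b ω ∂P = 0)
    (hM : ∀ a, ∫ ω, m a ω ^ 2 ∂P ≤ M) (w : ι → ℝ) :
    ∫⁻ ω, ENNReal.ofReal ((∑ a, m a ω * w a) ^ 2) ∂P ≤ ENNReal.ofReal (M * ∑ a, w a ^ 2) := by
  have hint : ∀ a b, Integrable (fun ω ↦ m a ω * w a * (m b ω * w b)) P := fun a b ↦ by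
    have := ((hm a).integrable_mul (hm b)).mul_const (w a * w b)
    refine this.congr (ae_of_all _ fun ω ↦ ?_)
    simp only [Pi.mul_apply]; ring
  have hsq : ∀ ω, (∑ a, m a ω * w a) ^ 2 = ∑ a, ∑ b, m a ω * w a * (m b ω * w b) := fun ω ↦ by
    rw [sq, Finset.sum_mul_sum]
  rw [← ofReal_integral_eq_lintegral_ofReal _ (ae_of_all _ fun ω ↦ sq_nonneg _)]
  · refine ENNReal.ofReal_le_ofReal ?_
    simp_rw [hsq]
    rw [integral_finsetSum _ fun a _ ↦ integrable_finsetSum _ fun b _ ↦ hint a b, Finset.mul_sum]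
    refine Finset.sum_le_sum fun a _ ↦ ?_
    rw [integral_finsetSum _ fun b _ ↦ hint a b, Finset.sum_eq_single a]
    · have : ∫ ω, m a ω * w a * (m a ω * w a) ∂P = (∫ ω, m a ω ^ 2 ∂P) * w a ^ 2 := by
        rw [← integral_mul_const]
        refine integral_congr_ae (ae_of_all _ fun ω ↦ ?_)
        simp only; ring
      rw [this]
      exact mul_le_mul_of_nonneg_right (hM a) (sq_nonneg _)
    · intro b _ hb
      have : ∫ ω, m a ω * w a * (m b ω * w b) ∂P = (∫ ω, m a ω * m b ω ∂P) * (w a * w b) := by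
        rw [← integral_mul_const]
        refine integral_congr_ae (ae_of_all _ fun ω ↦ ?_)
        simp only; ring
      rw [this, h0 a b hb.symm, zero_mul]
    · simp
  · simp_rw [hsq]
    exact integrable_finsetSum _ fun a _ ↦ integrable_finsetSum _ fun b _ ↦ hint a b

/-- A random symmetric hollow matrix with independent centred entries of variance `σ²` and fourth
moments at most `C`. -/
structure IsNoise {n : ℕ} (P : Measure Ω) (E : Ω → Matrix (Fin n) (Fin n) ℝ) (σ C : ℝ) : Prop where
  measurable : ∀ i j, Measurable fun ω ↦ E ω i j
  mean : ∀ i j, ∫ ω, E ω i j ∂P = 0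
  hollow : ∀ ω i, E ω i i = 0
  symm : ∀ ω, (E ω)ᵀ = E ω
  indep : iIndepFun (fun (p : {p : Fin n × Fin n // p.1 < p.2}) ω ↦ E ω p.1.1 p.1.2) P
  var : ∀ i j, i ≠ j → ∫ ω, E ω i j ^ 2 ∂P = σ ^ 2
  integrable : ∀ i j, Integrable (fun ω ↦ E ω i j ^ 4) P
  fourth : ∀ i j, ∫ ω, E ω i j ^ 4 ∂P ≤ C

namespace IsNoise

variable {n : ℕ} {E : Ω → Matrix (Fin n) (Fin n) ℝ} {σ C : ℝ}

lemma nonneg (h : IsNoise P E σ C) (i : Fin n) : 0 ≤ C :=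
  (integral_nonneg fun ω ↦ by positivity).trans (h.fourth i i)

lemma apply_symm (h : IsNoise P E σ C) (ω : Ω) (i j : Fin n) : E ω i j = E ω j i := by
  conv_lhs => rw [← h.symm ω]
  rfl

lemma memLp_two [IsProbabilityMeasure P] (h : IsNoise P E σ C) (i j : Fin n) : MemLp (fun ω ↦ E ω i j) 2 P := by
  rw [memLp_two_iff_integrable_sq (h.measurable i j).aestronglyMeasurable]
  refine ((integrable_const (1 : ℝ)).add (h.integrable i j)).mono'
    ((h.measurable i j).pow_const 2).aestronglyMeasurable (ae_of_all _ fun ω ↦ ?_)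
  rw [Real.norm_of_nonneg (sq_nonneg _)]
  simp only [Pi.add_apply]
  nlinarith [sq_nonneg (E ω i j ^ 2 - 1), sq_nonneg (E ω i j)]

lemma mul_memLp_two (h : IsNoise P E σ C) (i j k l : Fin n) : MemLp (fun ω ↦ E ω i j * E ω k l) 2 P := by
  have hmeas : Measurable fun ω ↦ E ω i j * E ω k l := (h.measurable i j).mul (h.measurable k l)
  rw [memLp_two_iff_integrable_sq hmeas.aestronglyMeasurable]
  refine ((h.integrable i j).add (h.integrable k l)).mono'
    (hmeas.pow_const 2).aestronglyMeasurable (ae_of_all _ fun ω ↦ ?_)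
  rw [Real.norm_of_nonneg (sq_nonneg _)]
  simp only [Pi.add_apply]
  nlinarith [sq_nonneg (E ω i j ^ 2 - E ω k l ^ 2), sq_nonneg (E ω i j ^ 2),
    sq_nonneg (E ω k l ^ 2)]

lemma integral_mul_sq_le (h : IsNoise P E σ C) (i j k l : Fin n) : ∫ ω, (E ω i j * E ω k l) ^ 2 ∂P ≤ C := by
  have h1 : ∫ ω, (E ω i j * E ω k l) ^ 2 ∂P ≤
      ∫ ω, (1 / 2) * (E ω i j ^ 4 + E ω k l ^ 4) ∂P := by
    refine integral_mono ?_ (((h.integrable i j).add (h.integrable k l)).const_mul _) fun ω ↦ ?_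
    · exact (h.mul_memLp_two i j k l).integrable_sq
    · nlinarith [sq_nonneg (E ω i j ^ 2 - E ω k l ^ 2)]
  rw [integral_const_mul, integral_add (h.integrable i j) (h.integrable k l)] at h1
  linarith [h.fourth i j, h.fourth k l]

/-- The index of the entry `(a, b)` of a symmetric matrix above the diagonal. -/
noncomputable def edge (a b : Fin n) (hab : a ≠ b) : {p : Fin n × Fin n // p.1 < p.2} :=
  if h : a < b then ⟨(a, b), h⟩ else ⟨(b, a), lt_of_le_of_ne (not_lt.1 h) hab.symm⟩

lemma edge_eq {a b c d : Fin n} {hab : a ≠ b} {hcd : c ≠ d} (h : edge a b hab = edge c d hcd) :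
    (a = c ∧ b = d) ∨ (a = d ∧ b = c) := by
  unfold edge at h
  split_ifs at h <;> simp only [Subtype.mk.injEq, Prod.mk.injEq] at h <;> tauto

lemma apply_edge (h : IsNoise P E σ C) (ω : Ω) {a b : Fin n} (hab : a ≠ b) :
    E ω (edge a b hab).1.1 (edge a b hab).1.2 = E ω a b := by
  unfold edge
  split_ifs
  · rfl
  · exact h.apply_symm ω b a

/-- An off-diagonal entry is centred and independent of any function of entries on other edges.
Condition `hs` says that φ looks neither at this entry nor at its mirror image. -/
lemma integral_mul_mul_eq_zero (h : IsNoise P E σ C) {a b : Fin n} (hab : a ≠ b) (s : Finset (Fin n × Fin n))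
    (hs : ∀ p ∈ s, p.1 ≠ p.2 → ¬((a = p.1 ∧ b = p.2) ∨ (a = p.2 ∧ b = p.1)))
    (φ : ((Fin n × Fin n) → ℝ) → ℝ) (hφ : Measurable φ)
    (hφs : ∀ x y, (∀ p ∈ s, x p = y p) → φ x = φ y) :
    ∫ ω, E ω a b * φ (fun p ↦ E ω p.1 p.2) ∂P = 0 := by
  classical
  set X := fun (p : {p : Fin n × Fin n // p.1 < p.2}) ω ↦ E ω p.1.1 p.1.2
  set T : Finset {p : Fin n × Fin n // p.1 < p.2} := Finset.univ.filter (· ≠ edge a b hab)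
  have hind := h.indep.indepFun_finset {edge a b hab} T (by simp [T])
    fun p ↦ h.measurable p.1.1 p.1.2
  -- Rebuilds the matrix from the entries above the diagonal other than the excluded one. The
  -- diagonal is set to zero, its true value; the value at the excluded edge is irrelevant to φ.
  let g : (T → ℝ) → ((Fin n × Fin n) → ℝ) := fun y p ↦
    if hp : p.1 ≠ p.2 then
      if hT : edge p.1 p.2 hp ∈ T then y ⟨_, hT⟩ else 0
    else 0
  have hg : Measurable g := by
    refine measurable_pi_iff.2 fun p ↦ ?_
    simp only [g]
    split_ifs <;> fun_prop
  let e : (({edge a b hab} : Finset {p : Fin n × Fin n // p.1 < p.2}) → ℝ) → ℝ :=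
    fun y ↦ y ⟨edge a b hab, Finset.mem_singleton_self _⟩
  have he : Measurable e := measurable_pi_apply _
  have hind2 := hind.comp he (hφ.comp hg)
  have heq : ∀ ω, φ (fun p ↦ E ω p.1 p.2) = (φ ∘ g) (fun p : T ↦ E ω p.1.1.1 p.1.1.2) := by
    intro ω
    refine hφs _ _ fun p hp ↦ ?_
    simp only [g]
    split_ifs with h1 h2
    · exact (h.apply_edge ω h1).symm
    · exfalso
      simp only [T, Finset.mem_filter, Finset.mem_univ, true_and, not_not] at h2
      exact hs p hp h1 (edge_eq h2.symm)
    · rw [not_not.1 h1, h.hollow]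
  have key := hind2.integral_fun_mul_eq_mul_integral
    ((he.comp (measurable_pi_lambda _
      fun p : ({edge a b hab} : Finset _) ↦ h.measurable p.1.1.1 p.1.1.2)).aestronglyMeasurable)
    (((hφ.comp hg).comp (measurable_pi_lambda _
      fun p : T ↦ h.measurable p.1.1.1 p.1.1.2)).aestronglyMeasurable)
  simp_rw [heq]
  simp only [e, Function.comp_apply, h.apply_edge] at key ⊢
  rw [key, h.mean, zero_mul]

lemma integral_mul_eq_zero (h : IsNoise P E σ C) {a b c d : Fin n} (hab : a ≠ b)
    (hne : ¬((a = c ∧ b = d) ∨ (a = d ∧ b = c))) : ∫ ω, E ω a b * E ω c d ∂P = 0 :=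
  h.integral_mul_mul_eq_zero hab {(c, d)} (by simpa using fun _ ↦ hne) (fun x ↦ x (c, d))
    (measurable_pi_apply _) (fun x y hxy ↦ hxy _ (by simp))

/-- By symmetry each variable occurs twice, so the whole family of entries is not orthogonal. Each
strict triangle is, and joining the two by (x + y)² ≤ 2x² + 2y² produces the factor 4. -/
lemma lintegral_linear_sq_le [IsProbabilityMeasure P] (h : IsNoise P E σ C) (w : Fin n → Fin n → ℝ) :
    ∫⁻ ω, ENNReal.ofReal ((∑ j, ∑ l, E ω j l * w j l) ^ 2) ∂P ≤
      ENNReal.ofReal (4 * σ ^ 2 * ∑ j, ∑ l, w j l ^ 2) := by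
  have key : ∀ (r : Fin n → Fin n → Prop) [∀ j l, Decidable (r j l)],
      (∀ j l, r j l → j ≠ l ∧ ¬ r l j) →
      ∫⁻ ω, ENNReal.ofReal ((∑ j, ∑ l, (if r j l then E ω j l else 0) * w j l) ^ 2) ∂P ≤
        ENNReal.ofReal (σ ^ 2 * ∑ j, ∑ l, w j l ^ 2) := by
    intro r _ hr
    have := lintegral_sum_sq_le (P := P) (M := σ ^ 2)
      (m := fun (p : Fin n × Fin n) ω ↦ if r p.1 p.2 then E ω p.1 p.2 else 0)
      (fun p ↦ ?_) (fun p q hpq ↦ ?_) (fun p ↦ ?_) (fun p ↦ w p.1 p.2)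
    · simpa only [Fintype.sum_prod_type] using this
    · split_ifs
      · exact h.memLp_two _ _
      · exact MemLp.zero
    · split_ifs with h1 h2
      · refine h.integral_mul_eq_zero (hr _ _ h1).1 ?_
        rintro (⟨h3, h4⟩ | ⟨h3, h4⟩)
        · exact hpq (Prod.ext h3 h4)
        · rw [h3, h4] at h1
          exact (hr _ _ h1).2 h2
      all_goals simp
    · split_ifs with h1
      · exact (h.var _ _ (hr _ _ h1).1).le
      · simpa using sq_nonneg σ
  have h1 := key (fun j l ↦ j < l) fun j l hjl ↦ ⟨hjl.ne, hjl.not_gt⟩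
  have h2 := key (fun j l ↦ l < j) fun j l hjl ↦ ⟨hjl.ne', hjl.not_gt⟩
  have hsplit : ∀ ω, ∑ j, ∑ l, E ω j l * w j l =
      ∑ j, ∑ l, (if j < l then E ω j l else 0) * w j l +
      ∑ j, ∑ l, (if l < j then E ω j l else 0) * w j l := fun ω ↦ by
    simp_rw [← Finset.sum_add_distrib, ← add_mul]
    refine Finset.sum_congr rfl fun j _ ↦ Finset.sum_congr rfl fun l _ ↦ ?_
    rcases lt_trichotomy j l with hjl | hjl | hjl
    · simp [hjl, hjl.not_gt]
    · simp [hjl, h.hollow]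
    · simp [hjl, hjl.not_gt]
  have hm : ∀ (r : Fin n → Fin n → Prop) [∀ j l, Decidable (r j l)],
      Measurable fun ω ↦ ∑ j, ∑ l, (if r j l then E ω j l else 0) * w j l := by
    intro r _
    refine Finset.measurable_fun_sum _ fun j _ ↦ Finset.measurable_fun_sum _ fun l _ ↦ ?_
    refine Measurable.mul_const ?_ _
    split_ifs
    · exact h.measurable j l
    · exact measurable_const
  calc _ ≤ ∫⁻ ω, (2 * ENNReal.ofReal ((∑ j, ∑ l, (if j < l then E ω j l else 0) * w j l) ^ 2) +
        2 * ENNReal.ofReal ((∑ j, ∑ l, (if l < j then E ω j l else 0) * w j l) ^ 2)) ∂P := by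
        refine lintegral_mono fun ω ↦ ?_
        rw [hsplit, ← ENNReal.ofReal_ofNat, ← ENNReal.ofReal_mul (by norm_num),
          ← ENNReal.ofReal_mul (by norm_num), ← ENNReal.ofReal_add (by positivity) (by positivity)]
        refine ENNReal.ofReal_le_ofReal ?_
        linarith [add_sq_le (a := ∑ j, ∑ l, (if j < l then E ω j l else 0) * w j l)
          (b := ∑ j, ∑ l, (if l < j then E ω j l else 0) * w j l)]
    _ = _ := by
        rw [lintegral_add_left (((hm _).pow_const 2).ennreal_ofReal.const_mul _),
          lintegral_const_mul _ ((hm _).pow_const 2).ennreal_ofReal,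
          lintegral_const_mul _ ((hm _).pow_const 2).ennreal_ofReal]
    _ ≤ 2 * ENNReal.ofReal (σ ^ 2 * ∑ j, ∑ l, w j l ^ 2) +
        2 * ENNReal.ofReal (σ ^ 2 * ∑ j, ∑ l, w j l ^ 2) := by gcongr
    _ = _ := by
        rw [← ENNReal.ofReal_ofNat, ← ENNReal.ofReal_mul (by norm_num),
          ← ENNReal.ofReal_add (by positivity) (by positivity)]
        congr 1; ring

/-- The off-diagonal part of a row of `E²`. -/
lemma lintegral_offDiag_sq_le (h : IsNoise P E σ C) (i : Fin n) (w : Fin n → ℝ) :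
    ∫⁻ ω, ENNReal.ofReal ((∑ l, (if l = i then 0 else (E ω * E ω) i l) * w l) ^ 2) ∂P ≤
      ENNReal.ofReal (C * (n * ∑ l, w l ^ 2)) := by
  have := lintegral_sum_sq_le (P := P) (M := C)
      (m := fun (p : Fin n × Fin n) ω ↦ if p.2 = i then 0 else E ω i p.1 * E ω p.1 p.2)
      (fun p ↦ ?_) (fun p q hpq ↦ ?_) (fun p ↦ ?_) (fun p ↦ w p.2)
  · simp only [Fintype.sum_prod_type, Finset.sum_const, Finset.card_univ, Fintype.card_fin,
      nsmul_eq_mul] at this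
    convert this using 5 with ω
    rw [Finset.sum_comm]
    refine Finset.sum_congr rfl fun l _ ↦ ?_
    rw [← Finset.sum_mul]
    congr 1
    split_ifs
    · simp
    · rw [Matrix.mul_apply]
  · split_ifs
    · exact MemLp.zero
    · exact h.mul_memLp_two _ _ _ _
  · obtain ⟨j, l⟩ := p
    obtain ⟨j', l'⟩ := q
    split_ifs with h1 h2 h2
    · simp
    · simp
    · simp
    simp only at h1 h2
    rcases eq_or_ne j i with rfl | hj
    · simp [h.hollow]
    rcases eq_or_ne j' i with rfl | hj'
    · simp [h.hollow]
    rcases eq_or_ne j l with rfl | hl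
    · simp [h.hollow]
    -- Orthogonality of E_ij E_jl and E_ij' E_j'l' for l, l' ≠ i: if j = j', the entry E_jl has no
    -- partner, and otherwise E_ij has none.
    rcases eq_or_ne j' j with rfl | hjj
    · have hll : l ≠ l' := fun hll ↦ hpq (by rw [hll])
      have := h.integral_mul_mul_eq_zero hl {(i, j'), (j', l')} (by simp; grind)
        (fun x ↦ x (i, j') * (x (i, j') * x (j', l'))) (by fun_prop)
        (fun x y hxy ↦ by rw [hxy _ (by simp), hxy (j', l') (by simp)])
      rw [← this]
      refine integral_congr_ae (ae_of_all _ fun ω ↦ ?_)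
      simp only; ring
    · have := h.integral_mul_mul_eq_zero hj.symm {(j, l), (i, j'), (j', l')} (by simp; grind)
        (fun x ↦ x (j, l) * (x (i, j') * x (j', l'))) (by fun_prop)
        (fun x y hxy ↦ by rw [hxy (j, l) (by simp), hxy (i, j') (by simp), hxy (j', l') (by simp)])
      rw [← this]
      refine integral_congr_ae (ae_of_all _ fun ω ↦ ?_)
      simp only; ring
  · split_ifs
    · simpa using h.nonneg i
    · exact h.integral_mul_sq_le _ _ _ _

/-- A diagonal entry of E² is a sum of n squares without cancellation, so its second moment may be
of order n², against n off the diagonal. Hence the separate treatment. -/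
lemma lintegral_diag_sq_le (h : IsNoise P E σ C) (i : Fin n) :
    ∫⁻ ω, ENNReal.ofReal ((E ω * E ω) i i ^ 2) ∂P ≤ ENNReal.ofReal (C * n ^ 2) := by
  have hpt : ∀ ω, (E ω * E ω) i i ^ 2 ≤ n * ∑ j, E ω i j ^ 4 := fun ω ↦ by
    have : (E ω * E ω) i i = ∑ j, E ω i j ^ 2 := by
      rw [Matrix.mul_apply]
      exact Finset.sum_congr rfl fun j _ ↦ by rw [h.apply_symm ω j i, sq]
    rw [this]
    have := sq_sum_le_card_mul_sum_sq (s := Finset.univ) (f := fun j ↦ E ω i j ^ 2)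
    simpa [← pow_mul] using this
  have hint : Integrable (fun ω ↦ (n : ℝ) * ∑ j, E ω i j ^ 4) P :=
    (integrable_finsetSum _ fun j _ ↦ h.integrable i j).const_mul _
  calc _ ≤ ∫⁻ ω, ENNReal.ofReal (n * ∑ j, E ω i j ^ 4) ∂P :=
        lintegral_mono fun ω ↦ ENNReal.ofReal_le_ofReal (hpt ω)
    _ = ENNReal.ofReal (∫ ω, n * ∑ j, E ω i j ^ 4 ∂P) :=
        (ofReal_integral_eq_lintegral_ofReal hint (ae_of_all _ fun ω ↦ by positivity)).symm
    _ ≤ _ := by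
        refine ENNReal.ofReal_le_ofReal ?_
        rw [integral_const_mul, integral_finsetSum _ fun j _ ↦ h.integrable i j]
        have : ∑ j, ∫ ω, E ω i j ^ 4 ∂P ≤ n * C := by
          simpa using Finset.sum_le_sum fun j (_ : j ∈ Finset.univ) ↦ h.fourth i j
        calc _ ≤ (n : ℝ) * (n * C) := by gcongr
          _ = _ := by ring

end IsNoise

end SecondMoments

/-! ### Markov bounds for the noise relative to the data -/

section NoiseSize

variable {Ω : Type*} [MeasurableSpace Ω] {P : Measure Ω}

lemma lintegral_ofReal_add_le {f g : Ω → ℝ} {a b : ℝ} (hf : Measurable f) (hf0 : ∀ ω, 0 ≤ f ω)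
    (hg0 : ∀ ω, 0 ≤ g ω) (ha : 0 ≤ a) (hb : 0 ≤ b)
    (hfa : ∫⁻ ω, ENNReal.ofReal (f ω) ∂P ≤ ENNReal.ofReal a)
    (hgb : ∫⁻ ω, ENNReal.ofReal (g ω) ∂P ≤ ENNReal.ofReal b) :
    ∫⁻ ω, ENNReal.ofReal (f ω + g ω) ∂P ≤ ENNReal.ofReal (a + b) := by
  simp_rw [ENNReal.ofReal_add (hf0 _) (hg0 _)]
  rw [ENNReal.ofReal_add ha hb, lintegral_add_left hf.ennreal_ofReal]
  exact add_le_add hfa hgb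

lemma lintegral_ofReal_div_le {f : Ω → ℝ} {a c : ℝ} (hf : Measurable f) (hc : 0 < c)
    (hfa : ∫⁻ ω, ENNReal.ofReal (f ω) ∂P ≤ ENNReal.ofReal a) :
    ∫⁻ ω, ENNReal.ofReal (f ω / c) ∂P ≤ ENNReal.ofReal (a / c) := by
  simp_rw [ENNReal.ofReal_div_of_pos hc, div_eq_mul_inv]
  rw [lintegral_mul_const _ hf.ennreal_ofReal]
  gcongr

lemma measurable_norm_sq {ι κ : Type*} [Fintype ι] [Fintype κ] {M : Ω → Matrix ι κ ℝ}
    (hM : ∀ i j, Measurable fun ω ↦ M ω i j) : Measurable fun ω ↦ ‖M ω‖ ^ 2 := by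
  simp_rw [frobenius_norm_sq]
  exact Finset.measurable_fun_sum _ fun i _ ↦ Finset.measurable_fun_sum _ fun j _ ↦
    (hM i j).pow_const 2

lemma lintegral_norm_sq_le {ι κ : Type*} [Fintype ι] [Fintype κ] {M : Ω → Matrix ι κ ℝ}
    (hM : ∀ i j, Measurable fun ω ↦ M ω i j) {b : ι → κ → ℝ} (hb : ∀ i j, 0 ≤ b i j)
    (h : ∀ i j, ∫⁻ ω, ENNReal.ofReal (M ω i j ^ 2) ∂P ≤ ENNReal.ofReal (b i j)) :
    ∫⁻ ω, ENNReal.ofReal (‖M ω‖ ^ 2) ∂P ≤ ENNReal.ofReal (∑ i, ∑ j, b i j) := by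
  have h1 : ∀ ω, ENNReal.ofReal (‖M ω‖ ^ 2) = ∑ i, ∑ j, ENNReal.ofReal (M ω i j ^ 2) := fun ω ↦ by
    rw [frobenius_norm_sq, ENNReal.ofReal_sum_of_nonneg fun i _ ↦ by positivity]
    exact Finset.sum_congr rfl fun i _ ↦ ENNReal.ofReal_sum_of_nonneg fun j _ ↦ by positivity
  simp_rw [h1]
  rw [lintegral_finsetSum _ fun i _ ↦ Finset.measurable_fun_sum _ fun j _ ↦
    ((hM i j).pow_const 2).ennreal_ofReal,
    ENNReal.ofReal_sum_of_nonneg fun i _ ↦ Finset.sum_nonneg fun j _ ↦ hb i j]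
  refine Finset.sum_le_sum fun i _ ↦ ?_
  rw [lintegral_finsetSum _ fun j _ ↦ ((hM i j).pow_const 2).ennreal_ofReal,
    ENNReal.ofReal_sum_of_nonneg fun j _ ↦ hb i j]
  exact Finset.sum_le_sum fun j _ ↦ h i j

lemma measurable_const_mul_apply {ι κ τ : Type*} [Fintype κ] (N : Matrix ι κ ℝ)
    {M : Ω → Matrix κ τ ℝ} (hM : ∀ i j, Measurable fun ω ↦ M ω i j) (i : ι) (j : τ) :
    Measurable fun ω ↦ (N * M ω) i j := by
  simp only [Matrix.mul_apply]
  fun_prop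

lemma measurable_mul_const_apply {ι κ τ : Type*} [Fintype κ] {M : Ω → Matrix ι κ ℝ}
    (hM : ∀ i j, Measurable fun ω ↦ M ω i j) (N : Matrix κ τ ℝ) (i : ι) (j : τ) :
    Measurable fun ω ↦ (M ω * N) i j := by
  simp only [Matrix.mul_apply]
  fun_prop

variable {n d : ℕ}

/-- The sum of the normalized squared norms that have to be bounded. -/
noncomputable def noiseSize (E : Matrix (Fin n) (Fin n) ℝ) (Y : Matrix (Fin n) (Fin d) ℝ)
    (i : Fin n) : ℝ :=
  ‖E * E‖ ^ 2 / n ^ 3 + (‖E * Y‖ ^ 2 / n ^ 2 + (‖Yᵀ * (E * Y)‖ ^ 2 / n ^ 2 +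
    (‖rowSelector i * E‖ ^ 2 / n + (‖onesRow n * E‖ ^ 2 / n ^ 2 +
    (‖onesRow n * (E * Y)‖ ^ 2 / n ^ 2 + ‖rowSelector i * E * (E * Y)‖ ^ 2 / n ^ 2)))))

lemma measurable_noiseSize {E : Ω → Matrix (Fin n) (Fin n) ℝ} {Y : Ω → Matrix (Fin n) (Fin d) ℝ}
    (hE : ∀ i j, Measurable fun ω ↦ E ω i j) (hY : ∀ i j, Measurable fun ω ↦ Y ω i j)
    (i : Fin n) : Measurable fun ω ↦ noiseSize (E ω) (Y ω) i := by
  have hEY := measurable_mul_apply hE hY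
  have heE := measurable_const_mul_apply (rowSelector i) hE
  unfold noiseSize
  exact ((measurable_norm_sq (measurable_mul_apply hE hE)).div_const _).add
    (((measurable_norm_sq hEY).div_const _).add
    (((measurable_norm_sq (measurable_mul_apply (fun k l ↦ hY l k) hEY)).div_const _).add
    (((measurable_norm_sq heE).div_const _).add
    (((measurable_norm_sq (measurable_const_mul_apply _ hE)).div_const _).add
    (((measurable_norm_sq (measurable_const_mul_apply _ hEY)).div_const _).add
    ((measurable_norm_sq (measurable_mul_apply heE hEY)).div_const _))))))

lemma noiseBound_of_noiseSize_le {E : Matrix (Fin n) (Fin n) ℝ} {Y : Matrix (Fin n) (Fin d) ℝ}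
    {i : Fin n} {a u : ℝ} (hu : u ^ 4 = n) (h : noiseSize E Y i ≤ a ^ 4) :
    NoiseBound E Y i a u := by
  have hn : (0 : ℝ) < n := by exact_mod_cast i.pos
  have key : ∀ {x c b : ℝ}, 0 < c → x ^ 2 / c ≤ a ^ 4 → 0 ≤ b → b ^ 2 = c → x ≤ a ^ 2 * b := by
    intro x c b hc hx hb hbc
    rw [div_le_iff₀ hc, ← hbc, show a ^ 4 * b ^ 2 = (a ^ 2 * b) ^ 2 by ring] at hx
    exact le_of_sq_le_sq hx (by positivity)
  have h0 : 0 ≤ ‖E * E‖ ^ 2 / n ^ 3 := by positivity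
  have h1 : 0 ≤ ‖E * Y‖ ^ 2 / n ^ 2 := by positivity
  have h2 : 0 ≤ ‖Yᵀ * (E * Y)‖ ^ 2 / n ^ 2 := by positivity
  have h3 : 0 ≤ ‖rowSelector i * E‖ ^ 2 / n := by positivity
  have h4 : 0 ≤ ‖onesRow n * E‖ ^ 2 / n ^ 2 := by positivity
  have h5 : 0 ≤ ‖onesRow n * (E * Y)‖ ^ 2 / n ^ 2 := by positivity
  have h6 : 0 ≤ ‖rowSelector i * E * (E * Y)‖ ^ 2 / n ^ 2 := by positivity
  unfold noiseSize at h
  have hu8 : (u ^ 4) ^ 2 = (n : ℝ) ^ 2 := by rw [hu]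
  constructor
  · exact key (c := n ^ 3) (by positivity) (by linarith) (by positivity) (by rw [← hu]; ring)
  · exact key (c := n ^ 2) (by positivity) (by linarith) (by positivity) hu8
  · exact key (c := n ^ 2) (by positivity) (by linarith) (by positivity) hu8
  · exact key (c := n) (by positivity) (by linarith) (by positivity) (by rw [← hu]; ring)
  · exact key (c := n ^ 2) (by positivity) (by linarith) (by positivity) hu8
  · exact key (c := n ^ 2) (by positivity) (by linarith) (by positivity) hu8
  · exact key (c := n ^ 2) (by positivity) (by linarith) (by positivity) hu8

namespace IsNoise

variable {E : Ω → Matrix (Fin n) (Fin n) ℝ} {σ C : ℝ}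

lemma lintegral_sq_apply_le (h : IsNoise P E σ C) (i l : Fin n) :
    ∫⁻ ω, ENNReal.ofReal ((E ω * E ω) i l ^ 2) ∂P ≤
      ENNReal.ofReal (C * n + if l = i then C * n ^ 2 else 0) := by
  have hC := h.nonneg i
  split_ifs with hl
  · rw [hl]
    exact (h.lintegral_diag_sq_le i).trans (ENNReal.ofReal_le_ofReal (by
      have : 0 ≤ C * n := by positivity
      linarith))
  · have := h.lintegral_offDiag_sq_le i (Pi.single l 1)
    rw [Finset.sum_eq_single l (by intro b _ hb; simp [hb]) (by simp)] at this
    refine le_trans (le_of_eq ?_) (this.trans (le_of_eq ?_))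
    · congr 1; ext ω
      rw [Finset.sum_eq_single l (by intro b _ hb; simp [hb]) (by simp)]
      simp [hl]
    · simp

/-- There are n² entries contributing Cn each, and the n diagonal ones contribute a further Cn²
each; both totals are of order n³. -/
lemma lintegral_norm_sq_sq_le (h : IsNoise P E σ C) :
    ∫⁻ ω, ENNReal.ofReal (‖E ω * E ω‖ ^ 2) ∂P ≤ ENNReal.ofReal (2 * C * n ^ 3) := by
  refine (lintegral_norm_sq_le (measurable_mul_apply h.measurable h.measurable) (fun i j ↦ ?_)
    h.lintegral_sq_apply_le).trans (le_of_eq ?_)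
  · have := h.nonneg i; split_ifs <;> positivity
  · congr 1
    simp [Finset.sum_add_distrib]; ring

/-- Row i of E²Y is split into its off-diagonal part, where orthogonality saves a factor n, and the
single term with the diagonal entry of E², which meets only row i of Y. -/
lemma lintegral_norm_row_sq_mul_sq_le (h : IsNoise P E σ C)
    (Y : Matrix (Fin n) (Fin d) ℝ) (i : Fin n) :
    ∫⁻ ω, ENNReal.ofReal (‖rowSelector i * E ω * (E ω * Y)‖ ^ 2) ∂P ≤
      ENNReal.ofReal (2 * (C * (n * ‖Y‖ ^ 2)) + 2 * (C * n ^ 2 * ‖rowSelector i * Y‖ ^ 2)) := by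
  have hC := h.nonneg i
  have hEE := measurable_mul_apply h.measurable h.measurable
  refine (lintegral_norm_sq_le (measurable_mul_apply (measurable_const_mul_apply _ h.measurable)
    (measurable_mul_const_apply h.measurable _))
    (b := fun _ k ↦ 2 * (C * (n * ∑ l, Y l k ^ 2)) + 2 * (C * n ^ 2 * Y i k ^ 2))
    (fun i k ↦ by positivity) (fun x k ↦ ?_)).trans (le_of_eq ?_)
  · have h1 : ∀ ω, (rowSelector i * E ω * (E ω * Y)) x k =
        ∑ l, (if l = i then 0 else (E ω * E ω) i l) * Y l k + (E ω * E ω) i i * Y i k := fun ω ↦ by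
      rw [Matrix.mul_assoc, ← Matrix.mul_assoc (E ω), rowSelector_mul_apply, Matrix.mul_apply,
        ← Finset.sum_erase_add _ _ (Finset.mem_univ i),
        ← Finset.sum_erase_add (a := i) _ _ (Finset.mem_univ i)]
      congr 1
      simp only [if_true, zero_mul, add_zero]
      exact Finset.sum_congr rfl fun l hl ↦ by rw [if_neg (Finset.ne_of_mem_erase hl)]
    have hm : Measurable fun ω ↦ ∑ l, (if l = i then 0 else (E ω * E ω) i l) * Y l k :=
      Finset.measurable_fun_sum _ fun l _ ↦ by
        refine Measurable.mul_const ?_ _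
        split_ifs
        · exact measurable_const
        · exact hEE i l
    have h2 : ∀ (c v : ℝ) (f : Ω → ℝ), 0 ≤ c → Measurable f →
        ∫⁻ ω, ENNReal.ofReal (f ω) ∂P ≤ ENNReal.ofReal v →
        ∫⁻ ω, ENNReal.ofReal (c * f ω) ∂P ≤ ENNReal.ofReal (c * v) := by
      intro c v f hc hf hv
      simp_rw [ENNReal.ofReal_mul hc]
      rw [lintegral_const_mul _ hf.ennreal_ofReal]
      gcongr
    refine le_trans (lintegral_mono fun ω ↦ ENNReal.ofReal_le_ofReal (?_ : _ ≤
      2 * (∑ l, (if l = i then 0 else (E ω * E ω) i l) * Y l k) ^ 2 +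
        2 * (Y i k ^ 2 * (E ω * E ω) i i ^ 2))) ?_
    · rw [h1, ← mul_pow, mul_comm (Y i k), ← mul_add]
      exact add_sq_le
    · refine lintegral_ofReal_add_le ((hm.pow_const 2).const_mul 2) (fun ω ↦ by positivity)
        (fun ω ↦ by positivity) (by positivity) (by positivity) ?_ ?_
      · exact h2 _ _ _ (by norm_num) (hm.pow_const 2) (h.lintegral_offDiag_sq_le i fun l ↦ Y l k)
      · rw [mul_comm (C * (n : ℝ) ^ 2)]
        exact h2 _ _ _ (by norm_num) (((hEE i i).pow_const 2).const_mul _)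
          (h2 _ _ _ (sq_nonneg _) ((hEE i i).pow_const 2) (h.lintegral_diag_sq_le i))
  · have h3 : ‖rowSelector i * Y‖ ^ 2 = ∑ k, Y i k ^ 2 := by
      rw [frobenius_norm_sq]; simp [rowSelector_mul_apply]
    rw [h3, frobenius_norm_sq, Finset.sum_comm (f := fun i j ↦ Y i j ^ 2)]
    congr 1
    simp [Finset.sum_add_distrib, Finset.mul_sum]

variable [IsProbabilityMeasure P]

lemma lintegral_mul_apply_sq_le (h : IsNoise P E σ C) (i : Fin n) (v : Fin n → ℝ) :
    ∫⁻ ω, ENNReal.ofReal ((∑ l, E ω i l * v l) ^ 2) ∂P ≤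
      ENNReal.ofReal (4 * σ ^ 2 * ∑ l, v l ^ 2) := by
  have := h.lintegral_linear_sq_le fun j l ↦ if j = i then v l else 0
  have h1 : ∀ ω, ∑ j, ∑ l, E ω j l * (if j = i then v l else 0) = ∑ l, E ω i l * v l := fun ω ↦ by
    rw [Finset.sum_eq_single i (by intro b _ hb; simp [hb]) (by simp)]; simp
  have h2 : ∑ j : Fin n, ∑ l, (if j = i then v l else 0) ^ 2 = ∑ l, v l ^ 2 := by
    rw [Finset.sum_eq_single i (by intro b _ hb; simp [hb]) (by simp)]; simp
  simpa only [h1, h2] using this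

variable (Y : Matrix (Fin n) (Fin d) ℝ)

lemma lintegral_norm_mul_sq_le (h : IsNoise P E σ C) :
    ∫⁻ ω, ENNReal.ofReal (‖E ω * Y‖ ^ 2) ∂P ≤ ENNReal.ofReal (4 * σ ^ 2 * (n * ‖Y‖ ^ 2)) := by
  refine (lintegral_norm_sq_le (measurable_mul_const_apply h.measurable _)
    (b := fun i k ↦ 4 * σ ^ 2 * ∑ l, Y l k ^ 2) (fun i k ↦ by positivity) (fun i k ↦ ?_)).trans
    (le_of_eq ?_)
  · simp_rw [Matrix.mul_apply]
    exact h.lintegral_mul_apply_sq_le i fun l ↦ Y l k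
  · rw [frobenius_norm_sq, Finset.sum_comm (f := fun i j ↦ Y i j ^ 2)]
    congr 1
    simp [Finset.mul_sum]; ring_nf

lemma lintegral_norm_cross_sq_le (h : IsNoise P E σ C) :
    ∫⁻ ω, ENNReal.ofReal (‖Yᵀ * (E ω * Y)‖ ^ 2) ∂P ≤
      ENNReal.ofReal (4 * σ ^ 2 * (‖Y‖ ^ 2) ^ 2) := by
  refine (lintegral_norm_sq_le (measurable_const_mul_apply _
    (measurable_mul_const_apply h.measurable _))
    (b := fun k m ↦ 4 * σ ^ 2 * ∑ j, ∑ l, (Y j k * Y l m) ^ 2)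
    (fun i k ↦ by positivity) (fun k m ↦ ?_)).trans (le_of_eq ?_)
  · have h1 : ∀ ω, (Yᵀ * (E ω * Y)) k m = ∑ j, ∑ l, E ω j l * (Y j k * Y l m) := fun ω ↦ by
      simp only [Matrix.mul_apply, Matrix.transpose_apply, Finset.mul_sum]
      exact Finset.sum_congr rfl fun j _ ↦ Finset.sum_congr rfl fun l _ ↦ by ring
    simp_rw [h1]
    exact h.lintegral_linear_sq_le _
  · rw [frobenius_norm_sq, Finset.sum_comm (f := fun i j ↦ Y i j ^ 2)]
    congr 1
    simp only [mul_pow, ← Finset.mul_sum, ← Finset.sum_mul]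
    ring

lemma lintegral_norm_row_sq_le (h : IsNoise P E σ C) (i : Fin n) :
    ∫⁻ ω, ENNReal.ofReal (‖rowSelector i * E ω‖ ^ 2) ∂P ≤ ENNReal.ofReal (4 * σ ^ 2 * n) := by
  refine (lintegral_norm_sq_le (measurable_const_mul_apply _ h.measurable)
    (b := fun _ _ ↦ 4 * σ ^ 2) (fun i k ↦ by positivity) (fun x l ↦ ?_)).trans (le_of_eq ?_)
  · simp_rw [rowSelector_mul_apply]
    have := h.lintegral_mul_apply_sq_le i (Pi.single l 1)
    simpa [Pi.single_apply] using this
  · congr 1; simp; ring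

lemma lintegral_norm_ones_sq_le (h : IsNoise P E σ C) :
    ∫⁻ ω, ENNReal.ofReal (‖onesRow n * E ω‖ ^ 2) ∂P ≤ ENNReal.ofReal (4 * σ ^ 2 * n ^ 2) := by
  refine (lintegral_norm_sq_le (measurable_const_mul_apply _ h.measurable)
    (b := fun _ _ ↦ 4 * σ ^ 2 * n) (fun i k ↦ by positivity) (fun x l ↦ ?_)).trans (le_of_eq ?_)
  · simp_rw [onesRow_mul_apply]
    have := h.lintegral_mul_apply_sq_le l fun _ ↦ 1
    simp_rw [fun ω j ↦ h.apply_symm ω j l]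
    simpa using this
  · congr 1; simp; ring

lemma lintegral_norm_ones_mul_sq_le (h : IsNoise P E σ C) :
    ∫⁻ ω, ENNReal.ofReal (‖onesRow n * (E ω * Y)‖ ^ 2) ∂P ≤
      ENNReal.ofReal (4 * σ ^ 2 * (n * ‖Y‖ ^ 2)) := by
  refine (lintegral_norm_sq_le (measurable_const_mul_apply _
    (measurable_mul_const_apply h.measurable _))
    (b := fun _ k ↦ 4 * σ ^ 2 * (n * ∑ l, Y l k ^ 2)) (fun i k ↦ by positivity)
    (fun x k ↦ ?_)).trans (le_of_eq ?_)
  · simp_rw [onesRow_mul_apply, Matrix.mul_apply]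
    have := h.lintegral_linear_sq_le fun _ l ↦ Y l k
    simpa using this
  · rw [frobenius_norm_sq, Finset.sum_comm (f := fun i j ↦ Y i j ^ 2)]
    congr 1
    simp [← Finset.mul_sum]

lemma lintegral_noiseSize_le (h : IsNoise P E σ C) (i : Fin n) {q : ℝ} (hq : 0 ≤ q)
    (hY : ‖Y‖ ^ 2 ≤ q * n) (hYi : ‖rowSelector i * Y‖ ^ 2 ≤ q) :
    ∫⁻ ω, ENNReal.ofReal (noiseSize (E ω) Y i) ∂P ≤
      ENNReal.ofReal (8 * (σ ^ 2 + C) * (1 + q + q ^ 2)) := by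
  have hC := h.nonneg i
  have hn : (0 : ℝ) < n := by exact_mod_cast i.pos
  have hY0 : ∀ k l, Measurable fun _ : Ω ↦ Y k l := fun _ _ ↦ measurable_const
  have hEY := measurable_mul_const_apply h.measurable Y
  have key : ∀ (f : Ω → ℝ) (a c v : ℝ), Measurable f → 0 < c →
      ∫⁻ ω, ENNReal.ofReal (f ω) ∂P ≤ ENNReal.ofReal a → a ≤ v * c →
      ∫⁻ ω, ENNReal.ofReal (f ω / c) ∂P ≤ ENNReal.ofReal v := fun f a c v hf hc hfa hac ↦
    (lintegral_ofReal_div_le hf hc hfa).trans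
      (ENNReal.ofReal_le_ofReal ((div_le_iff₀ hc).2 hac))
  have hσY : 4 * σ ^ 2 * (n * ‖Y‖ ^ 2) ≤ 4 * σ ^ 2 * q * n ^ 2 := by
    calc _ ≤ 4 * σ ^ 2 * (n * (q * n)) := by gcongr
      _ = _ := by ring
  have hmeas := measurable_noiseSize h.measurable hY0 i
  have e1 := key _ _ (n ^ 3) (2 * C) (measurable_norm_sq (measurable_mul_apply h.measurable
    h.measurable)) (by positivity) h.lintegral_norm_sq_sq_le le_rfl
  have e2 := key _ _ (n ^ 2) (4 * σ ^ 2 * q) (measurable_norm_sq hEY) (by positivity)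
    (h.lintegral_norm_mul_sq_le Y) hσY
  have e3 := key _ _ (n ^ 2) (4 * σ ^ 2 * q ^ 2)
    (measurable_norm_sq (measurable_const_mul_apply Yᵀ hEY)) (by positivity)
    (h.lintegral_norm_cross_sq_le Y) (by
      calc 4 * σ ^ 2 * (‖Y‖ ^ 2) ^ 2 ≤ 4 * σ ^ 2 * (q * n) ^ 2 := by gcongr
        _ = _ := by ring)
  have e4 := key _ _ n (4 * σ ^ 2) (measurable_norm_sq (measurable_const_mul_apply (rowSelector i)
    h.measurable)) hn (h.lintegral_norm_row_sq_le i) le_rfl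
  have e5 := key _ _ (n ^ 2) (4 * σ ^ 2) (measurable_norm_sq (measurable_const_mul_apply (onesRow n)
    h.measurable)) (by positivity) h.lintegral_norm_ones_sq_le le_rfl
  have e6 := key _ _ (n ^ 2) (4 * σ ^ 2 * q) (measurable_norm_sq (measurable_const_mul_apply
    (onesRow n) hEY)) (by positivity) (h.lintegral_norm_ones_mul_sq_le Y) hσY
  have e7 := key _ _ (n ^ 2) (4 * C * q) (measurable_norm_sq (measurable_mul_apply
    (measurable_const_mul_apply (rowSelector i) h.measurable) hEY)) (by positivity)
    (h.lintegral_norm_row_sq_mul_sq_le Y i) (by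
      calc _ ≤ 2 * (C * (n * (q * n))) + 2 * (C * n ^ 2 * q) := by gcongr
        _ = _ := by ring)
  have m : ∀ {ι κ : Type} [Fintype ι] [Fintype κ] {M : Ω → Matrix ι κ ℝ}
    (_ : ∀ i j, Measurable fun ω ↦ M ω i j) (c : ℝ), Measurable fun ω ↦ ‖M ω‖ ^ 2 / c :=
    fun hM c ↦ (measurable_norm_sq hM).div_const c
  refine (lintegral_ofReal_add_le (m (measurable_mul_apply h.measurable h.measurable) _)
    (fun ω ↦ by positivity) (fun ω ↦ by positivity) (by positivity) ?_ e1
    (lintegral_ofReal_add_le (m hEY _)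
    (fun ω ↦ by positivity) (fun ω ↦ by positivity) (by positivity) ?_ e2
    (lintegral_ofReal_add_le (m (measurable_const_mul_apply Yᵀ hEY) _)
    (fun ω ↦ by positivity) (fun ω ↦ by positivity) (by positivity) ?_ e3
    (lintegral_ofReal_add_le (m (measurable_const_mul_apply (rowSelector i) h.measurable) _)
    (fun ω ↦ by positivity) (fun ω ↦ by positivity) (by positivity) ?_ e4
    (lintegral_ofReal_add_le (m (measurable_const_mul_apply (onesRow n) h.measurable) _)
    (fun ω ↦ by positivity) (fun ω ↦ by positivity) (by positivity) ?_ e5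
    (lintegral_ofReal_add_le (m (measurable_const_mul_apply (onesRow n) hEY) _)
    (fun ω ↦ by positivity) (fun ω ↦ by positivity) (by positivity) ?_ e6 e7)))))).trans
    (ENNReal.ofReal_le_ofReal ?_)
  rotate_left 6
  · nlinarith [mul_nonneg hC hq, mul_nonneg hC (sq_nonneg q), mul_nonneg (sq_nonneg σ) hq,
      mul_nonneg (sq_nonneg σ) (sq_nonneg q), sq_nonneg σ]
  all_goals positivity

end IsNoise

/-- Markov's inequality conditionally on V: by independence the joint law is a product, and the
moment bound is needed only for fixed v in S. -/
lemma measure_le_of_indepFun {α β : Type*} [MeasurableSpace α] [MeasurableSpace β]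
    [IsProbabilityMeasure P] {U : Ω → α} {V : Ω → β} (hU : Measurable U) (hV : Measurable V)
    (hUV : IndepFun U V P) {f : α → β → ℝ} (hf : Measurable fun p : α × β ↦ f p.1 p.2) {S : Set β}
    (hS : MeasurableSet S) {B c : ℝ} (hc : 0 < c)
    (h : ∀ v ∈ S, ∫⁻ ω, ENNReal.ofReal (f (U ω) v) ∂P ≤ ENNReal.ofReal B) :
    P {ω | V ω ∈ S ∧ c < f (U ω) (V ω)} ≤ ENNReal.ofReal (B / c) := by
  have hmap := (indepFun_iff_map_prod_eq_prod_map_map hU.aemeasurable hV.aemeasurable).1 hUV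
  let g : α × β → ENNReal := fun p ↦ S.indicator (fun v ↦ ENNReal.ofReal (f p.1 v)) p.2
  have hg : Measurable g := by
    have : g = (Prod.snd ⁻¹' S).indicator fun p ↦ ENNReal.ofReal (f p.1 p.2) := by
      ext p; by_cases hp : p.2 ∈ S <;> simp [g, hp]
    rw [this]
    exact hf.ennreal_ofReal.indicator (measurable_snd hS)
  have hint : ∫⁻ ω, g (U ω, V ω) ∂P ≤ ENNReal.ofReal B := by
    have : IsProbabilityMeasure (P.map U) := Measure.isProbabilityMeasure_map hU.aemeasurable
    have : IsProbabilityMeasure (P.map V) := Measure.isProbabilityMeasure_map hV.aemeasurable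
    rw [← lintegral_map (μ := P) hg (hU.prodMk hV), hmap, lintegral_prod_symm' _ hg]
    calc _ ≤ ∫⁻ _, ENNReal.ofReal B ∂(P.map V) := by
          refine lintegral_mono fun v ↦ ?_
          by_cases hv : v ∈ S
          · simp only [g, Set.indicator_of_mem hv]
            have hfv : Measurable fun e ↦ f e v := hf.comp (measurable_id.prodMk measurable_const)
            rw [lintegral_map hfv.ennreal_ofReal hU]
            exact h v hv
          · simp [g, hv]
      _ = _ := by simp
  calc _ ≤ P {ω | ENNReal.ofReal c ≤ g (U ω, V ω)} := by
        refine measure_mono fun ω ⟨h1, h2⟩ ↦ ?_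
        simp only [Set.mem_ofPred_eq, g, Set.indicator_of_mem h1]
        exact ENNReal.ofReal_le_ofReal h2.le
    _ ≤ (∫⁻ ω, g (U ω, V ω) ∂P) / ENNReal.ofReal c :=
        meas_ge_le_lintegral_div (hg.comp (hU.prodMk hV)).aemeasurable
          (by simpa using hc) ENNReal.ofReal_ne_top
    _ ≤ _ := by
        rw [ENNReal.ofReal_div_of_pos hc]
        gcongr

theorem IsNoise.measure_not_noiseBound_le [IsProbabilityMeasure P]
    {E : Ω → Matrix (Fin n) (Fin n) ℝ} {σ C : ℝ} (h : IsNoise P E σ C)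
    {Y : Ω → Matrix (Fin n) (Fin d) ℝ} (hY : ∀ k l, Measurable fun ω ↦ Y ω k l)
    (hEY : IndepFun (fun ω (k l : Fin n) ↦ E ω k l) (fun ω (k : Fin n) (l : Fin d) ↦ Y ω k l) P)
    (i : Fin n) {q a u : ℝ} (hq : 0 ≤ q) (ha : 0 < a) (hu : u ^ 4 = n) :
    P {ω | (‖Y ω‖ ^ 2 ≤ q * n ∧ ‖rowSelector i * Y ω‖ ^ 2 ≤ q) ∧ ¬ NoiseBound (E ω) (Y ω) i a u} ≤
      ENNReal.ofReal (8 * (σ ^ 2 + C) * (1 + q + q ^ 2) / a ^ 4) := by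
  have hid : ∀ k l, Measurable fun y : Fin n → Fin d → ℝ ↦ Matrix.of y k l := fun k l ↦ by
    simp only [Matrix.of_apply]; fun_prop
  have key := measure_le_of_indepFun (P := P)
    (measurable_pi_lambda _ fun k ↦ measurable_pi_lambda _ fun l ↦ h.measurable k l)
    (measurable_pi_lambda _ fun k ↦ measurable_pi_lambda _ fun l ↦ hY k l) hEY
    (f := fun e y ↦ noiseSize (Matrix.of e) (Matrix.of y) i)
    (measurable_noiseSize (fun k l ↦ by simp only [Matrix.of_apply]; fun_prop)
      (fun k l ↦ by simp only [Matrix.of_apply]; fun_prop) i)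
    (S := {y | ‖Matrix.of y‖ ^ 2 ≤ q * n ∧ ‖rowSelector i * Matrix.of y‖ ^ 2 ≤ q})
    ((measurableSet_le (measurable_norm_sq hid) measurable_const).inter
      (measurableSet_le (measurable_norm_sq (measurable_const_mul_apply _ hid)) measurable_const))
    (c := a ^ 4) (by positivity) fun y hy ↦ h.lintegral_noiseSize_le _ i hq hy.1 hy.2
  refine le_trans (measure_mono ?_) key
  rintro ω ⟨h1, h2⟩
  refine ⟨h1, ?_⟩
  by_contra hlt
  exact h2 (noiseBound_of_noiseSize_le hu (not_lt.1 hlt))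

end NoiseSize

/-! ### Fourth moments from sub-Gaussian tails -/

section FourthMoment

/-- A bound on the fourth moment of a sub-Gaussian random variable with constant `K`. -/
noncomputable def fourthMomentBound (K : ℝ) : ℝ :=
  4 * ∫ t in Set.Ioi (0 : ℝ), 2 * (t ^ (3 : ℝ) * Real.exp (-(1 / K ^ 2) * t ^ 2))

variable {Ω : Type*} [MeasurableSpace Ω] {P : Measure Ω} [IsProbabilityMeasure P]

/-- The layer cake formula with the tail bound inserted. -/
lemma IsSubGaussianWith.lintegral_fourth_le {X : Ω → ℝ} {K : ℝ} (h : IsSubGaussianWith X K P)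
    (hX : AEMeasurable X P) :
    ∫⁻ ω, ENNReal.ofReal (X ω ^ 4) ∂P ≤ ENNReal.ofReal (fourthMomentBound K) := by
  obtain ⟨hK, htail⟩ := h
  have hint : IntegrableOn (fun t : ℝ ↦ 2 * (t ^ (3 : ℝ) * Real.exp (-(1 / K ^ 2) * t ^ 2)))
      (Set.Ioi 0) :=
    ((integrable_rpow_mul_exp_neg_mul_sq (by positivity) (by norm_num)).integrableOn).const_mul 2
  have h1 : ∀ ω, X ω ^ 4 = |X ω| ^ (4 : ℝ) := fun ω ↦ by
    rw [show (4 : ℝ) = ((4 : ℕ) : ℝ) by norm_num, Real.rpow_natCast, ← abs_pow,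
      abs_of_nonneg (by positivity)]
  simp_rw [h1]
  rw [lintegral_rpow_eq_lintegral_meas_lt_mul P (ae_of_all _ fun ω ↦ abs_nonneg _) hX.abs
    (by norm_num), fourthMomentBound, ENNReal.ofReal_mul (by norm_num)]
  gcongr
  rw [ofReal_integral_eq_lintegral_ofReal hint]
  · refine setLIntegral_mono' measurableSet_Ioi fun t ht ↦ ?_
    have ht0 : (0 : ℝ) < t := ht
    have h2 : P {a | t < |X a|} ≤ ENNReal.ofReal (2 * Real.exp (-(t ^ 2 / K ^ 2))) := by
      rw [← ofReal_measureReal]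
      exact ENNReal.ofReal_le_ofReal (htail t ht0.le)
    calc _ ≤ ENNReal.ofReal (2 * Real.exp (-(t ^ 2 / K ^ 2))) * ENNReal.ofReal (t ^ ((4 : ℝ) - 1)) := by
          gcongr
      _ = _ := by
        rw [← ENNReal.ofReal_mul (by positivity)]
        congr 1
        rw [show ((4 : ℝ) - 1) = 3 by norm_num, show -(t ^ 2 / K ^ 2) = -(1 / K ^ 2) * t ^ 2 by ring]
        ring
  · filter_upwards [ae_restrict_mem measurableSet_Ioi] with t ht
    have ht0 : (0 : ℝ) < t := ht
    simp only [Pi.zero_apply]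
    positivity

lemma fourthMomentBound_nonneg (K : ℝ) : 0 ≤ fourthMomentBound K := by
  refine mul_nonneg (by norm_num) (setIntegral_nonneg measurableSet_Ioi fun t ht ↦ ?_)
  have ht0 : (0 : ℝ) < t := ht
  positivity

lemma IsSubGaussianWith.integrable_fourth {X : Ω → ℝ} {K : ℝ} (h : IsSubGaussianWith X K P)
    (hX : AEMeasurable X P) : Integrable (fun ω ↦ X ω ^ 4) P := by
  refine ⟨(hX.pow_const 4).aestronglyMeasurable, ?_⟩
  rw [hasFiniteIntegral_iff_ofReal (ae_of_all _ fun ω ↦ by positivity)]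
  exact (h.lintegral_fourth_le hX).trans_lt ENNReal.ofReal_lt_top

lemma IsSubGaussianWith.integral_fourth_le {X : Ω → ℝ} {K : ℝ} (h : IsSubGaussianWith X K P)
    (hX : AEMeasurable X P) : ∫ ω, X ω ^ 4 ∂P ≤ fourthMomentBound K := by
  rw [integral_eq_lintegral_of_nonneg_ae (ae_of_all _ fun ω ↦ by positivity)
    (hX.pow_const 4).aestronglyMeasurable]
  exact ENNReal.toReal_le_of_le_ofReal (fourthMomentBound_nonneg K) (h.lintegral_fourth_le hX)

end FourthMoment

/-! ### Conditional central limit theorem -/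

section CharacteristicFunction

open Complex in
-- Taylor's remainder for |x| ≤ 1 and the triangle inequality beyond, where each term is dominated
-- by the cube.
lemma norm_exp_mul_I_expansion_le (x : ℝ) :
    ‖exp (x * I) - 1 - x * I + x ^ 2 / 2‖ ≤ 4 * |x| ^ 3 := by
  have hx : ‖(x : ℂ) * I‖ = |x| := by simp
  rcases le_or_gt |x| 1 with h | h
  · have key := exp_bound (x := x * I) (by rwa [hx]) (n := 3) (by norm_num)
    have h1 : exp (x * I) - ∑ m ∈ Finset.range 3, (x * I : ℂ) ^ m / m.factorial =
        exp (x * I) - 1 - x * I + x ^ 2 / 2 := by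
      simp [Finset.sum_range_succ, Nat.factorial, mul_pow]
      ring
    rw [h1, hx] at key
    refine key.trans ?_
    have : 0 ≤ |x| ^ 3 := by positivity
    norm_num [Nat.factorial]
    linarith
  · calc _ ≤ ‖exp (x * I)‖ + ‖(1 : ℂ)‖ + ‖(x : ℂ) * I‖ + ‖(x : ℂ) ^ 2 / 2‖ :=
          (norm_add_le _ _).trans (add_le_add ((norm_sub_le _ _).trans
            (add_le_add (norm_sub_le _ _) le_rfl)) le_rfl)
      _ = 1 + 1 + |x| + |x| ^ 2 / 2 := by
          rw [norm_exp_ofReal_mul_I, hx]; simp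
      _ ≤ _ := by nlinarith [mul_pos (zero_lt_one.trans h) (sub_pos.2 h)]

lemma abs_exp_neg_sub_le {y : ℝ} (hy : 0 ≤ y) : |Real.exp (-y) - (1 - y)| ≤ y ^ 2 := by
  have h1 : 1 - y ≤ Real.exp (-y) := by linarith [Real.add_one_le_exp (-y)]
  have h2 : Real.exp (-y) ≤ 1 - y + y ^ 2 := by
    rw [Real.exp_neg, inv_le_comm₀ (Real.exp_pos _) (by nlinarith)]
    refine le_trans ?_ (Real.add_one_le_exp y)
    rw [inv_le_iff_one_le_mul₀ (by nlinarith)]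
    nlinarith [pow_nonneg hy 3]
  rw [abs_le]
  constructor <;> nlinarith

lemma norm_prod_sub_prod_le {ι : Type*} (s : Finset ι) (a b : ι → ℂ) (ha : ∀ i, ‖a i‖ ≤ 1)
    (hb : ∀ i, ‖b i‖ ≤ 1) : ‖∏ i ∈ s, a i - ∏ i ∈ s, b i‖ ≤ ∑ i ∈ s, ‖a i - b i‖ := by
  classical
  induction s using Finset.induction_on with
  | empty => simp
  | insert j s hj ih =>
    rw [Finset.prod_insert hj, Finset.prod_insert hj, Finset.sum_insert hj]
    have h1 : a j * ∏ i ∈ s, a i - b j * ∏ i ∈ s, b i =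
        (a j - b j) * ∏ i ∈ s, a i + b j * (∏ i ∈ s, a i - ∏ i ∈ s, b i) := by ring
    have h2 : ‖∏ i ∈ s, a i‖ ≤ 1 := by
      rw [norm_prod]; exact Finset.prod_le_one (fun i _ ↦ norm_nonneg _) fun i _ ↦ ha i
    rw [h1]
    refine (norm_add_le _ _).trans ?_
    rw [norm_mul, norm_mul]
    exact add_le_add (mul_le_of_le_one_right (norm_nonneg _) h2)
      ((mul_le_of_le_one_left (norm_nonneg _) (hb j)).trans ih)

variable {Ω : Type*} [MeasurableSpace Ω] {P : Measure Ω} [IsProbabilityMeasure P]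

lemma integrable_exp_mul_I {X : Ω → ℝ} (hX : Measurable X) :
    Integrable (fun ω ↦ Complex.exp (X ω * Complex.I)) P := by
  refine (integrable_const (1 : ℝ)).mono' (by fun_prop) (ae_of_all _ fun ω ↦ ?_)
  rw [Complex.norm_exp_ofReal_mul_I]

open Complex in
-- The characteristic function and the Gaussian one both agree with 1 − σ²w²/2 up to the stated
-- errors. The third moment is controlled by |X|³ ≤ 1 + X⁴.
lemma norm_integral_exp_sub_le {X : Ω → ℝ} {σ C : ℝ} (hX : Measurable X) (h2 : MemLp X 2 P)
    (hmean : ∫ ω, X ω ∂P = 0) (hvar : ∫ ω, X ω ^ 2 ∂P = σ ^ 2)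
    (hint : Integrable (fun ω ↦ X ω ^ 4) P) (hC : ∫ ω, X ω ^ 4 ∂P ≤ C) (w : ℝ) :
    ‖∫ ω, exp ((X ω * w : ℝ) * I) ∂P - (Real.exp (-(σ ^ 2 * w ^ 2 / 2)) : ℝ)‖ ≤
      4 * (1 + C) * |w| ^ 3 + σ ^ 4 * w ^ 4 := by
  have hm : Measurable fun ω ↦ X ω * w := hX.mul_const w
  have hI1 : Integrable (fun ω ↦ exp ((X ω * w : ℝ) * I)) P := integrable_exp_mul_I hm
  have hI2 : Integrable (fun ω ↦ ((X ω * w : ℝ) : ℂ) * I) P :=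
    ((h2.integrable (by norm_num)).mul_const w).ofReal.mul_const I
  have hI3 : Integrable (fun ω ↦ ((X ω * w : ℝ) : ℂ) ^ 2 / 2) P := by
    have := ((h2.integrable_sq.mul_const (w ^ 2)).ofReal (𝕜 := ℂ)).div_const 2
    refine this.congr (ae_of_all _ fun ω ↦ ?_)
    simp only; push_cast; rw [mul_pow]; rfl
  have hx1 : ∫ ω, ((X ω * w : ℝ) : ℂ) * I ∂P = 0 := by
    rw [integral_mul_const, integral_complex_ofReal, integral_mul_const, hmean]; simp
  have h3 : ∫ ω, ((X ω * w : ℝ) : ℂ) ^ 2 / 2 ∂P = ((σ ^ 2 * w ^ 2 / 2 : ℝ) : ℂ) := by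
    rw [integral_div]
    have : ∀ ω, ((X ω * w : ℝ) : ℂ) ^ 2 = ((X ω ^ 2 * w ^ 2 : ℝ) : ℂ) := fun ω ↦ by
      push_cast; ring
    simp_rw [this]
    rw [integral_complex_ofReal, integral_mul_const, hvar]
    push_cast; ring
  have hmain : ∫ ω, (exp ((X ω * w : ℝ) * I) - 1 - (X ω * w : ℝ) * I +
      ((X ω * w : ℝ) : ℂ) ^ 2 / 2) ∂P =
      ∫ ω, exp ((X ω * w : ℝ) * I) ∂P - 1 + ((σ ^ 2 * w ^ 2 / 2 : ℝ) : ℂ) := by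
    have hI0 : Integrable (fun _ : Ω ↦ (1 : ℂ)) P := integrable_const _
    have e1 := integral_add ((hI1.sub hI0).sub hI2) hI3
    have e2 := integral_sub (hI1.sub hI0) hI2
    have e3 := integral_sub hI1 hI0
    simp only [Pi.sub_apply] at e1 e2 e3
    rw [e1, e2, e3, hx1, h3]
    simp
  have hcube : ‖∫ ω, exp ((X ω * w : ℝ) * I) ∂P - 1 + ((σ ^ 2 * w ^ 2 / 2 : ℝ) : ℂ)‖ ≤
      4 * (1 + C) * |w| ^ 3 := by
    rw [← hmain]
    have hint' : Integrable (fun ω ↦ 4 * |w| ^ 3 * (1 + X ω ^ 4)) P :=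
      ((integrable_const (1 : ℝ)).add hint).const_mul _
    refine (norm_integral_le_of_norm_le hint' (ae_of_all _ fun ω ↦ ?_)).trans ?_
    · refine (norm_exp_mul_I_expansion_le _).trans ?_
      rw [abs_mul, mul_pow]
      have h4 : |X ω| ^ 3 ≤ 1 + X ω ^ 4 := by
        rw [← Even.pow_abs (by decide) (X ω)]
        rcases le_total |X ω| 1 with h5 | h5
        · have := pow_le_one₀ (abs_nonneg (X ω)) h5 (n := 3)
          have := pow_nonneg (abs_nonneg (X ω)) 4
          linarith
        · have := pow_le_pow_right₀ h5 (by norm_num : 3 ≤ 4)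
          linarith
      calc _ ≤ 4 * ((1 + X ω ^ 4) * |w| ^ 3) := by gcongr
        _ = _ := by ring
    · rw [integral_const_mul, integral_add (integrable_const _) hint]
      have := hC
      have hw : 0 ≤ |w| ^ 3 := by positivity
      simp only [integral_const, probReal_univ, smul_eq_mul, one_mul]
      nlinarith
  have hexp := abs_exp_neg_sub_le (y := σ ^ 2 * w ^ 2 / 2) (by positivity)
  have hsplit : ∫ ω, exp ((X ω * w : ℝ) * I) ∂P - (Real.exp (-(σ ^ 2 * w ^ 2 / 2)) : ℝ) =
      (∫ ω, exp ((X ω * w : ℝ) * I) ∂P - 1 + ((σ ^ 2 * w ^ 2 / 2 : ℝ) : ℂ)) -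
      ((Real.exp (-(σ ^ 2 * w ^ 2 / 2)) - (1 - σ ^ 2 * w ^ 2 / 2) : ℝ) : ℂ) := by
    push_cast; ring
  rw [hsplit]
  refine (norm_sub_le _ _).trans (add_le_add hcube ?_)
  rw [norm_real, Real.norm_eq_abs]
  refine hexp.trans ?_
  have : 0 ≤ σ ^ 4 * w ^ 4 := by positivity
  nlinarith

namespace IsNoise

variable {n : ℕ} {E : Ω → Matrix (Fin n) (Fin n) ℝ} {σ C : ℝ}

open Complex in
-- Independence factors the characteristic function over j ≠ i, and a telescoping product comparison
-- adds up the errors of the factors. The last term pays for the zero diagonal entry, which has no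
-- Gaussian counterpart.
lemma norm_integral_exp_row_sub_le (h : IsNoise P E σ C) (i : Fin n) (w : Fin n → ℝ) :
    ‖∫ ω, exp ((∑ j, E ω i j * w j : ℝ) * I) ∂P -
      (Real.exp (-(σ ^ 2 * (∑ j, w j ^ 2) / 2)) : ℝ)‖ ≤
      (4 * (1 + C) * ∑ j, |w j| ^ 3 + σ ^ 4 * ∑ j, w j ^ 4) + σ ^ 2 * w i ^ 2 := by
  have hC := h.nonneg i
  have hprod : ∫ ω, exp ((∑ j, E ω i j * w j : ℝ) * I) ∂P =
      ∏ j : {j // j ≠ i}, ∫ ω, exp ((E ω i j * w j : ℝ) * I) ∂P := by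
    have hinj : Function.Injective fun j : {j // j ≠ i} ↦ edge i j.1 j.2.symm := by
      intro j l hjl
      rcases edge_eq hjl with h1 | h1
      · exact Subtype.ext h1.2
      · exact absurd h1.2 j.2
    have hind := h.indep.precomp hinj
    have := hind.integral_fun_prod_comp (𝕜 := ℂ) (f := fun j x ↦ exp ((x * w j.1 : ℝ) * I))
      (fun j ↦ (h.measurable _ _).aemeasurable) (fun j ↦ by
        refine Continuous.aestronglyMeasurable ?_
        fun_prop)
    simp only [h.apply_edge] at this
    rw [← this]
    refine integral_congr_ae (ae_of_all _ fun ω ↦ ?_)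
    simp only
    rw [← Complex.exp_sum, Fintype.sum_eq_add_sum_subtype_ne _ i, h.hollow, zero_mul, zero_add]
    push_cast
    rw [Finset.sum_mul]
  have hexp : Real.exp (-(σ ^ 2 * (∑ j : {j // j ≠ i}, w j ^ 2) / 2)) =
      ∏ j : {j // j ≠ i}, Real.exp (-(σ ^ 2 * w j ^ 2 / 2)) := by
    rw [← Real.exp_sum, Finset.mul_sum, Finset.sum_div, ← Finset.sum_neg_distrib]
  have hmain : ‖∫ ω, exp ((∑ j, E ω i j * w j : ℝ) * I) ∂P -
      (Real.exp (-(σ ^ 2 * (∑ j : {j // j ≠ i}, w j ^ 2) / 2)) : ℝ)‖ ≤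
      4 * (1 + C) * ∑ j, |w j| ^ 3 + σ ^ 4 * ∑ j, w j ^ 4 := by
    rw [hprod, hexp, ofReal_prod]
    refine (norm_prod_sub_prod_le _ _ _ (fun j ↦ ?_) (fun j ↦ ?_)).trans ?_
    · refine (norm_integral_le_integral_norm _).trans (le_of_eq ?_)
      simp_rw [norm_exp_ofReal_mul_I]
      simp
    · rw [norm_real, Real.norm_of_nonneg (Real.exp_pos _).le]
      exact Real.exp_le_one_iff.2 (by
        have : 0 ≤ σ ^ 2 * w j ^ 2 / 2 := by positivity
        linarith)
    · refine (Finset.sum_le_sum fun (j : {j // j ≠ i}) _ ↦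
        norm_integral_exp_sub_le (h.measurable i j) (h.memLp_two i j) (h.mean i j)
          (h.var i j j.2.symm) (h.integrable i j) (h.fourth i j) (w j)).trans ?_
      rw [Finset.sum_add_distrib, ← Finset.mul_sum, ← Finset.mul_sum,
        Fintype.sum_eq_add_sum_subtype_ne (fun j ↦ |w j| ^ 3) i,
        Fintype.sum_eq_add_sum_subtype_ne (fun j ↦ w j ^ 4) i]
      gcongr
      · exact le_add_of_nonneg_left (by positivity)
      · exact le_add_of_nonneg_left (by positivity)
  have hlast : ‖((Real.exp (-(σ ^ 2 * (∑ j : {j // j ≠ i}, w j ^ 2) / 2)) : ℝ) : ℂ) -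
      (Real.exp (-(σ ^ 2 * (∑ j, w j ^ 2) / 2)) : ℝ)‖ ≤ σ ^ 2 * w i ^ 2 := by
    rw [← ofReal_sub, norm_real, Real.norm_eq_abs, Fintype.sum_eq_add_sum_subtype_ne _ i]
    set s := ∑ j : {j // j ≠ i}, w j ^ 2
    have hs : 0 ≤ s := by positivity
    have h1 : Real.exp (-(σ ^ 2 * (w i ^ 2 + s) / 2)) =
        Real.exp (-(σ ^ 2 * s / 2)) * Real.exp (-(σ ^ 2 * w i ^ 2 / 2)) := by
      rw [← Real.exp_add]; congr 1; ring
    have h2 : Real.exp (-(σ ^ 2 * s / 2)) ≤ 1 := Real.exp_le_one_iff.2 (by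
      have : 0 ≤ σ ^ 2 * s / 2 := by positivity
      linarith)
    have h3 : 0 ≤ σ ^ 2 * w i ^ 2 / 2 := by positivity
    have h4 : Real.exp (-(σ ^ 2 * w i ^ 2 / 2)) ≤ 1 := Real.exp_le_one_iff.2 (by linarith)
    have h5 := Real.add_one_le_exp (-(σ ^ 2 * w i ^ 2 / 2))
    have h6 := Real.exp_pos (-(σ ^ 2 * s / 2))
    rw [h1, abs_of_nonneg (by nlinarith)]
    nlinarith
  calc _ ≤ _ := norm_sub_le_norm_sub_add_norm_sub _
        ((Real.exp (-(σ ^ 2 * (∑ j : {j // j ≠ i}, w j ^ 2) / 2)) : ℝ) : ℂ) _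
    _ ≤ _ := add_le_add hmain hlast

end IsNoise

/-- Fubini for the product law: the inner integral plays the role of the conditional expectation
given V. -/
lemma integral_eq_integral_of_indepFun {α β : Type*} [MeasurableSpace α] [MeasurableSpace β]
    {U : Ω → α} {V : Ω → β} (hU : Measurable U) (hV : Measurable V) (hUV : IndepFun U V P)
    {f : α × β → ℂ} (hf : Measurable f) (hf1 : ∀ p, ‖f p‖ ≤ 1) :
    ∫ ω, f (U ω, V ω) ∂P = ∫ ω, ∫ ω', f (U ω', V ω) ∂P ∂P ∧
      AEStronglyMeasurable (fun ω ↦ ∫ ω', f (U ω', V ω) ∂P) P := by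
  have hmap := (indepFun_iff_map_prod_eq_prod_map_map hU.aemeasurable hV.aemeasurable).1 hUV
  have : IsProbabilityMeasure (P.map U) := Measure.isProbabilityMeasure_map hU.aemeasurable
  have : IsProbabilityMeasure (P.map V) := Measure.isProbabilityMeasure_map hV.aemeasurable
  have hfs : StronglyMeasurable f := hf.stronglyMeasurable
  have hinner : ∀ v, ∫ u, f (u, v) ∂(P.map U) = ∫ ω', f (U ω', v) ∂P := fun v ↦
    integral_map hU.aemeasurable
      (hf.comp (measurable_id.prodMk measurable_const)).aestronglyMeasurable
  have hsm : StronglyMeasurable fun v ↦ ∫ ω', f (U ω', v) ∂P := by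
    simp_rw [← hinner]
    exact hfs.integral_prod_left'
  refine ⟨?_, (hsm.comp_measurable hV).aestronglyMeasurable⟩
  rw [← integral_map (φ := fun ω ↦ (U ω, V ω)) (hU.prodMk hV).aemeasurable
    hf.aestronglyMeasurable, hmap, integral_prod_symm]
  · simp_rw [hinner]
    rw [integral_map hV.aemeasurable hsm.aestronglyMeasurable]
  · exact (integrable_const (1 : ℝ)).mono' hf.aestronglyMeasurable (ae_of_all _ hf1)

open Complex in
/-- A conditional central limit theorem for weighted sums of the entries of a row of the noise:
the weights are random and independent of the noise, and their squares sum to almost `s`. -/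
theorem tendsto_integral_exp_row {m : ℕ → ℕ} {E : (n : ℕ) → Ω → Matrix (Fin (m n)) (Fin (m n)) ℝ}
    {σ C s : ℝ} (h : ∀ n, IsNoise P (E n) σ C) (i : (n : ℕ) → Fin (m n))
    {w : (n : ℕ) → Ω → Fin (m n) → ℝ} (hw : ∀ n, Measurable (w n))
    (hind : ∀ n, IndepFun (fun ω (k l : Fin (m n)) ↦ E n ω k l) (w n) P)
    (hs : ∀ᵐ ω ∂P, Tendsto (fun n ↦ ∑ j, w n ω j ^ 2) atTop (𝓝 s))
    (h3 : ∀ᵐ ω ∂P, Tendsto (fun n ↦ ∑ j, |w n ω j| ^ 3) atTop (𝓝 0))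
    (h4 : ∀ᵐ ω ∂P, Tendsto (fun n ↦ ∑ j, w n ω j ^ 4) atTop (𝓝 0)) :
    Tendsto (fun n ↦ ∫ ω, exp ((∑ j, E n ω (i n) j * w n ω j : ℝ) * I) ∂P) atTop
      (𝓝 ((Real.exp (-(σ ^ 2 * s / 2)) : ℝ) : ℂ)) := by
  have hfub := fun n ↦ integral_eq_integral_of_indepFun (P := P)
    (measurable_pi_lambda _ fun k ↦ measurable_pi_lambda _ fun l ↦ (h n).measurable k l) (hw n)
    (hind n) (f := fun p ↦ exp ((∑ j, p.1 (i n) j * p.2 j : ℝ) * I)) (by fun_prop)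
    (fun p ↦ (norm_exp_ofReal_mul_I _).le)
  simp only at hfub
  simp_rw [fun n ↦ (hfub n).1]
  have hconst : ((Real.exp (-(σ ^ 2 * s / 2)) : ℝ) : ℂ) =
      ∫ _, ((Real.exp (-(σ ^ 2 * s / 2)) : ℝ) : ℂ) ∂P := by simp
  rw [hconst]
  refine tendsto_integral_of_dominated_convergence (fun _ ↦ (1 : ℝ)) (fun n ↦ (hfub n).2)
    (integrable_const _) (fun n ↦ ae_of_all _ fun ω ↦ ?_) ?_
  · refine (norm_integral_le_integral_norm _).trans (le_of_eq ?_)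
    simp_rw [norm_exp_ofReal_mul_I]
    simp
  filter_upwards [hs, h3, h4] with ω hs h3 h4
  -- The weight at the diagonal position is negligible because its fourth power is one term of a sum
  -- tending to zero.
  have hwi : Tendsto (fun n ↦ w n ω (i n) ^ 2) atTop (𝓝 0) := by
    have h5 : Tendsto (fun n ↦ √(∑ j, w n ω j ^ 4)) atTop (𝓝 0) := by
      simpa using h4.sqrt
    refine squeeze_zero (fun n ↦ sq_nonneg _) (fun n ↦ ?_) h5
    refine Real.le_sqrt_of_sq_le ?_
    rw [← pow_mul]
    exact Finset.single_le_sum (f := fun j ↦ w n ω j ^ (2 * 2)) (fun j _ ↦ by simp only [pow_mul]; positivity)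
      (Finset.mem_univ _)
  have hlim : Tendsto (fun n ↦ ((Real.exp (-(σ ^ 2 * (∑ j, w n ω j ^ 2) / 2)) : ℝ) : ℂ)) atTop
      (𝓝 ((Real.exp (-(σ ^ 2 * s / 2)) : ℝ) : ℂ)) :=
    (continuous_ofReal.tendsto _).comp ((Real.continuous_exp.tendsto _).comp
      (((hs.const_mul _).div_const _).neg))
  have hbd : Tendsto (fun n ↦ (4 * (1 + C) * ∑ j, |w n ω j| ^ 3 + σ ^ 4 * ∑ j, w n ω j ^ 4) +
      σ ^ 2 * w n ω (i n) ^ 2) atTop (𝓝 0) := by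
    simpa using ((h3.const_mul (4 * (1 + C))).add (h4.const_mul (σ ^ 4))).add
      (hwi.const_mul (σ ^ 2))
  have hdiff := squeeze_zero_norm (fun n ↦ (h n).norm_integral_exp_row_sub_le (i n) (w n ω)) hbd
  simpa using hdiff.add hlim

end CharacteristicFunction

/-! ### Sample covariance and the weights of the linear term -/

section Gram

variable {n d : ℕ} {z : ℕ → EuclideanSpace ℝ (Fin d)}

/-- The Gram matrix `YᵀY` of the centred data. -/
noncomputable def gram (n : ℕ) (z : ℕ → EuclideanSpace ℝ (Fin d)) : Matrix (Fin d) (Fin d) ℝ :=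
  (centered n z)ᵀ * centered n z

lemma sampleMean_apply (k : Fin d) : sampleMean n z k = (n : ℝ)⁻¹ * ∑ j : Fin n, z j k := by
  simp [sampleMean]

lemma smul_gram_apply (hn : 0 < n) (k l : Fin d) :
    ((n : ℝ)⁻¹ • gram n z) k l =
      (n : ℝ)⁻¹ * ∑ j : Fin n, z j k * z j l - sampleMean n z k * sampleMean n z l := by
  have hn0 : (n : ℝ) ≠ 0 := by exact_mod_cast hn.ne'
  have h1 : ∀ k, ∑ j : Fin n, z j k = n * sampleMean n z k := fun k ↦ by
    rw [sampleMean_apply]; field_simp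
  have h2 : gram n z k l = ∑ j : Fin n, (z j k * z j l - sampleMean n z l * z j k -
      sampleMean n z k * z j l + sampleMean n z k * sampleMean n z l) := by
    rw [gram, Matrix.mul_apply]
    refine Finset.sum_congr rfl fun j _ ↦ ?_
    simp only [centered, Matrix.transpose_apply, Matrix.of_apply]
    ring
  rw [Matrix.smul_apply, h2, Finset.sum_add_distrib, Finset.sum_sub_distrib,
    Finset.sum_sub_distrib, ← Finset.mul_sum, ← Finset.mul_sum, h1, h1]
  simp only [Finset.sum_const, Finset.card_univ, Fintype.card_fin, nsmul_eq_mul, smul_eq_mul]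
  field_simp
  ring

lemma norm_centered_sq : ‖centered n z‖ ^ 2 = (gram n z).trace := by
  rw [frobenius_norm_sq, gram, Matrix.trace, Finset.sum_comm]
  refine Finset.sum_congr rfl fun k _ ↦ ?_
  rw [Matrix.diag_apply, Matrix.mul_apply]
  exact Finset.sum_congr rfl fun j _ ↦ by rw [Matrix.transpose_apply, sq]

lemma norm_rowSelector_mul_centered (i : Fin n) :
    ‖rowSelector i * centered n z‖ = ‖z i - sampleMean n z‖ := by
  rw [← sq_eq_sq₀ (norm_nonneg _) (norm_nonneg _), frobenius_norm_sq, EuclideanSpace.norm_sq_eq]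
  simp [rowSelector_mul_apply, centered]

/-- The data behave regularly as the sample size grows: the sample covariance converges to `Ξ`,
the sample mean to `m`, and the fourth moments remain bounded. -/
structure IsRegular (z : ℕ → EuclideanSpace ℝ (Fin d)) (Ξ : Matrix (Fin d) (Fin d) ℝ)
    (m : EuclideanSpace ℝ (Fin d)) : Prop where
  gram : Tendsto (fun n : ℕ ↦ (n : ℝ)⁻¹ • gram n z) atTop (𝓝 Ξ)
  mean : Tendsto (fun n : ℕ ↦ sampleMean n z) atTop (𝓝 m)
  fourth : ∃ B, ∀ᶠ n : ℕ in atTop, ∑ j : Fin n, ‖z j - sampleMean n z‖ ^ 4 ≤ B * n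

namespace IsRegular

variable {Ξ : Matrix (Fin d) (Fin d) ℝ} {m : EuclideanSpace ℝ (Fin d)}

lemma det_ne_zero (h : IsRegular z Ξ m) (hΞ : IsUnit Ξ.det) :
    ∀ᶠ n : ℕ in atTop, (CMDS.gram n z).det ≠ 0 := by
  have h1 : Tendsto (fun n : ℕ ↦ ((n : ℝ)⁻¹ • CMDS.gram n z).det) atTop (𝓝 Ξ.det) :=
    ((continuous_id.matrix_det).tendsto Ξ).comp h.gram
  filter_upwards [h1.eventually_ne hΞ.ne_zero] with n hn h0
  rw [Matrix.det_smul, h0, mul_zero] at hn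
  exact hn rfl

lemma smul_inv (h : IsRegular z Ξ m) (hΞ : IsUnit Ξ.det) :
    Tendsto (fun n : ℕ ↦ (n : ℝ) • (CMDS.gram n z)⁻¹) atTop (𝓝 Ξ⁻¹) := by
  have hc : ContinuousAt (fun M : Matrix (Fin d) (Fin d) ℝ ↦ M⁻¹) Ξ := by
    have h1 : (fun M : Matrix (Fin d) (Fin d) ℝ ↦ M⁻¹) = fun M ↦ M.det⁻¹ • M.adjugate := by
      ext1 M; rw [Matrix.inv_def, Ring.inverse_eq_inv']
    rw [h1]
    exact ((continuous_id.matrix_det).continuousAt.inv₀ hΞ.ne_zero).smul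
      (continuous_id.matrix_adjugate).continuousAt
  refine (hc.tendsto.comp h.gram).congr' ?_
  filter_upwards [eventually_gt_atTop 0, h.det_ne_zero hΞ] with n hn hdet
  have hn0 : (n : ℝ) ≠ 0 := by exact_mod_cast hn.ne'
  simp only [Function.comp_apply]
  refine Matrix.inv_eq_left_inv ?_
  rw [Matrix.smul_mul, Matrix.mul_smul, Matrix.nonsing_inv_mul _ (Ne.isUnit hdet), smul_smul,
    mul_inv_cancel₀ hn0, one_smul]

end IsRegular

/-- The weights of the entries of a row of the noise in the linear term of the expansion, in the
direction `v`. -/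
noncomputable def weights (n : ℕ) (z : ℕ → EuclideanSpace ℝ (Fin d)) (v : Fin d → ℝ) :
    Fin n → ℝ := fun j ↦ √(n : ℝ) * ((centered n z * (gram n z)⁻¹) *ᵥ v) j

/-- The source of Ξ⁻¹ in the limit: with Γ = (YᵀY)⁻¹, the Gram matrix of YΓ is Γ itself. -/
lemma sum_weights_sq (v : Fin d → ℝ) (hdet : (gram n z).det ≠ 0) :
    ∑ j, weights n z v j ^ 2 = v ⬝ᵥ ((n : ℝ) • (gram n z)⁻¹) *ᵥ v := by
  have hsymm : (gram n z)⁻¹ᵀ = (gram n z)⁻¹ := by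
    rw [Matrix.transpose_nonsing_inv]
    congr 1
    rw [gram, Matrix.transpose_mul, Matrix.transpose_transpose]
  have h1 : ∑ j, ((centered n z * (gram n z)⁻¹) *ᵥ v) j ^ 2 = v ⬝ᵥ (gram n z)⁻¹ *ᵥ v := by
    have h2 : ∑ j, ((centered n z * (gram n z)⁻¹) *ᵥ v) j ^ 2 =
        ((centered n z * (gram n z)⁻¹) *ᵥ v) ⬝ᵥ ((centered n z * (gram n z)⁻¹) *ᵥ v) :=
      Finset.sum_congr rfl fun j _ ↦ sq _
    rw [h2, Matrix.dotProduct_mulVec, Matrix.vecMul_mulVec, ← Matrix.dotProduct_mulVec]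
    congr 2
    rw [Matrix.transpose_mul, hsymm, Matrix.mul_assoc, ← Matrix.mul_assoc (centered n z)ᵀ,
      ← gram, Matrix.mul_nonsing_inv _ (Ne.isUnit hdet), Matrix.mul_one]
  simp only [weights, mul_pow, Real.sq_sqrt (Nat.cast_nonneg n)]
  rw [← Finset.mul_sum, h1, Matrix.smul_mulVec, dotProduct_smul, smul_eq_mul]

lemma abs_weights_le (hn : 0 < n) (v : Fin d → ℝ) (j : Fin n) :
    |weights n z v j| ≤ (√(n : ℝ))⁻¹ *
      (‖z j - sampleMean n z‖ * ‖WithLp.toLp 2 (((n : ℝ) • (gram n z)⁻¹) *ᵥ v)‖) := by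
  have hn0 : (0 : ℝ) < n := by exact_mod_cast hn
  set x := WithLp.toLp 2 (((n : ℝ) • (gram n z)⁻¹) *ᵥ v) with hx
  have h1 : weights n z v j = (√(n : ℝ))⁻¹ * inner ℝ x (z j - sampleMean n z) := by
    have h2 : inner ℝ x (z j - sampleMean n z) = n * ((centered n z * (gram n z)⁻¹) *ᵥ v) j := by
      rw [← Matrix.mulVec_mulVec, hx, Matrix.smul_mulVec]
      simp only [PiLp.inner_apply, RCLike.inner_apply, conj_trivial, Matrix.mulVec, dotProduct,
        centered, Matrix.of_apply, Pi.smul_apply, smul_eq_mul, PiLp.sub_apply, Finset.mul_sum]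
      refine Finset.sum_congr rfl fun k _ ↦ ?_
      exact Finset.sum_congr rfl fun l _ ↦ by ring
    rw [h2, weights, ← mul_assoc]
    congr 1
    rw [inv_mul_eq_div, Real.div_sqrt]
  rw [h1, abs_mul, abs_of_nonneg (by positivity), mul_comm ‖z j - sampleMean n z‖]
  gcongr
  exact abs_real_inner_le_norm _ _

namespace IsRegular

variable {Ξ : Matrix (Fin d) (Fin d) ℝ} {m : EuclideanSpace ℝ (Fin d)}

lemma tendsto_sum_weights_sq (h : IsRegular z Ξ m) (hΞ : IsUnit Ξ.det) (v : Fin d → ℝ) :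
    Tendsto (fun n ↦ ∑ j, weights n z v j ^ 2) atTop (𝓝 (v ⬝ᵥ Ξ⁻¹ *ᵥ v)) := by
  have hc : Continuous fun M : Matrix (Fin d) (Fin d) ℝ ↦ v ⬝ᵥ M *ᵥ v := by fun_prop
  refine ((hc.tendsto _).comp (h.smul_inv hΞ)).congr' ?_
  filter_upwards [h.det_ne_zero hΞ] with n hn
  exact (sum_weights_sq v hn).symm

/-- The weights are n^{-1/2} times quantities with bounded average fourth power, which gives the
Lyapunov-type smallness of their higher power sums. -/
lemma exists_abs_weights_le (h : IsRegular z Ξ m) (hΞ : IsUnit Ξ.det) (v : Fin d → ℝ) :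
    ∃ B, ∀ᶠ n : ℕ in atTop, ∃ s : Fin n → ℝ, (∀ j, 0 ≤ s j) ∧
      (∀ j, |weights n z v j| ≤ (√(n : ℝ))⁻¹ * s j) ∧ ∑ j, s j ^ 4 ≤ B * n := by
  obtain ⟨B, hB⟩ := h.fourth
  have hc : Continuous fun M : Matrix (Fin d) (Fin d) ℝ ↦ ‖WithLp.toLp 2 (M *ᵥ v)‖ := by fun_prop
  have h1 := ((hc.tendsto _).comp (h.smul_inv hΞ)).eventually_lt_const
    (lt_add_one ‖WithLp.toLp 2 (Ξ⁻¹ *ᵥ v)‖)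
  refine ⟨(‖WithLp.toLp 2 (Ξ⁻¹ *ᵥ v)‖ + 1) ^ 4 * B, ?_⟩
  filter_upwards [h1, hB, eventually_gt_atTop 0] with n h1 hB hn
  refine ⟨fun j ↦ ‖z j - sampleMean n z‖ * (‖WithLp.toLp 2 (Ξ⁻¹ *ᵥ v)‖ + 1),
    fun j ↦ by positivity, fun j ↦ (abs_weights_le hn v j).trans ?_, ?_⟩
  · refine mul_le_mul_of_nonneg_left ?_ (by positivity)
    refine mul_le_mul_of_nonneg_left ?_ (norm_nonneg _)
    exact h1.le
  · simp only [mul_pow]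
    rw [← Finset.sum_mul, mul_comm, mul_assoc]
    gcongr

lemma tendsto_sum_weights_fourth (h : IsRegular z Ξ m) (hΞ : IsUnit Ξ.det) (v : Fin d → ℝ) :
    Tendsto (fun n ↦ ∑ j, weights n z v j ^ 4) atTop (𝓝 0) := by
  obtain ⟨B, hB⟩ := h.exists_abs_weights_le hΞ v
  have hlim : Tendsto (fun n : ℕ ↦ B * (n : ℝ)⁻¹) atTop (𝓝 0) := by
    simpa using tendsto_inv_atTop_nhds_zero_nat.const_mul B
  refine squeeze_zero' (Eventually.of_forall fun n ↦ by positivity) ?_ hlim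
  filter_upwards [hB, eventually_gt_atTop 0] with n ⟨s, hs0, hs, hsB⟩ hn
  have hn0 : (0 : ℝ) < n := by exact_mod_cast hn
  have h4 : ((√(n : ℝ))⁻¹) ^ 4 = ((n : ℝ) ^ 2)⁻¹ := by
    rw [inv_pow, show (√(n : ℝ)) ^ 4 = (√(n : ℝ) ^ 2) ^ 2 by ring, Real.sq_sqrt hn0.le]
  calc ∑ j, weights n z v j ^ 4 ≤ ∑ j, ((√(n : ℝ))⁻¹ * s j) ^ 4 := by
        refine Finset.sum_le_sum fun j _ ↦ ?_
        rw [← Even.pow_abs (by decide)]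
        exact pow_le_pow_left₀ (abs_nonneg _) (hs j) 4
    _ = ((n : ℝ) ^ 2)⁻¹ * ∑ j, s j ^ 4 := by simp only [mul_pow, h4, Finset.mul_sum]
    _ ≤ ((n : ℝ) ^ 2)⁻¹ * (B * n) := by gcongr
    _ = _ := by field_simp

lemma tendsto_sum_weights_cube (h : IsRegular z Ξ m) (hΞ : IsUnit Ξ.det) (v : Fin d → ℝ) :
    Tendsto (fun n ↦ ∑ j, |weights n z v j| ^ 3) atTop (𝓝 0) := by
  obtain ⟨B, hB⟩ := h.exists_abs_weights_le hΞ v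
  have hlim : Tendsto (fun n : ℕ ↦ (1 + B) * (√(n : ℝ))⁻¹) atTop (𝓝 0) := by
    have : Tendsto (fun n : ℕ ↦ (√(n : ℝ))⁻¹) atTop (𝓝 0) :=
      tendsto_inv_atTop_zero.comp (Real.tendsto_sqrt_atTop.comp tendsto_natCast_atTop_atTop)
    simpa using this.const_mul (1 + B)
  refine squeeze_zero' (Eventually.of_forall fun n ↦ by positivity) ?_ hlim
  filter_upwards [hB, eventually_gt_atTop 0] with n ⟨s, hs0, hs, hsB⟩ hn
  have hn0 : (0 : ℝ) < n := by exact_mod_cast hn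
  have hs3 : ∀ j, s j ^ 3 ≤ 1 + s j ^ 4 := fun j ↦ by
    rcases le_total (s j) 1 with h5 | h5
    · have := pow_le_one₀ (hs0 j) h5 (n := 3)
      have := pow_nonneg (hs0 j) 4
      linarith
    · have := pow_le_pow_right₀ h5 (by norm_num : 3 ≤ 4)
      linarith
  have hsq : √(n : ℝ) ^ 2 = n := Real.sq_sqrt hn0.le
  have hq : 0 < √(n : ℝ) := Real.sqrt_pos.2 hn0
  calc ∑ j, |weights n z v j| ^ 3 ≤ ∑ j, (((√(n : ℝ))⁻¹) ^ 3 * (1 + s j ^ 4)) := by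
        refine Finset.sum_le_sum fun j _ ↦ ?_
        refine (pow_le_pow_left₀ (abs_nonneg _) (hs j) 3).trans ?_
        rw [mul_pow]
        gcongr
        exact hs3 j
    _ = ((√(n : ℝ))⁻¹) ^ 3 * (n + ∑ j, s j ^ 4) := by
        rw [← Finset.mul_sum, Finset.sum_add_distrib]; simp
    _ ≤ ((√(n : ℝ))⁻¹) ^ 3 * (n + B * n) := by gcongr
    _ = ((√(n : ℝ))⁻¹) ^ 3 * √(n : ℝ) ^ 2 * (1 + B) := by rw [hsq]; ring
    _ = _ := by field_simp

end IsRegular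

end Gram

/-! ### Laws of large numbers and tightness of the data bounds -/

section Data

variable {d : ℕ} {F : Measure (EuclideanSpace ℝ (Fin d))}

lemma IsSubGaussianDistribution.integrable_coord_fourth [IsProbabilityMeasure F]
    (hF : IsSubGaussianDistribution F)
    (k : Fin d) : Integrable (fun z ↦ z k ^ 4) F := by
  obtain ⟨K, hK⟩ := hF (EuclideanSpace.single k 1)
  have h1 : (fun z : EuclideanSpace ℝ (Fin d) ↦ inner ℝ z (EuclideanSpace.single k (1 : ℝ))) =
      fun z ↦ z k := by
    ext z; simp [EuclideanSpace.inner_single_right]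
  rw [h1] at hK
  exact hK.integrable_fourth (by fun_prop)

lemma IsSubGaussianDistribution.integrable_norm_fourth [IsProbabilityMeasure F]
    (hF : IsSubGaussianDistribution F) :
    Integrable (fun z ↦ ‖z‖ ^ 4) F := by
  refine ((integrable_finsetSum Finset.univ fun k _ ↦
    hF.integrable_coord_fourth k).const_mul (d : ℝ)).mono' (by fun_prop)
    (ae_of_all _ fun z ↦ ?_)
  rw [Real.norm_of_nonneg (by positivity), show ‖z‖ ^ 4 = (‖z‖ ^ 2) ^ 2 by ring,
    EuclideanSpace.real_norm_sq_eq]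
  have := sq_sum_le_card_mul_sum_sq (s := Finset.univ) (f := fun k ↦ z k ^ 2)
  simpa [← pow_mul] using this

lemma IsSubGaussianDistribution.memLp_coord [IsProbabilityMeasure F]
    (hF : IsSubGaussianDistribution F)
    (k : Fin d) : MemLp (fun z ↦ z k) 2 F := by
  rw [memLp_two_iff_integrable_sq (by fun_prop)]
  refine ((integrable_const (1 : ℝ)).add (hF.integrable_coord_fourth k)).mono'
    (by fun_prop) (ae_of_all _ fun z ↦ ?_)
  rw [Real.norm_of_nonneg (sq_nonneg _)]
  simp only [Pi.add_apply]
  nlinarith [sq_nonneg (z k ^ 2 - 1), sq_nonneg (z k)]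

variable {Ω : Type*} [MeasurableSpace Ω] {P : Measure Ω}
  {Z : ℕ → Ω → EuclideanSpace ℝ (Fin d)}

lemma ae_tendsto_average (hZ : ∀ k, Measurable (Z k)) (hlaw : ∀ k, P.map (Z k) = F)
    (hind : iIndepFun Z P) {g : EuclideanSpace ℝ (Fin d) → ℝ} (hg : Measurable g)
    (hint : Integrable g F) :
    ∀ᵐ ω ∂P, Tendsto (fun n : ℕ ↦ (n : ℝ)⁻¹ * ∑ j : Fin n, g (Z j ω)) atTop
      (𝓝 (∫ z, g z ∂F)) := by
  have key := strong_law_ae_real (μ := P) (fun k ω ↦ g (Z k ω))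
    (by
      have h1 : Integrable g (P.map (Z 0)) := by rwa [hlaw]
      exact h1.comp_measurable (hZ 0))
    (fun k l hkl ↦ (hind.indepFun hkl).comp hg hg)
    (fun k ↦ (IdentDistrib.mk (hZ k).aemeasurable (hZ 0).aemeasurable
      (by rw [hlaw, hlaw])).comp hg)
  filter_upwards [key] with ω hω
  have h2 : ∫ z, g z ∂F = ∫ ω, g (Z 0 ω) ∂P := by
    rw [← hlaw 0, integral_map (hZ 0).aemeasurable hg.aestronglyMeasurable]
  rw [h2]
  refine hω.congr fun n ↦ ?_
  rw [Fin.sum_univ_eq_sum_range (fun j ↦ g (Z j ω)) n, div_eq_inv_mul]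

/-- The strong law for the coordinates, their pairwise products and the fourth power of the norm;
the sub-Gaussian assumption provides the integrability. -/
theorem ae_isRegular [IsProbabilityMeasure F] (hF : IsSubGaussianDistribution F)
    (hZ : ∀ k, Measurable (Z k))
    (hlaw : ∀ k, P.map (Z k) = F) (hind : iIndepFun Z P) :
    ∀ᵐ ω ∂P, IsRegular (fun k ↦ Z k ω) (covMatrix F) (WithLp.toLp 2 fun k ↦ ∫ z, z k ∂F) := by
  have h1 := ae_all_iff.2 fun k : Fin d ↦ ae_tendsto_average hZ hlaw hind (g := fun z ↦ z k)
    (by fun_prop) ((hF.memLp_coord k).integrable (by norm_num))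
  have h2 := ae_all_iff.2 fun k : Fin d ↦ ae_all_iff.2 fun l : Fin d ↦
    ae_tendsto_average hZ hlaw hind (g := fun z ↦ z k * z l)
    (by fun_prop) ((hF.memLp_coord k).integrable_mul (hF.memLp_coord l))
  have h4 := ae_tendsto_average hZ hlaw hind (g := fun z ↦ ‖z‖ ^ 4) (by fun_prop)
    hF.integrable_norm_fourth
  filter_upwards [h1, h2, h4] with ω h1 h2 h4
  have hcoord : ∀ k : Fin d, Tendsto (fun n : ℕ ↦ sampleMean n (fun j ↦ Z j ω) k) atTop
      (𝓝 (∫ z, z k ∂F)) := fun k ↦ (h1 k).congr fun n ↦ (sampleMean_apply k).symm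
  have hmean : Tendsto (fun n : ℕ ↦ sampleMean n (fun j ↦ Z j ω)) atTop
      (𝓝 (WithLp.toLp 2 fun k ↦ ∫ z, z k ∂F)) :=
    ((PiLp.continuous_toLp 2 _).tendsto _).comp (tendsto_pi_nhds.2 hcoord)
  refine ⟨?_, hmean, ?_⟩
  · refine tendsto_pi_nhds.2 fun k ↦ tendsto_pi_nhds.2 fun l ↦ ?_
    have hcov : covMatrix F k l = ∫ z, z k * z l ∂F - (∫ z, z k ∂F) * ∫ z, z l ∂F := by
      rw [covMatrix, Matrix.of_apply, covariance_eq_sub (hF.memLp_coord k) (hF.memLp_coord l)]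
      rfl
    rw [hcov]
    refine ((h2 k l).sub ((hcoord k).mul (hcoord l))).congr' ?_
    filter_upwards [eventually_gt_atTop 0] with n hn
    exact (smul_gram_apply (z := fun j ↦ Z j ω) hn k l).symm
  · set m : EuclideanSpace ℝ (Fin d) := WithLp.toLp 2 fun k ↦ ∫ z, z k ∂F
    refine ⟨8 * (∫ z, ‖z‖ ^ 4 ∂F + 1 + (‖m‖ + 1) ^ 4), ?_⟩
    filter_upwards [h4.eventually_lt_const (lt_add_one _),
      hmean.norm.eventually_lt_const (lt_add_one _), eventually_gt_atTop 0] with n h5 h6 hn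
    have hn0 : (0 : ℝ) < n := by exact_mod_cast hn
    have h7 : ∑ j : Fin n, ‖Z j ω‖ ^ 4 ≤ n * (∫ z, ‖z‖ ^ 4 ∂F + 1) := by
      rw [inv_mul_lt_iff₀ hn0] at h5
      exact h5.le
    have h8 : ∀ x y : ℝ, 0 ≤ x → 0 ≤ y → (x + y) ^ 4 ≤ 8 * (x ^ 4 + y ^ 4) := by
      intro x y hx hy
      have := add_pow_le hx hy 4
      norm_num at this
      exact this
    calc _ ≤ ∑ j : Fin n, 8 * (‖Z j ω‖ ^ 4 + (‖m‖ + 1) ^ 4) := by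
          refine Finset.sum_le_sum fun j _ ↦ ?_
          refine le_trans ?_ (h8 _ _ (norm_nonneg _) (by positivity))
          exact pow_le_pow_left₀ (norm_nonneg _)
            ((norm_sub_le _ _).trans (add_le_add le_rfl h6.le)) 4
      _ = 8 * (∑ j : Fin n, ‖Z j ω‖ ^ 4 + n * (‖m‖ + 1) ^ 4) := by
          rw [← Finset.mul_sum, Finset.sum_add_distrib]; simp
      _ ≤ 8 * (n * (∫ z, ‖z‖ ^ 4 ∂F + 1) + n * (‖m‖ + 1) ^ 4) := by gcongr
      _ = _ := by ring

lemma tendsto_measure_of_ae_eventually [IsProbabilityMeasure P] {A : ℕ → Set Ω}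
    (hA : ∀ n, MeasurableSet (A n)) (h : ∀ᵐ ω ∂P, ∀ᶠ n in atTop, ω ∈ A n) :
    Tendsto (fun n ↦ P (A n)ᶜ) atTop (𝓝 0) := by
  have := tendsto_measure_of_ae_tendsto_indicator_of_isFiniteMeasure (μ := P) (A := ∅) atTop
    MeasurableSet.empty (fun n ↦ (hA n).compl) (by
      filter_upwards [h] with ω hω
      filter_upwards [hω] with n hn
      simp [hn])
  simpa using this

lemma exists_measure_lt_le [IsProbabilityMeasure P] {X : Ω → ℝ} (hX : Measurable X) {δ : ENNReal}
    (hδ : 0 < δ) : ∃ R, 0 ≤ R ∧ P {ω | R < X ω} ≤ δ := by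
  have h := tendsto_measure_of_ae_eventually (P := P) (A := fun n : ℕ ↦ {ω | X ω ≤ n})
    (fun n ↦ measurableSet_le hX measurable_const) (ae_of_all _ fun ω ↦ by
      filter_upwards [eventually_ge_atTop ⌈X ω⌉₊] with n hn
      exact (Nat.le_ceil _).trans (by exact_mod_cast hn))
  obtain ⟨n, hn⟩ := (h.eventually_le_const hδ).exists
  refine ⟨n, Nat.cast_nonneg n, le_trans (measure_mono fun ω hω ↦ ?_) hn⟩
  simpa using hω

lemma measurable_centered_apply (hZ : ∀ k, Measurable (Z k)) (n : ℕ) (j : Fin n) (k : Fin d) :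
    Measurable fun ω ↦ centered n (fun m ↦ Z m ω) j k := by
  simp only [centered, Matrix.of_apply, sampleMean_apply]
  fun_prop

lemma measurable_gram_apply (hZ : ∀ k, Measurable (Z k)) (n : ℕ) (k l : Fin d) :
    Measurable fun ω ↦ gram n (fun m ↦ Z m ω) k l :=
  measurable_mul_apply (fun i j ↦ measurable_centered_apply hZ n j i)
    (measurable_centered_apply hZ n) k l

/-- The bounds on the Gram matrix, its inverse and the sample mean hold eventually almost surely,
with each limit enlarged by one. The row bound also involves the single fixed variable Z_i, which is
merely tight; this is why L₀ depends on δ. -/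
theorem exists_measure_not_dataBound_le [IsProbabilityMeasure P] {Ξ : Matrix (Fin d) (Fin d) ℝ}
    {m : EuclideanSpace ℝ (Fin d)} (hZ : ∀ k, Measurable (Z k))
    (h : ∀ᵐ ω ∂P, IsRegular (fun k ↦ Z k ω) Ξ m) (hΞ : IsUnit Ξ.det) (i : ℕ) {δ : ENNReal}
    (hδ : 0 < δ) : ∃ L₀, 0 ≤ L₀ ∧ ∀ᶠ n : ℕ in atTop, ∀ hi : i < n,
      P {ω | ¬ DataBound (centered n fun k ↦ Z k ω) ⟨i, hi⟩ L₀} ≤ δ := by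
  obtain ⟨δ', hδ', hδ2⟩ : ∃ δ', 0 < δ' ∧ δ' + δ' ≤ δ :=
    ⟨δ / 2, ENNReal.half_pos hδ.ne', (ENNReal.add_halves δ).le⟩
  obtain ⟨R, hR0, hR⟩ := exists_measure_lt_le (P := P) (hZ i).norm hδ'
  set L := ‖Ξ⁻¹‖ + 1 + |Ξ.trace| + 1 + ‖m‖ + 1 with hL
  have hL1 : ‖Ξ⁻¹‖ + 1 ≤ L := by rw [hL]; linarith [abs_nonneg Ξ.trace, norm_nonneg m]
  have hL2 : Ξ.trace + 1 ≤ L := by rw [hL]; linarith [le_abs_self Ξ.trace, norm_nonneg m, norm_nonneg Ξ⁻¹]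
  have hL3 : ‖m‖ + 1 ≤ L := by rw [hL]; linarith [abs_nonneg Ξ.trace, norm_nonneg Ξ⁻¹]
  have hL0 : 0 ≤ L := le_trans (by positivity) hL1
  let A : ℕ → Set Ω := fun n ↦ {ω | (gram n fun k ↦ Z k ω).det ≠ 0 ∧
    ‖(gram n fun k ↦ Z k ω)⁻¹‖ ^ 2 ≤ (L / n) ^ 2 ∧ ‖centered n fun k ↦ Z k ω‖ ^ 2 ≤ L * n ∧
    ‖sampleMean n fun k ↦ Z k ω‖ ≤ L}
  have hA : ∀ n, MeasurableSet (A n) := fun n ↦ by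
    have hG := measurable_gram_apply hZ n
    have hm : Measurable fun ω ↦ ‖sampleMean n fun k ↦ Z k ω‖ := by
      unfold sampleMean
      fun_prop
    exact (measurableSet_eq_fun (measurable_det hG) measurable_const).compl.inter
      ((measurableSet_le (measurable_norm_sq (measurable_inv_apply hG)) measurable_const).inter
      ((measurableSet_le (measurable_norm_sq (measurable_centered_apply hZ n))
        measurable_const).inter (measurableSet_le hm measurable_const)))
  have hAlim := tendsto_measure_of_ae_eventually (P := P) hA (by
    filter_upwards [h] with ω h
    have htr : Tendsto (fun n : ℕ ↦ ((n : ℝ)⁻¹ • gram n fun k ↦ Z k ω).trace) atTop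
        (𝓝 Ξ.trace) := ((continuous_id.matrix_trace).tendsto Ξ).comp h.gram
    filter_upwards [h.det_ne_zero hΞ, (h.smul_inv hΞ).norm.eventually_lt_const (lt_add_one _),
      htr.eventually_lt_const (lt_add_one _), h.mean.norm.eventually_lt_const (lt_add_one _),
      eventually_gt_atTop 0] with n h1 h2 h3 h4 hn
    have hn0 : (0 : ℝ) < n := by exact_mod_cast hn
    refine ⟨h1, ?_, ?_, h4.le.trans hL3⟩
    · refine pow_le_pow_left₀ (norm_nonneg _) ?_ 2
      rw [norm_smul, Real.norm_of_nonneg hn0.le] at h2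
      rw [le_div_iff₀ hn0, mul_comm]
      exact h2.le.trans hL1
    · rw [norm_centered_sq]
      rw [Matrix.trace_smul, smul_eq_mul, inv_mul_lt_iff₀ hn0] at h3
      nlinarith)
  refine ⟨L + R, by positivity, ?_⟩
  filter_upwards [hAlim.eventually_le_const hδ', eventually_gt_atTop 0] with n hn hn0 hi
  have hn1 : (0 : ℝ) < n := by exact_mod_cast hn0
  refine le_trans (measure_mono (t := (A n)ᶜ ∪ {ω | R < ‖Z i ω‖}) fun ω hω ↦ ?_)
    ((measure_union_le _ _).trans ((add_le_add hn hR).trans hδ2))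
  by_contra hcon
  simp only [Set.mem_union, Set.mem_compl_iff, not_or, not_not, Set.mem_ofPred_eq, not_lt]
    at hcon
  obtain ⟨⟨h1, h2, h3, h4⟩, h5⟩ := hcon
  refine hω ⟨Ne.isUnit h1, ?_, h3.trans ?_, ?_⟩
  · refine (le_of_sq_le_sq h2 (by positivity)).trans ?_
    gcongr
    linarith
  · gcongr
    linarith
  · rw [norm_rowSelector_mul_centered]
    refine (norm_sub_le _ _).trans ?_
    rw [add_comm L]
    exact add_le_add h5 h4

end Data

/-! ### The scaled row error and its linear part -/

section RowError

variable {N d : ℕ}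

/-- The scaled error of the row `i` of the rotated embedding. -/
noncomputable def rowError (i : Fin N) (z : ℕ → EuclideanSpace ℝ (Fin d))
    (X : Matrix (Fin N) (Fin d) ℝ) (W : Matrix (Fin d) (Fin d) ℝ) : EuclideanSpace ℝ (Fin d) :=
  WithLp.toLp 2 fun k ↦ √(N : ℝ) * ((X * W) i k - centered N z i k)

/-- The part of the scaled error of the row `i` that is linear in the noise. -/
noncomputable def linearTerm (i : Fin N) (z : ℕ → EuclideanSpace ℝ (Fin d))
    (E : Matrix (Fin N) (Fin N) ℝ) : EuclideanSpace ℝ (Fin d) :=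
  WithLp.toLp 2 fun k ↦ √(N : ℝ) * (-(1 / 2) * (E * (centered N z * (gram N z)⁻¹)) i k)

lemma inner_linearTerm (i : Fin N) (z : ℕ → EuclideanSpace ℝ (Fin d))
    (E : Matrix (Fin N) (Fin N) ℝ) (t : EuclideanSpace ℝ (Fin d)) :
    inner ℝ (linearTerm i z E) t = ∑ j, E i j * weights N z (fun k ↦ -(1 / 2) * t k) j := by
  simp only [linearTerm, PiLp.inner_apply, RCLike.inner_apply, conj_trivial, weights,
    Matrix.mulVec, dotProduct, Matrix.mul_apply (M := E), Finset.mul_sum]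
  rw [Finset.sum_comm]
  exact Finset.sum_congr rfl fun j _ ↦ Finset.sum_congr rfl fun k _ ↦ by ring

lemma norm_rowError_sub_linearTerm (i : Fin N) (z : ℕ → EuclideanSpace ℝ (Fin d))
    (E : Matrix (Fin N) (Fin N) ℝ) (X : Matrix (Fin N) (Fin d) ℝ) (W : Matrix (Fin d) (Fin d) ℝ) :
    ‖rowError i z X W - linearTerm i z E‖ = √(N : ℝ) * ‖rowSelector i * (X * W) -
      rowSelector i * centered N z + (1 / 2 : ℝ) • (rowSelector i * (E * centered N z) *
        ((centered N z)ᵀ * centered N z)⁻¹)‖ := by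
  rw [← sq_eq_sq₀ (norm_nonneg _) (by positivity), EuclideanSpace.real_norm_sq_eq, mul_pow,
    frobenius_norm_sq, Matrix.mul_assoc, Matrix.mul_assoc, ← gram]
  simp only [Finset.univ_unique, Finset.sum_singleton, Finset.mul_sum]
  refine Finset.sum_congr rfl fun k _ ↦ ?_
  rw [← mul_pow]
  simp only [PiLp.sub_apply, rowError, linearTerm, Matrix.add_apply, Matrix.sub_apply,
    Matrix.smul_apply, rowSelector_mul_apply, smul_eq_mul]
  congr 1
  ring

/-- The error of the row of an embedding under the bounds on the data and the noise. -/
theorem norm_rowError_sub_linearTerm_le {E : Matrix (Fin N) (Fin N) ℝ}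
    {z : ℕ → EuclideanSpace ℝ (Fin d)} {i : Fin N} {L₀ a u : ℝ} (hE : Eᵀ = E)
    (hD : DataBound (centered N z) i L₀) (hB : NoiseBound E (centered N z) i a u)
    (hu : u ^ 4 = N) (hu0 : 0 < u) (hL₀ : 0 ≤ L₀) (ha : 0 ≤ a)
    (hua : expansionThreshold d L₀ a ≤ u) (hdN : d ≤ N) {X : Matrix (Fin N) (Fin d) ℝ}
    (hX : (∃ Y : Matrix (Fin N) (Fin d) ℝ, IsCMDSEmbedding (sqDist N z + E) Y) →
      IsCMDSEmbedding (sqDist N z + E) X)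
    {W : Matrix (Fin d) (Fin d) ℝ} (hW : W ∈ Matrix.orthogonalGroup (Fin d) ℝ)
    (hA : ((centered N z)ᵀ * X).det ≠ 0 → ((centered N z)ᵀ * X * W).PosSemidef) :
    ‖rowError i z X W - linearTerm i z E‖ ≤ expansionConst d L₀ a / u := by
  have hsqrt : √(N : ℝ) = u ^ 2 := by
    rw [← hu, show u ^ 4 = (u ^ 2) ^ 2 by ring, Real.sqrt_sq (by positivity)]
  rw [norm_rowError_sub_linearTerm, hsqrt]
  exact norm_embedding_row_le hE hD hB hu hu0 hL₀ ha hua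
    (hX (exists_embedding_of_bounds hE hD hB hu hu0 hL₀ ha hua hdN)) hW hA

end RowError

/-! ### Vanishing remainder and the Gaussian limit -/

section Limit

variable {d : ℕ} {Ω : Type*} [MeasurableSpace Ω] {P : Measure Ω}
  {Ξ : Matrix (Fin d) (Fin d) ℝ} {m : EuclideanSpace ℝ (Fin d)}
  {Z : ℕ → Ω → EuclideanSpace ℝ (Fin d)} {E : (n : ℕ) → Ω → Matrix (Fin n) (Fin n) ℝ} {σ C : ℝ}

lemma indepFun_centered {n : ℕ}
    (hEZ : IndepFun (fun ω (i j : Fin n) ↦ E n ω i j) (fun ω (k : Fin n) ↦ Z k ω) P) :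
    IndepFun (fun ω (k l : Fin n) ↦ E n ω k l)
      (fun ω (k : Fin n) (l : Fin d) ↦ centered n (fun m ↦ Z m ω) k l) P := by
  have hφ : Measurable fun (y : Fin n → EuclideanSpace ℝ (Fin d)) (k : Fin n) (l : Fin d) ↦
      y k l - ((n : ℝ)⁻¹ • ∑ j, y j) l := by fun_prop
  exact hEZ.comp measurable_id hφ

/-- L₀ is chosen first from the data. It fixes the second moment bound q for the noise, and a is
then taken large enough for Markov's inequality. -/
theorem exists_measure_not_bound_le [IsProbabilityMeasure P]
    (hZ : ∀ k, Measurable (Z k)) (hE : ∀ n, IsNoise P (E n) σ C)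
    (hEZ : ∀ n : ℕ, IndepFun (fun ω (i j : Fin n) ↦ E n ω i j) (fun ω (k : Fin n) ↦ Z k ω) P)
    (hreg : ∀ᵐ ω ∂P, IsRegular (fun k ↦ Z k ω) Ξ m) (hΞ : IsUnit Ξ.det) (i : ℕ) {δ : ENNReal}
    (hδ : 0 < δ) : ∃ L₀ a : ℝ, 0 ≤ L₀ ∧ 0 ≤ a ∧ ∀ᶠ n : ℕ in atTop, ∀ (hi : i < n) (u : ℝ),
      u ^ 4 = n → P {ω | ¬ (DataBound (centered n fun k ↦ Z k ω) ⟨i, hi⟩ L₀ ∧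
        NoiseBound (E n ω) (centered n fun k ↦ Z k ω) ⟨i, hi⟩ a u)} ≤ δ := by
  obtain ⟨δ', hδ', hδ2⟩ : ∃ δ', 0 < δ' ∧ δ' + δ' ≤ δ :=
    ⟨δ / 2, ENNReal.half_pos hδ.ne', (ENNReal.add_halves δ).le⟩
  obtain ⟨L₀, hL₀, hdata⟩ := exists_measure_not_dataBound_le hZ hreg hΞ i hδ'
  set q := L₀ + L₀ ^ 2 with hq
  have hq0 : 0 ≤ q := by positivity
  have hlim : Tendsto (fun a : ℝ ↦ ENNReal.ofReal (8 * (σ ^ 2 + C) * (1 + q + q ^ 2) / a ^ 4)) atTop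
      (𝓝 0) := by
    have := ENNReal.tendsto_ofReal ((tendsto_pow_atTop (α := ℝ) (n := 4)
      (by norm_num)).const_div_atTop (8 * (σ ^ 2 + C) * (1 + q + q ^ 2)))
    simpa using this
  obtain ⟨a, hδa, ha⟩ := ((hlim.eventually_le_const hδ').and (eventually_gt_atTop 0)).exists
  refine ⟨L₀, a, hL₀, ha.le, ?_⟩
  filter_upwards [hdata] with n hn hi u hu
  refine le_trans (measure_mono fun ω hω ↦ ?_)
    ((measure_union_le _ _).trans ((add_le_add (hn hi) (((hE n).measure_not_noiseBound_le
      (measurable_centered_apply hZ n) (indepFun_centered (hEZ n)) ⟨i, hi⟩ hq0 ha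
      hu).trans hδa)).trans hδ2))
  by_cases hD : DataBound (centered n fun k ↦ Z k ω) ⟨i, hi⟩ L₀
  · refine Or.inr ⟨⟨hD.norm.trans ?_, ?_⟩, fun hN ↦ hω ⟨hD, hN⟩⟩
    · gcongr
      rw [hq]; nlinarith
    · refine (pow_le_pow_left₀ (norm_nonneg _) hD.row 2).trans ?_
      rw [hq]; linarith
  · exact Or.inl hD

variable {X : (n : ℕ) → Ω → Matrix (Fin n) (Fin d) ℝ} {W : ℕ → Ω → Matrix (Fin d) (Fin d) ℝ}

/-- Since L₀ and a depend on δ but not on n, the remainder on the good event is a constant over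
n^{1/4} and eventually falls below ε. -/
theorem tendsto_measure_rowError_sub [IsProbabilityMeasure P]
    (hZ : ∀ k, Measurable (Z k)) (hE : ∀ n, IsNoise P (E n) σ C)
    (hEZ : ∀ n : ℕ, IndepFun (fun ω (i j : Fin n) ↦ E n ω i j) (fun ω (k : Fin n) ↦ Z k ω) P)
    (hreg : ∀ᵐ ω ∂P, IsRegular (fun k ↦ Z k ω) Ξ m) (hΞ : IsUnit Ξ.det)
    (hX : ∀ n ω, (∃ Y : Matrix (Fin n) (Fin d) ℝ,
        IsCMDSEmbedding (sqDist n (fun k ↦ Z k ω) + E n ω) Y) →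
      IsCMDSEmbedding (sqDist n (fun k ↦ Z k ω) + E n ω) (X n ω))
    (hW : ∀ n ω, W n ω ∈ Matrix.orthogonalGroup (Fin d) ℝ)
    (hA : ∀ n ω, ((centered n fun k ↦ Z k ω)ᵀ * X n ω).det ≠ 0 →
      ((centered n fun k ↦ Z k ω)ᵀ * X n ω * W n ω).PosSemidef)
    (i : ℕ) {ε : ℝ} (hε : 0 < ε) {δ : ENNReal} (hδ : 0 < δ) :
    ∀ᶠ n : ℕ in atTop, ∀ hi : i < n, P {ω | ε ≤ ‖rowError ⟨i, hi⟩ (fun k ↦ Z k ω) (X n ω) (W n ω) -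
      linearTerm ⟨i, hi⟩ (fun k ↦ Z k ω) (E n ω)‖} ≤ δ := by
  obtain ⟨L₀, a, hL₀, ha, hbd⟩ := exists_measure_not_bound_le hZ hE hEZ hreg hΞ i hδ
  have hu : Tendsto (fun n : ℕ ↦ √√(n : ℝ)) atTop atTop :=
    Real.tendsto_sqrt_atTop.comp (Real.tendsto_sqrt_atTop.comp tendsto_natCast_atTop_atTop)
  have hconst : Tendsto (fun n : ℕ ↦ expansionConst d L₀ a / √√(n : ℝ)) atTop (𝓝 0) :=
    hu.const_div_atTop _
  filter_upwards [hbd, hu.eventually_ge_atTop (expansionThreshold d L₀ a),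
    hu.eventually_gt_atTop 0, hconst.eventually_lt_const hε, eventually_ge_atTop d]
    with n hn hua hu0 hc hdn hi
  have hu4 : √√(n : ℝ) ^ 4 = n := by
    rw [show √√(n : ℝ) ^ 4 = (√√(n : ℝ) ^ 2) ^ 2 by ring, Real.sq_sqrt (Real.sqrt_nonneg _),
      Real.sq_sqrt (Nat.cast_nonneg n)]
  refine le_trans (measure_mono fun ω hω ↦ ?_) (hn hi _ hu4)
  rintro ⟨hD, hN⟩
  have hω' : ε ≤ _ := hω
  have := norm_rowError_sub_linearTerm_le ((hE n).symm ω) hD hN hu4 hu0 hL₀ ha hua hdn (hX n ω)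
    (hW n ω) (hA n ω)
  linarith

lemma IsRegular.posSemidef {z : ℕ → EuclideanSpace ℝ (Fin d)} (h : IsRegular z Ξ m) :
    Ξ.PosSemidef := by
  rw [Matrix.posSemidef_iff_dotProduct_mulVec]
  have hG : ∀ n : ℕ, ((n : ℝ)⁻¹ • CMDS.gram n z).PosSemidef := fun n ↦ by
    have : (CMDS.gram n z).PosSemidef := by
      simpa [CMDS.gram] using Matrix.posSemidef_conjTranspose_mul_self (centered n z)
    exact this.smul (by positivity)
  constructor
  · refine tendsto_nhds_unique (((continuous_id.matrix_conjTranspose).tendsto Ξ).comp h.gram) ?_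
    exact h.gram.congr fun n ↦ (hG n).isHermitian.eq.symm
  · intro x
    have hc : Continuous fun M : Matrix (Fin d) (Fin d) ℝ ↦ star x ⬝ᵥ M *ᵥ x := by fun_prop
    exact ge_of_tendsto' ((hc.tendsto _).comp h.gram) fun n ↦
      (Matrix.posSemidef_iff_dotProduct_mulVec.1 (hG n)).2 x

lemma measurable_linearTerm (hZ : ∀ k, Measurable (Z k)) {n : ℕ} (hE : IsNoise P (E n) σ C)
    (i : Fin n) : Measurable fun ω ↦ linearTerm i (fun k ↦ Z k ω) (E n ω) := by
  have h1 := measurable_mul_apply hE.measurable (measurable_mul_apply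
    (measurable_centered_apply hZ n) (measurable_inv_apply (measurable_gram_apply hZ n)))
  refine (WithLp.measurable_toLp 2 _).comp (measurable_pi_lambda _ fun k ↦ ?_)
  exact ((h1 i k).const_mul _).const_mul _

lemma measurable_rowError (hZ : ∀ k, Measurable (Z k)) {n : ℕ}
    (hX : ∀ i k, Measurable fun ω ↦ X n ω i k) (hW : ∀ k l, Measurable fun ω ↦ W n ω k l)
    (i : Fin n) : Measurable fun ω ↦ rowError i (fun k ↦ Z k ω) (X n ω) (W n ω) := by
  refine (WithLp.measurable_toLp 2 _).comp (measurable_pi_lambda _ fun k ↦ ?_)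
  exact ((measurable_mul_apply hX hW i k).sub (measurable_centered_apply hZ n i k)).const_mul _

theorem tendstoInDistribution_linearTerm [IsProbabilityMeasure P]
    (hZ : ∀ k, Measurable (Z k))
    (hE : ∀ n, IsNoise P (E n) σ C)
    (hEZ : ∀ n : ℕ, IndepFun (fun ω (i j : Fin n) ↦ E n ω i j) (fun ω (k : Fin n) ↦ Z k ω) P)
    (hreg : ∀ᵐ ω ∂P, IsRegular (fun k ↦ Z k ω) Ξ m) (hΞ : IsUnit Ξ.det) (hpos : Ξ.PosSemidef)
    {N : ℕ → ℕ} (hN : Tendsto N atTop atTop) (i : (n : ℕ) → Fin (N n)) :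
    TendstoInDistribution (fun n ω ↦ linearTerm (i n) (fun k ↦ Z k ω) (E (N n) ω)) atTop id
      (fun _ ↦ P) (multivariateGaussian 0 ((σ ^ 2 / 4) • Ξ⁻¹)) := by
  have hmeas := fun n ↦ measurable_linearTerm hZ (hE (N n)) (i n)
  refine ⟨fun n ↦ (hmeas n).aemeasurable, aemeasurable_id, ?_⟩
  refine ProbabilityMeasure.tendsto_iff_tendsto_charFun.2 fun t ↦ ?_
  simp only [ProbabilityMeasure.coe_mk, Measure.map_id]
  -- The factor −1/2 from double centering enters the quadratic form squared and turns σ² into σ²/4.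
  set v : Fin d → ℝ := fun k ↦ -(1 / 2) * t k with hv
  have hS : ((σ ^ 2 / 4) • Ξ⁻¹).PosSemidef := hpos.inv.smul (by positivity)
  have hlim := tendsto_integral_exp_row (fun n ↦ hE (N n)) i
    (w := fun n ω ↦ weights (N n) (fun k ↦ Z k ω) v) (s := v ⬝ᵥ Ξ⁻¹ *ᵥ v)
    (fun n ↦ ?_) (fun n ↦ ?_) ?_ ?_ ?_
  · have h1 : charFun (multivariateGaussian 0 ((σ ^ 2 / 4) • Ξ⁻¹)) t =
        ((Real.exp (-(σ ^ 2 * (v ⬝ᵥ Ξ⁻¹ *ᵥ v) / 2)) : ℝ) : ℂ) := by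
      have h2 : v = (-(1 / 2 : ℝ)) • t.ofLp := by ext k; simp [hv]
      rw [charFun_multivariateGaussian hS, h2, Matrix.mulVec_smul, dotProduct_smul,
        smul_dotProduct, Matrix.smul_mulVec, dotProduct_smul]
      simp only [inner_zero_right, smul_eq_mul]
      push_cast
      congr 1
      ring
    rw [h1]
    refine hlim.congr fun n ↦ ?_
    rw [charFun_apply, integral_map (hmeas n).aemeasurable (by fun_prop)]
    simp only [inner_linearTerm]
    rfl
  · refine measurable_pi_lambda _ fun j ↦ ?_
    have h1 := measurable_mul_apply (measurable_centered_apply hZ (N n))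
      (measurable_inv_apply (measurable_gram_apply hZ (N n)))
    simp only [weights, Matrix.mulVec, dotProduct]
    exact (Finset.measurable_fun_sum _ fun k _ ↦ (h1 j k).mul_const _).const_mul _
  · have h1 := indepFun_centered (hEZ (N n))
    let φ : (Fin (N n) → Fin d → ℝ) → Fin (N n) → ℝ := fun y j ↦
      √(N n : ℝ) * ((Matrix.of y * ((Matrix.of y)ᵀ * Matrix.of y)⁻¹) *ᵥ v) j
    have hφ : Measurable φ := by
      refine measurable_pi_lambda _ fun j ↦ ?_
      have h0 : ∀ k l, Measurable fun y : Fin (N n) → Fin d → ℝ ↦ Matrix.of y k l := fun k l ↦ by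
        simp only [Matrix.of_apply]; fun_prop
      have h2 := measurable_mul_apply h0
        (measurable_inv_apply (measurable_mul_apply (fun k l ↦ h0 l k) h0))
      simp only [φ, Matrix.mulVec, dotProduct]
      exact (Finset.measurable_fun_sum _ fun k _ ↦ (h2 j k).mul_const _).const_mul _
    exact h1.comp measurable_id hφ
  · filter_upwards [hreg] with ω h
    exact (h.tendsto_sum_weights_sq hΞ v).comp hN
  · filter_upwards [hreg] with ω h
    exact (h.tendsto_sum_weights_cube hΞ v).comp hN
  · filter_upwards [hreg] with ω h
    exact (h.tendsto_sum_weights_fourth hΞ v).comp hN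

end Limit

/-! ### Orthants as continuity sets -/

section Orthant

variable {d : ℕ}

lemma frontier_orthant_subset (α : EuclideanSpace ℝ (Fin d)) :
    frontier {x : EuclideanSpace ℝ (Fin d) | ∀ k, x k ≤ α k} ⊆ ⋃ k, {x | x k = α k} := by
  have hclosed : IsClosed {x : EuclideanSpace ℝ (Fin d) | ∀ k, x k ≤ α k} := by
    simp only [Set.ofPred_forall]
    exact isClosed_iInter fun k ↦ isClosed_le (by fun_prop) continuous_const
  have hopen : IsOpen {x : EuclideanSpace ℝ (Fin d) | ∀ k, x k < α k} := by
    simp only [Set.ofPred_forall]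
    exact isOpen_iInter_of_finite fun k ↦ isOpen_lt (by fun_prop) continuous_const
  intro x hx
  rw [hclosed.frontier_eq] at hx
  by_contra hne
  simp only [Set.mem_iUnion, Set.mem_ofPred_eq, not_exists] at hne
  exact hx.2 (interior_maximal (fun y hy k ↦ (hy k).le) hopen
    fun k ↦ lt_of_le_of_ne (hx.1 k) (hne k))

/-- The frontier lies in finitely many coordinate hyperplanes, and each coordinate is a
nondegenerate real Gaussian without atoms. -/
lemma multivariateGaussian_frontier_orthant {S : Matrix (Fin d) (Fin d) ℝ} (hS : S.PosDef)
    (α : EuclideanSpace ℝ (Fin d)) :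
    multivariateGaussian 0 S (frontier {x : EuclideanSpace ℝ (Fin d) | ∀ k, x k ≤ α k}) = 0 := by
  refine measure_mono_null (frontier_orthant_subset α) (measure_iUnion_null fun k ↦ ?_)
  have hp := measurePreserving_eval_multivariateGaussian (μ := 0) hS.posSemidef (i := k)
  have hv : (S k k).toNNReal ≠ 0 := by simpa using hS.diag_pos
  have : NullSingletonClass (gaussianReal ((0 : EuclideanSpace ℝ (Fin d)) k) (S k k).toNNReal) :=
    nullSingletonClass_gaussianReal hv
  have h1 := hp.measure_preimage (s := {α k}) (measurableSet_singleton _).nullMeasurableSet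
  rw [measure_singleton] at h1
  exact h1

end Orthant

/-! ### The degenerate case of zero variance -/

section NoNoise

variable {d : ℕ} {Ω : Type*} [MeasurableSpace Ω] {P : Measure Ω}

lemma IsNoise.ae_eq_zero {n : ℕ} {E : Ω → Matrix (Fin n) (Fin n) ℝ} {C : ℝ}
    [IsProbabilityMeasure P] (h : IsNoise P E 0 C) : ∀ᵐ ω ∂P, E ω = 0 := by
  have h1 : ∀ i j, ∀ᵐ ω ∂P, E ω i j = 0 := fun i j ↦ by
    rcases eq_or_ne i j with rfl | hij
    · exact ae_of_all _ fun ω ↦ h.hollow ω i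
    · have h2 := (integral_eq_zero_iff_of_nonneg (fun ω ↦ sq_nonneg (E ω i j))
        (h.memLp_two i j).integrable_sq).1 (by simpa using h.var i j hij)
      filter_upwards [h2] with ω hω
      simpa using hω
  filter_upwards [ae_all_iff.2 fun i ↦ ae_all_iff.2 (h1 i)] with ω hω
  ext i j
  exact hω i j

lemma noiseBound_zero {n : ℕ} (Y : Matrix (Fin n) (Fin d) ℝ) (i : Fin n) (u : ℝ) :
    NoiseBound 0 Y i 0 u := by
  constructor <;> simp

/-- Without noise the rotated embedding recovers the centred data with high probability. -/
theorem tendsto_measure_rowError_ne_zero [IsProbabilityMeasure P] {Ξ : Matrix (Fin d) (Fin d) ℝ}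
    {m : EuclideanSpace ℝ (Fin d)} {Z : ℕ → Ω → EuclideanSpace ℝ (Fin d)}
    {E : (n : ℕ) → Ω → Matrix (Fin n) (Fin n) ℝ} {C : ℝ}
    {X : (n : ℕ) → Ω → Matrix (Fin n) (Fin d) ℝ} {W : ℕ → Ω → Matrix (Fin d) (Fin d) ℝ}
    (hZ : ∀ k, Measurable (Z k)) (hE : ∀ n, IsNoise P (E n) 0 C)
    (hreg : ∀ᵐ ω ∂P, IsRegular (fun k ↦ Z k ω) Ξ m) (hΞ : IsUnit Ξ.det)
    (hX : ∀ n ω, (∃ Y : Matrix (Fin n) (Fin d) ℝ,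
        IsCMDSEmbedding (sqDist n (fun k ↦ Z k ω) + E n ω) Y) →
      IsCMDSEmbedding (sqDist n (fun k ↦ Z k ω) + E n ω) (X n ω))
    (hW : ∀ n ω, W n ω ∈ Matrix.orthogonalGroup (Fin d) ℝ)
    (hA : ∀ n ω, ((centered n fun k ↦ Z k ω)ᵀ * X n ω).det ≠ 0 →
      ((centered n fun k ↦ Z k ω)ᵀ * X n ω * W n ω).PosSemidef)
    (i : ℕ) {δ : ENNReal} (hδ : 0 < δ) : ∀ᶠ n : ℕ in atTop, ∀ hi : i < n,
      P {ω | rowError ⟨i, hi⟩ (fun k ↦ Z k ω) (X n ω) (W n ω) ≠ 0} ≤ δ := by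
  obtain ⟨L₀, hL₀, hbd⟩ := exists_measure_not_dataBound_le hZ hreg hΞ i hδ
  have hu : Tendsto (fun n : ℕ ↦ √√(n : ℝ)) atTop atTop :=
    Real.tendsto_sqrt_atTop.comp (Real.tendsto_sqrt_atTop.comp tendsto_natCast_atTop_atTop)
  filter_upwards [hbd, hu.eventually_ge_atTop (expansionThreshold d L₀ 0),
    hu.eventually_gt_atTop 0, eventually_ge_atTop d] with n hn hua hu0 hdn hi
  have hu4 : √√(n : ℝ) ^ 4 = n := by
    rw [show √√(n : ℝ) ^ 4 = (√√(n : ℝ) ^ 2) ^ 2 by ring, Real.sq_sqrt (Real.sqrt_nonneg _),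
      Real.sq_sqrt (Nat.cast_nonneg n)]
  refine le_trans (measure_mono_ae ?_) (hn hi)
  filter_upwards [(hE n).ae_eq_zero] with ω hω hne hD
  refine hne ?_
  have h1 := norm_rowError_sub_linearTerm_le ((hE n).symm ω) hD
    (by rw [hω]; exact noiseBound_zero _ _ _) hu4 hu0 hL₀ le_rfl hua hdn (hX n ω) (hW n ω) (hA n ω)
  have h2 : linearTerm ⟨i, hi⟩ (fun k ↦ Z k ω) (E n ω) = 0 := by
    rw [hω]; ext k; simp [linearTerm]
  rw [h2, sub_zero, expansionConst_zero, zero_div] at h1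
  exact norm_le_zero_iff.1 h1

lemma multivariateGaussian_zero_zero :
    multivariateGaussian (0 : EuclideanSpace ℝ (Fin d)) 0 = Measure.dirac 0 := by
  simp [multivariateGaussian]

end NoNoise

/-! ### Sub-Gaussian noise satisfies the moment conditions -/

section Noise

lemma isNoise_of_isSubGaussianWith {Ω : Type*} [MeasurableSpace Ω] {P : Measure Ω}
    [IsProbabilityMeasure P] {n : ℕ} {E : Ω → Matrix (Fin n) (Fin n) ℝ} {σ K : ℝ}
    (hE_meas : ∀ i j, Measurable fun ω ↦ E ω i j) (hE_mean : ∀ i j, ∫ ω, E ω i j ∂P = 0)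
    (hE_hollow : ∀ ω i, E ω i i = 0) (hE_symm : ∀ ω, (E ω).IsSymm)
    (hE_indep : iIndepFun
      (fun (p : {p : Fin n × Fin n // p.1 < p.2}) ω ↦ E ω p.1.1 p.1.2) P)
    (hE_var : ∀ i j, i ≠ j → Var[fun ω ↦ E ω i j; P] = σ ^ 2)
    (hE_subG : ∀ i j, IsSubGaussianWith (fun ω ↦ E ω i j) K P) :
    IsNoise P E σ (fourthMomentBound K) where
  measurable := hE_meas
  mean := hE_mean
  hollow := hE_hollow
  symm := hE_symm
  indep := hE_indep
  var i j hij := by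
    rw [← hE_var i j hij, variance_of_integral_eq_zero (hE_meas i j).aemeasurable (hE_mean i j)]
  integrable i j := (hE_subG i j).integrable_fourth (hE_meas i j).aemeasurable
  fourth i j := (hE_subG i j).integral_fourth_le (hE_meas i j).aemeasurable

end Noise
end CMDS

theorem theorem1 {Ω : Type*} [MeasurableSpace Ω] (P : Measure Ω) [IsProbabilityMeasure P] (d : ℕ)
    -- the points: i.i.d. from a sub-Gaussian distribution with nonsingular covariance matrix
    (F : Measure (EuclideanSpace ℝ (Fin d))) [IsProbabilityMeasure F]
    (hF : CMDS.IsSubGaussianDistribution F)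
    (hΞ : IsUnit (CMDS.covMatrix F).det)
    (Z : ℕ → Ω → EuclideanSpace ℝ (Fin d))
    (hZ_meas : ∀ k, Measurable (Z k))
    (hZ_law : ∀ k, P.map (Z k) = F)
    (hZ_indep : iIndepFun Z P)
    -- `max_i ∑_j D_ij² ≫ log⁴ n`, in probability
    (hZ_log : ∀ C : ℝ, Tendsto
      (fun n : ℕ ↦ P {ω | C * Real.log n ^ 4 ≤
        ⨆ i : Fin n, ∑ j : Fin n, CMDS.sqDist n (fun k ↦ Z k ω) i j}) atTop (𝓝 1))
    -- the noise: for every `n` a random matrix that is independent of the points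
    (E : (n : ℕ) → Ω → Matrix (Fin n) (Fin n) ℝ) (σ K : ℝ)
    (hE_meas : ∀ n i j, Measurable fun ω ↦ E n ω i j)
    (hEZ_indep : ∀ n : ℕ, IndepFun (fun ω (i j : Fin n) ↦ E n ω i j) (fun ω (k : Fin n) ↦ Z k ω) P)
    (hE_mean : ∀ n i j, ∫ ω, E n ω i j ∂P = 0)
    (hE_hollow : ∀ n ω i, E n ω i i = 0)
    (hE_symm : ∀ n ω, (E n ω).IsSymm)
    (hE_indep : ∀ n : ℕ, iIndepFun
      (fun (p : {p : Fin n × Fin n // p.1 < p.2}) ω ↦ E n ω p.1.1 p.1.2) P)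
    (hE_var : ∀ n i j, i ≠ j → Var[fun ω ↦ E n ω i j; P] = σ ^ 2)
    (hE_subG : ∀ n i j, CMDS.IsSubGaussianWith (fun ω ↦ E n ω i j) K P)
    -- a CMDS embedding of `Δ² = D² + E`, whenever there is one
    (X : (n : ℕ) → Ω → Matrix (Fin n) (Fin d) ℝ)
    (hX_meas : ∀ n i k, Measurable fun ω ↦ X n ω i k)
    (hX : ∀ n ω,
      (∃ Y : Matrix (Fin n) (Fin d) ℝ,
        CMDS.IsCMDSEmbedding (CMDS.sqDist n (fun k ↦ Z k ω) + E n ω) Y) →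
      CMDS.IsCMDSEmbedding (CMDS.sqDist n (fun k ↦ Z k ω) + E n ω) (X n ω)) :
    ∃ W : ℕ → Ω → Matrix (Fin d) (Fin d) ℝ,
      (∀ n ω, W n ω ∈ Matrix.orthogonalGroup (Fin d) ℝ) ∧
      (∀ n k l, Measurable fun ω ↦ W n ω k l) ∧
      ∀ (α : EuclideanSpace ℝ (Fin d)) (i : ℕ),
        Tendsto
          (fun n : ℕ ↦ P {ω | ∀ (hi : i < n) (k : Fin d),
            √(n : ℝ) * ((X n ω * W n ω) ⟨i, hi⟩ k -
              (Z i ω k - CMDS.sampleMean n (fun m ↦ Z m ω) k)) ≤ α k})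
          atTop
          (𝓝 (multivariateGaussian 0 ((σ ^ 2 / 4) • (CMDS.covMatrix F)⁻¹)
            {x | ∀ k : Fin d, x k ≤ α k})) := by
  have hE := fun n ↦ CMDS.isNoise_of_isSubGaussianWith (hE_meas n) (hE_mean n) (hE_hollow n)
    (hE_symm n) (hE_indep n) (hE_var n) (hE_subG n)
  have hreg := CMDS.ae_isRegular hF hZ_meas hZ_law hZ_indep
  have hpos : (CMDS.covMatrix F).PosSemidef := by
    obtain ⟨ω, hω⟩ := hreg.exists
    exact hω.posSemidef
  obtain ⟨w, hw_meas, hw_orth, hw_pos⟩ := CMDS.exists_measurable_polar (κ := Fin d)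
  -- The polar factor of YᵀX aligns the embedding with the centred data; the measurable choice makes
  -- it a random matrix.
  set W : ℕ → Ω → Matrix (Fin d) (Fin d) ℝ := fun n ω ↦
    w fun k l ↦ ((CMDS.centered n fun k ↦ Z k ω)ᵀ * X n ω) k l with hW
  have hW_orth : ∀ n ω, W n ω ∈ Matrix.orthogonalGroup (Fin d) ℝ := fun n ω ↦ hw_orth _
  have hW_meas : ∀ n k l, Measurable fun ω ↦ W n ω k l := fun n k l ↦
    (hw_meas k l).comp (measurable_pi_lambda _ fun k ↦ measurable_pi_lambda _ fun l ↦
      CMDS.measurable_mul_apply (fun a b ↦ CMDS.measurable_centered_apply hZ_meas n b a)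
        (hX_meas n) k l)
  have hA : ∀ n ω, ((CMDS.centered n fun k ↦ Z k ω)ᵀ * X n ω).det ≠ 0 →
      ((CMDS.centered n fun k ↦ Z k ω)ᵀ * X n ω * W n ω).PosSemidef := fun n ω ↦ hw_pos _
  refine ⟨W, hW_orth, hW_meas, fun α i ↦ ?_⟩
  -- For n ≤ i there is no row i and the event is vacuously everything; the shift discards these n.
  rw [← tendsto_add_atTop_iff_nat (i + 1)]
  set N : ℕ → ℕ := fun n ↦ n + (i + 1) with hNdef
  have hN : Tendsto N atTop atTop := tendsto_add_atTop_nat (i + 1)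
  have hiN : ∀ n, i < N n := fun n ↦ by simp only [hNdef]; omega
  set S : Set (EuclideanSpace ℝ (Fin d)) := {x | ∀ k, x k ≤ α k} with hS
  have hSm : MeasurableSet S := by
    simp only [hS, Set.ofPred_forall]
    exact MeasurableSet.iInter fun k ↦ measurableSet_le (by fun_prop) measurable_const
  set D : ℕ → Ω → EuclideanSpace ℝ (Fin d) := fun n ω ↦
    CMDS.rowError ⟨i, hiN n⟩ (fun k ↦ Z k ω) (X (N n) ω) (W (N n) ω) with hD
  have hD_meas : ∀ n, Measurable (D n) := fun n ↦
    CMDS.measurable_rowError hZ_meas (hX_meas (N n)) (hW_meas (N n)) _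
  have hset : ∀ n, {ω | ∀ (hi : i < N n) (k : Fin d),
      √(N n : ℝ) * ((X (N n) ω * W (N n) ω) ⟨i, hi⟩ k -
        (Z i ω k - CMDS.sampleMean (N n) (fun m ↦ Z m ω) k)) ≤ α k} = D n ⁻¹' S := fun n ↦ by
    ext ω
    exact ⟨fun h k ↦ h (hiN n) k, fun h _ k ↦ h k⟩
  change Tendsto (fun n ↦ P {ω | ∀ (hi : i < N n) (k : Fin d),
      √(N n : ℝ) * ((X (N n) ω * W (N n) ω) ⟨i, hi⟩ k -
        (Z i ω k - CMDS.sampleMean (N n) (fun m ↦ Z m ω) k)) ≤ α k}) _ _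
  simp_rw [hset]
  -- For σ = 0 the limit is the point mass at 0, which charges the frontier of the orthant when α ≥
  -- 0 has a zero coordinate. Convergence in distribution is then insufficient, and exact vanishing
  -- of the error with high probability is used.
  rcases eq_or_ne σ 0 with rfl | hσ
  · have h0 : Tendsto (fun n ↦ P {ω | D n ω ≠ 0}) atTop (𝓝 0) := by
      refine ENNReal.tendsto_nhds_zero.2 fun δ hδ ↦ ?_
      filter_upwards [hN.eventually (CMDS.tendsto_measure_rowError_ne_zero hZ_meas hE hreg hΞ hX
        hW_orth hA i hδ)] with n hn
      exact hn (hiN n)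
    have hg : multivariateGaussian (0 : EuclideanSpace ℝ (Fin d))
        (((0 : ℝ) ^ 2 / 4) • (CMDS.covMatrix F)⁻¹) = Measure.dirac 0 := by
      simp [CMDS.multivariateGaussian_zero_zero]
    rw [hg, Measure.dirac_apply' _ hSm]
    by_cases h0S : (0 : EuclideanSpace ℝ (Fin d)) ∈ S
    · rw [Set.indicator_of_mem h0S, Pi.one_apply]
      have h1 : Tendsto (fun n ↦ 1 - P {ω | D n ω ≠ 0}) atTop (𝓝 (1 - 0)) :=
        ENNReal.Tendsto.sub tendsto_const_nhds h0 (by simp)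
      rw [tsub_zero] at h1
      refine tendsto_of_tendsto_of_tendsto_of_le_of_le h1 tendsto_const_nhds (fun n ↦ ?_)
        fun n ↦ prob_le_one
      have h2 : (D n ⁻¹' S)ᶜ ⊆ {ω | D n ω ≠ 0} := fun ω hω h3 ↦ hω (by
        rw [Set.mem_preimage, h3]; exact h0S)
      have h4 := measure_mono (μ := P) h2
      rw [prob_compl_eq_one_sub (hD_meas n hSm)] at h4
      simp only
      rw [tsub_le_iff_right] at h4 ⊢
      rwa [add_comm]
    · rw [Set.indicator_of_notMem h0S]
      refine tendsto_of_tendsto_of_tendsto_of_le_of_le tendsto_const_nhds h0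
        (fun n ↦ zero_le) fun n ↦ measure_mono fun ω hω h3 ↦ h0S ?_
      have h4 : D n ω ∈ S := hω
      rwa [h3] at h4
  · have hpd : ((σ ^ 2 / 4) • (CMDS.covMatrix F)⁻¹).PosDef := by
      have h1 : (CMDS.covMatrix F).PosDef := hpos.posDef_iff_isUnit.2
        ((Matrix.isUnit_iff_isUnit_det _).2 hΞ)
      exact h1.inv.smul (by positivity)
    have hT := CMDS.tendstoInDistribution_linearTerm hZ_meas hE hEZ_indep hreg hΞ hpos hN
      fun n ↦ ⟨i, hiN n⟩
    -- Slutsky's theorem: the row error differs from the linear term by a quantity tending to zero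
    -- in probability.
    have hDlim := tendstoInDistribution_of_tendstoInMeasure_sub D id hT (by
      rw [tendstoInMeasure_iff_norm]
      intro ε hε
      refine ENNReal.tendsto_nhds_zero.2 fun δ hδ ↦ ?_
      filter_upwards [hN.eventually (CMDS.tendsto_measure_rowError_sub hZ_meas hE hEZ_indep hreg hΞ
        hX hW_orth hA i hε hδ)] with n hn
      simpa using hn (hiN n)) fun n ↦ (hD_meas n).aemeasurable
    have key := ProbabilityMeasure.tendsto_measure_of_null_frontier_of_tendsto' hDlim.tendsto
      (E := S) (by simpa using CMDS.multivariateGaussian_frontier_orthant hpd α)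
    simp only [ProbabilityMeasure.coe_mk, Measure.map_id] at key
    refine key.congr fun n ↦ ?_
    rw [Measure.map_apply (hD_meas n) hSm]
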